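/- **Setting.** Index sequences by $a\in\mathbb N_*=\{1,2,\dots\}$. For $s\ge 0$ let $\ell^2_s$ be the space of complex sequences with $\|z\|_s=(\sum_a a^{2s}|z_a|^2)^{1/2}<\infty$. The phase space consists of the pairs $\boldsymbol z=(z,\bar z)$, $z\in\ell^2_s$, with $\|\boldsymbol z\|_s^2=\|z\|_s^2+\|\bar z\|_s^2$ and $B_s(R)=\{\|\boldsymbol z\|_s<R\}$; all vector fields below are real (the $\bar z_a$-component is the conjugate of the $z_a$-component) and the same norm is used for their values. Put $I_a=|z_a|^2$. *The Kirchhoff field.* Let $\varphi$ be the inverse of $x\mapsto x\sqrt{1+2x}$ on $[0,\infty)$, $f(y)=(1+2\varphi(y))^{-3/2}$, $y(z)=\frac14\sum_b|z_b+\bar z_b|^2/b$, and let $X$ be the field with $$X^{(z_a)}=-\mathrm i a z_a-\tfrac{\mathrm i}{4}f(y(z))\Big(\sum_b(z_b^2-\bar z_b^2)\Big)\bar z_a .$$ Write $X=Z_1+\sum_{l=1}^rP_{2l+1}+R_{\ge 2r+3}$ with $Z_1^{(z_a)}=-\mathrm i a z_a$ and $$P_{2l+1}^{(z_a)}=-\frac{\mathrm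 i f^{(l-1)}(0)}{4^l(l-1)!}\Big(\sum_b\frac{z_b^2+\bar z_b^2+2I_b}{b}\Big)^{l-1}\Big(\sum_b(z_b^2-\bar z_b^2)\Big)\bar z_a .$$ *Polynomial fields.* For $j=(\delta,a)\in\{1,-1,0\}\times\mathbb N_*$ let $\zeta_j=z_a^2,\ \bar z_a^2,\ I_a$ if $\delta=1,-1,0$; for $\boldsymbol j=(j_1,\dots,j_l)$, $j_k=(\delta_k,a_k)$, let $\zeta_{\boldsymbol j}=\prod_k\zeta_{j_k}$ and $\Delta_{\boldsymbol j}=\sum_k\delta_ka_k$. $\mathscr M_{2l+1}$ is the set of fields with $$X^{(z_a)}=z_a\sum_{\boldsymbol j}\tilde X^{(z_a,z_a)}_{\boldsymbol j}\zeta_{\boldsymbol j}+\bar z_a\sum_{\boldsymbol j}\tilde X^{(z_a,\bar z_a)}_{\boldsymbol j}\zeta_{\boldsymbol j},$$ with coefficients that are invariant under permutations of $\boldsymbol j$ and bounded; $\|X\|_{\ell^\infty}$ is the supremum of their moduli. The field is reversible if all coefficients are purely imaginary, and resonant if only indices with $\Delta_{\boldsymbol j}=0$ (in the first sum) and $\Delta_{\boldsymbol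 j}=a$ (in the second) occur. Let $\mathcal I^0_l$ be the set of $\boldsymbol j$ with $\Delta_{\boldsymbol j}=0$ for which a permutation $\sigma$ satisfies $\delta_k=-\delta_{\sigma(k)}$, $a_k=a_{\sigma(k)}$ for all $k$, and $\mathcal I^a_l=\{\boldsymbol j:\Delta_{\boldsymbol j}=a,\ (\boldsymbol j,(-1,a))\in\mathcal I^0_{l+1}\}$. The field is integrable if only $\mathcal I^0_l$ and $\mathcal I^a_l$ occur in the two sums; its integrable part is obtained by restricting the two sums to these sets. *The constant $C_0$.* For a fixed $r$, call $C_0>0$ admissible if, for $1\le l\le r$, $P_{2l+1}$ is a reversible element of $\mathscr M_{2l+1}$ with $\|P_{2l+1}\|_{\ell^\infty}\le C_0^l$, and $\|R_{\ge2r+3}(\boldsymbol z)\|_s\le C_0^r\|z\|_s^{2r+3}$ for all $s\ge0$ and $z\in\ell^2_s$. **Theorem.** There is a constant $C_0$ that is admissible for every $r\ge2$. Moreover, let $r\ge 2$ be an integer, let $C_0$ be admissible for $r$, and put $C_1=\max\{C_0,20\}$. For all $s\ge0$ and $0<\varepsilon\le(6rC_1^{r+1})^{-1/2}$ there is a smooth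 coordinate transformation $\phi$ (a $C^\infty$ diffeomorphism between open subsets of the phase space) such that $\phi$ and $\phi^{-1}$ are defined on $B_s(3\varepsilon)$ and map it into $B_s(4\varepsilon)$, and $\phi$ transforms $X$ on $B_s(3\varepsilon)$ into $$X'=Z_1+Z_3+\sum_{l=2}^rK_{2l+1}+R'_{\ge2r+3},$$ that is, for each $\boldsymbol z\in B_s(3\varepsilon)$ with $z\in\ell^2_{s+1}$ (the domain of $Z_1$), $\phi(\boldsymbol z)$ is again in that domain and $D\phi(\boldsymbol z)[X'(\boldsymbol z)]=X(\phi(\boldsymbol z))$. Here: 1. $\|\boldsymbol z-\phi(\boldsymbol z)\|_s\le9C_1\|z\|_s^3$ for $\boldsymbol z\in B_s(3\varepsilon)$, strictly if $z\ne0$; and the same estimate holds for $\phi^{-1}$ on $B_s(3\varepsilon)$ and on $\phi(B_s(3\varepsilon))$. 2. $Z_3=-\frac{\mathrm i}{4}\sum_aI_a(z_a\partial_{z_a}-\bar z_a\partial_{\bar z_a})$ is an integrable reversible polynomial field. 3. For $2\le l\le r$, $K_{2l+1}\in\mathscr M_{2l+1}$ is resonant and reversible, and $\|K_{2l+1}\|_{\ell^\infty}\le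 C_1^{l^2}$. 4. $R'_{\ge2r+3}$ is continuous from $B_s(3\varepsilon)$ to the phase space, and $\|R'_{\ge2r+3}(\boldsymbol z)\|_s\le(3C_1)^{r(r+1)}\|z\|_s^{2r+3}$, strictly if $z\neq0$. Moreover $$K_5^{(z_a)}=Z_5^{(z_a)}+\mathrm i\frac{3a}{32}\bar z_a\Big(\sum_{b_1+b_2=a}\frac{z_{b_1}^2z_{b_2}^2}{b_1b_2}+\sum_{b-c=a}\frac{2z_b^2\bar z_c^2}{bc}\Big),$$ and the integrable part of $K_5$ is $$Z_5^{(z_a)}=\mathrm iz_a\Big(\frac{27}{64a}I_a^2+\frac18I_a\sum_{d\ne a}\Big(\frac3d+\frac d{d^2-a^2}\Big)I_d-\frac a{16}\sum_{d\ne a}\frac1{d^2-a^2}I_d^2\Big).$$ -/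

import Mathlib

open scoped ContDiff ComplexConjugate
open Set

noncomputable section

/-! ### The Sobolev spaces of sequences -/

/-- `∑ a^{2s} |u_a|² < ∞`, i.e. `u` belongs to `ℓ²_s`. -/
def IsSobolev (s : ℝ) (u : ℕ+ → ℂ) : Prop :=
  Summable fun a : ℕ+ => (a : ℝ) ^ (2 * s) * ‖u a‖ ^ 2

/-- `‖u‖_s = (∑ a^{2s} |u_a|²)^{1/2}`. -/
def sobNorm (s : ℝ) (u : ℕ+ → ℂ) : ℝ :=
  √(∑' a : ℕ+, (a : ℝ) ^ (2 * s) * ‖u a‖ ^ 2)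

/-- `‖(u, ū)‖_s = (‖u‖_s² + ‖ū‖_s²)^{1/2}`, the norm on the phase space. A point (or a real
vector) of the phase space is a pair `(z, z̄)`, so it is given by its first entry `z`. -/
def phaseNorm (s : ℝ) (u : ℕ+ → ℂ) : ℝ :=
  √(sobNorm s u ^ 2 + sobNorm s (fun a => conj (u a)) ^ 2)

theorem weight_sq (s : ℝ) (a : ℕ+) (w : ℂ) :
    ‖(((a : ℝ) ^ s : ℝ) : ℂ) * w‖ ^ 2 = (a : ℝ) ^ (2 * s) * ‖w‖ ^ 2 := by
  have ha : (0 : ℝ) ≤ (a : ℝ) := Nat.cast_nonneg _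
  rw [norm_mul, mul_pow, Complex.norm_real, Real.norm_of_nonneg (Real.rpow_nonneg ha s),
    mul_comm 2 s, Real.rpow_mul ha, Real.rpow_two]

theorem isSobolev_iff (s : ℝ) (u : ℕ+ → ℂ) :
    IsSobolev s u ↔ Memℓp (fun a : ℕ+ => (((a : ℝ) ^ s : ℝ) : ℂ) * u a) 2 := by
  rw [memℓp_gen_iff (by norm_num)]
  unfold IsSobolev
  simp only [ENNReal.toReal_ofNat, Real.rpow_two, weight_sq]

/-- `ℓ²_s` as a space of sequences. -/
def sobolevSubmodule (s : ℝ) : Submodule ℂ (ℕ+ → ℂ) where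
  carrier := {u | IsSobolev s u}
  add_mem' {u v} hu hv := by
    simp only [mem_ofPred_eq, isSobolev_iff] at hu hv ⊢
    convert hu.add hv using 1
    funext a
    simp [mul_add]
  zero_mem' := by simp [IsSobolev, summable_zero]
  smul_mem' c u hu := by
    simp only [mem_ofPred_eq, isSobolev_iff] at hu ⊢
    convert hu.const_smul c using 1
    funext a
    simp [mul_left_comm]

/-- `ℓ²_s`, with the norm `‖·‖_s` (see `Ell2.norm_eq`). It is a type of its own, because the
subtype would carry the topology of pointwise convergence. -/
def Ell2 (s : ℝ) : Type := ↥(sobolevSubmodule s)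

namespace Ell2

instance (s : ℝ) : AddCommGroup (Ell2 s) := inferInstanceAs (AddCommGroup ↥(sobolevSubmodule s))

instance (s : ℝ) : Module ℂ (Ell2 s) := inferInstanceAs (Module ℂ ↥(sobolevSubmodule s))

instance (s : ℝ) : CoeFun (Ell2 s) fun _ => ℕ+ → ℂ := ⟨fun z => Subtype.val z⟩

theorem isSobolev {s : ℝ} (z : Ell2 s) : IsSobolev s z := Subtype.property z

/-- The map `z ↦ (a^s z_a)_a` onto the unweighted `ℓ²`. -/
def toLp (s : ℝ) : Ell2 s →ₗ[ℂ] lp (fun _ : ℕ+ => ℂ) 2 where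
  toFun z := ⟨fun a => (((a : ℝ) ^ s : ℝ) : ℂ) * z a, (isSobolev_iff s z).1 z.isSobolev⟩
  map_add' x y := by
    ext a
    exact mul_add _ _ _
  map_smul' c x := by
    ext a
    exact mul_left_comm _ _ _

theorem toLp_injective (s : ℝ) : Function.Injective (toLp s) := by
  intro x y h
  apply Subtype.ext
  funext a
  have h1 : (((a : ℝ) ^ s : ℝ) : ℂ) * x a = (((a : ℝ) ^ s : ℝ) : ℂ) * y a :=
    congrFun (congrArg Subtype.val h) a
  have h2 : (((a : ℝ) ^ s : ℝ) : ℂ) ≠ 0 := by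
    have : (0 : ℝ) < (a : ℝ) := by exact_mod_cast a.pos
    exact_mod_cast (Real.rpow_pos_of_pos this s).ne'
  exact mul_left_cancel₀ h2 h1

instance (s : ℝ) : NormedAddCommGroup (Ell2 s) :=
  NormedAddCommGroup.induced (Ell2 s) (lp (fun _ : ℕ+ => ℂ) 2) (toLp s) (toLp_injective s)

instance (s : ℝ) : NormedSpace ℂ (Ell2 s) :=
  NormedSpace.induced ℂ (Ell2 s) (lp (fun _ : ℕ+ => ℂ) 2) (toLp s)

theorem norm_eq {s : ℝ} (z : Ell2 s) : ‖z‖ = sobNorm s z := by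
  have h : ‖toLp s z‖ ^ 2 = ∑' a : ℕ+, (a : ℝ) ^ (2 * s) * ‖z a‖ ^ 2 := by
    have := lp.norm_rpow_eq_tsum (p := 2) (by norm_num) (toLp s z)
    simp only [ENNReal.toReal_ofNat, Real.rpow_two] at this
    rw [this]
    exact tsum_congr fun a => weight_sq s a (z a)
  unfold sobNorm
  rw [← h, Real.sqrt_sq (norm_nonneg _)]
  rfl

end Ell2

/-- The open ball `B_s(R)` of the phase space. -/
def phaseBall (s R : ℝ) : Set (Ell2 s) := {z | phaseNorm s z < R}

/-! ### Polynomial vector fields -/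

/-- The index `(δ, a)` with `δ ∈ {1, -1, 0}` and `a ≥ 1`. -/
abbrev ZIndex : Type := SignType × ℕ+

/-- `(δ, a) ↦ (-δ, a)`. -/
def ZIndex.bar (j : ZIndex) : ZIndex := (-j.1, j.2)

/-- `ζ_{(1,a)} = z_a²`, `ζ_{(-1,a)} = z̄_a²`, `ζ_{(0,a)} = I_a = |z_a|²`. -/
def zeta (z : ℕ+ → ℂ) (j : ZIndex) : ℂ :=
  match j.1 with
  | SignType.pos => z j.2 ^ 2
  | SignType.neg => conj (z j.2) ^ 2
  | SignType.zero => ((‖z j.2‖ ^ 2 : ℝ) : ℂ)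

/-- The monomial `ζ_{j_1} ⋯ ζ_{j_l}`. -/
def zetaProd {l : ℕ} (z : ℕ+ → ℂ) (j : Fin l → ZIndex) : ℂ := ∏ k, zeta z (j k)

/-- `(j_1, …, j_l) ↦ (j̄_1, …, j̄_l)`. -/
def barIndex {l : ℕ} (j : Fin l → ZIndex) : Fin l → ZIndex := fun k => (j k).bar

/-- An element of `𝓜_{2l+1}`, given by its coefficients: `zz`, `zb`, `bb`, `bz` are the
coefficients with upper indices `(z_a, z_a)`, `(z_a, z̄_a)`, `(z̄_a, z̄_a)`, `(z̄_a, z_a)`. -/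
structure PolyField (l : ℕ) where
  zz : ℕ+ → (Fin l → ZIndex) → ℂ
  zb : ℕ+ → (Fin l → ZIndex) → ℂ
  bb : ℕ+ → (Fin l → ZIndex) → ℂ
  bz : ℕ+ → (Fin l → ZIndex) → ℂ
  zz_eq : ∀ a j, zz a j = conj (bb a j)
  zb_eq : ∀ a j, zb a j = conj (bz a j)
  bddAbove : BddAbove (range fun p : ℕ+ × (Fin l → ZIndex) => max ‖zz p.1 p.2‖ ‖zb p.1 p.2‖)
  zz_perm : ∀ a j (σ : Equiv.Perm (Fin l)), zz a (fun k => j (σ k)) = zz a j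
  zb_perm : ∀ a j (σ : Equiv.Perm (Fin l)), zb a (fun k => j (σ k)) = zb a j

namespace PolyField

variable {l : ℕ}

/-- The `z_a`-component. -/
def compZ (X : PolyField l) (z : ℕ+ → ℂ) (a : ℕ+) : ℂ :=
  z a * ∑' j : Fin l → ZIndex, X.zz a j * zetaProd z j
    + conj (z a) * ∑' j : Fin l → ZIndex, X.zb a j * zetaProd z j

/-- The `z̄_a`-component. -/
def compZbar (X : PolyField l) (z : ℕ+ → ℂ) (a : ℕ+) : ℂ :=
  conj (z a) * ∑' j : Fin l → ZIndex, X.bb a j * zetaProd z (barIndex j)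
    + z a * ∑' j : Fin l → ZIndex, X.bz a j * zetaProd z (barIndex j)

/-- `‖X‖_{ℓ^∞}`. -/
def coeffNorm (X : PolyField l) : ℝ :=
  ⨆ p : ℕ+ × (Fin l → ZIndex), max ‖X.zz p.1 p.2‖ ‖X.zb p.1 p.2‖

/-- The reversible condition: `X ∈ 𝓜^rev_{2l+1}`. -/
def IsReversible (X : PolyField l) : Prop :=
  ∀ a j, X.zz a j = -X.bb a j ∧ X.zb a j = -X.bz a j

end PolyField

theorem zeta_bar (z : ℕ+ → ℂ) (j : ZIndex) : zeta z j.bar = conj (zeta z j) := by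
  obtain ⟨δ, a⟩ := j
  cases δ
  · change (((‖z a‖ ^ 2 : ℝ)) : ℂ) = conj (((‖z a‖ ^ 2 : ℝ)) : ℂ)
    rw [Complex.conj_ofReal]
  · change z a ^ 2 = conj (conj (z a) ^ 2)
    simp
  · change conj (z a) ^ 2 = conj (z a ^ 2)
    simp

/-- The `z̄_a`-component is the conjugate of the `z_a`-component, so an identity between real
vector fields need only be stated for the `z_a`-components. -/
theorem PolyField.compZbar_eq {l : ℕ} (X : PolyField l) (z : ℕ+ → ℂ) (a : ℕ+) :
    X.compZbar z a = conj (X.compZ z a) := by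
  have hz (j : Fin l → ZIndex) : zetaProd z (barIndex j) = conj (zetaProd z j) := by
    simp [zetaProd, barIndex, zeta_bar, map_prod]
  simp only [PolyField.compZbar, PolyField.compZ, map_add, map_mul, Complex.conj_tsum, X.zz_eq,
    X.zb_eq, Complex.conj_conj, hz]

/-- `Δ_j = ∑ δ_k a_k`. -/
def resDelta {l : ℕ} (j : Fin l → ZIndex) : ℤ := ∑ k, ((j k).1 : ℤ) * ((j k).2 : ℤ)

/-- The index set `𝓡^b_l`. -/
def resSet (l : ℕ) (b : ℤ) : Set (Fin l → ZIndex) := {j | resDelta j = b}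

/-- The integrable index set `𝓘^0_l`. -/
def intSetZero (l : ℕ) : Set (Fin l → ZIndex) :=
  {j | j ∈ resSet l 0 ∧ ∃ σ : Equiv.Perm (Fin l), ∀ k,
    (j k).1 = -(j (σ k)).1 ∧ (j k).2 = (j (σ k)).2}

/-- The integrable index set `𝓘^a_l`: the `j ∈ 𝓡^a_l` with `(j, (-1, a)) ∈ 𝓘^0_{l+1}`. -/
def intSet (l : ℕ) (a : ℕ+) : Set (Fin l → ZIndex) :=
  {j | j ∈ resSet l (a : ℤ) ∧
    (Fin.snoc j ((-1 : SignType), a) : Fin (l + 1) → ZIndex) ∈ intSetZero (l + 1)}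

namespace PolyField

variable {l : ℕ}

/-- `X ∈ 𝓡_{2l+1}`: only indices in `𝓡^0_l`, respectively `𝓡^a_l`, occur. -/
def IsResonant (X : PolyField l) : Prop :=
  ∀ a j, (j ∉ resSet l 0 → X.zz a j = 0 ∧ X.bb a j = 0) ∧
    (j ∉ resSet l (a : ℤ) → X.zb a j = 0 ∧ X.bz a j = 0)

/-- `X ∈ 𝓘_{2l+1}`: only indices in `𝓘^0_l`, respectively `𝓘^a_l`, occur. -/
def IsIntegrable (X : PolyField l) : Prop :=
  ∀ a j, (j ∉ intSetZero l → X.zz a j = 0 ∧ X.bb a j = 0) ∧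
    (j ∉ intSet l a → X.zb a j = 0 ∧ X.bz a j = 0)

/-- The `z_a`-component of the integrable part of `X`. -/
def intCompZ (X : PolyField l) (z : ℕ+ → ℂ) (a : ℕ+) : ℂ :=
  z a * ∑' j : intSetZero l, X.zz a j * zetaProd z (j : Fin l → ZIndex)
    + conj (z a) * ∑' j : intSet l a, X.zb a j * zetaProd z (j : Fin l → ZIndex)

end PolyField

/-! ### The Kirchhoff vector field -/

/-- `φ`, the inverse of `x ↦ x √(1 + 2x)` on `[0, ∞)`. -/
def kirPhi (y : ℝ) : ℝ := Function.invFunOn (fun x : ℝ => x * √(1 + 2 * x)) (Ici 0) y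

/-- `f(y) = (1 + 2 φ(y))^{-3/2}`. -/
def kirF (y : ℝ) : ℝ := (1 + 2 * kirPhi y) ^ (-(3 / 2) : ℝ)

/-- `y(z, z̄) = (1/4) ∑ |z_b + z̄_b|² / b`. -/
def kirY (z : ℕ+ → ℂ) : ℝ := 1 / 4 * ∑' b : ℕ+, ‖z b + conj (z b)‖ ^ 2 / (b : ℝ)

/-- `∑ (z_b² - z̄_b²)`. -/
def kirS (z : ℕ+ → ℂ) : ℂ := ∑' b : ℕ+, (z b ^ 2 - conj (z b) ^ 2)

/-- The linear field `Z_1`: its `z_a`-component is `-i a z_a`. -/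
def linField (z : ℕ+ → ℂ) (a : ℕ+) : ℂ := -Complex.I * (a : ℂ) * z a

/-- The `z_a`-component of the Kirchhoff vector field `X`. -/
def kirField (z : ℕ+ → ℂ) (a : ℕ+) : ℂ :=
  linField z a - Complex.I / 4 * (kirF (kirY z) : ℂ) * kirS z * conj (z a)

/-- The `z_a`-component of the homogeneous part `P_{2l+1}` of `X`, for `l ≥ 1`. -/
def kirP (l : ℕ) (z : ℕ+ → ℂ) (a : ℕ+) : ℂ :=
  -(Complex.I * ((iteratedDerivWithin (l - 1) kirF (Ici 0) 0 : ℝ) : ℂ) /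
      (4 ^ l * ((l - 1).factorial : ℂ)))
    * (∑' b : ℕ+, (z b ^ 2 + conj (z b) ^ 2 + 2 * ((‖z b‖ ^ 2 : ℝ) : ℂ)) / (b : ℂ)) ^ (l - 1)
    * kirS z * conj (z a)

/-- The `z_a`-component of the remainder `R_{≥2r+3} = X - Z_1 - ∑_{l=1}^r P_{2l+1}`. -/
def kirR (r : ℕ) (z : ℕ+ → ℂ) (a : ℕ+) : ℂ :=
  kirField z a - linField z a - ∑ l ∈ Finset.Icc 1 r, kirP l z a

/-- `C₀ > 0` is a constant with `‖P_{2l+1}‖_{ℓ^∞} ≤ C₀^l` for `1 ≤ l ≤ r` (where `P_{2l+1}` is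
written as an element of `𝓜^rev_{2l+1}`) and `‖R_{≥2r+3}(z)‖_s ≤ C₀^r ‖z‖_s^{2r+3}`
for all `s ≥ 0`. -/
def IsStructureConstant (r : ℕ) (C₀ : ℝ) : Prop :=
  0 < C₀ ∧
  (∀ l : ℕ, 1 ≤ l → l ≤ r → ∃ P : PolyField l, P.IsReversible ∧
    (∀ z : Ell2 0, ∀ a, P.compZ z a = kirP l z a) ∧ P.coeffNorm ≤ C₀ ^ l) ∧
  ∀ s : ℝ, 0 ≤ s → ∀ z : Ell2 s,
    IsSobolev s (kirR r z) ∧ phaseNorm s (kirR r z) ≤ C₀ ^ r * sobNorm s z ^ (2 * r + 3)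

/-- The change of variables `φ` transforms the field `X` into `X'` on `U ⊆ ℓ²_s`, that is
`Dφ(z)[X'(z)] = X(φ(z))`. Both fields contain the unbounded operator `Z_1`, hence take values in
`ℓ²_s` only at the points of its domain `ℓ²_{s+1}`, which `φ` has to preserve. -/
def TransformsInto {s : ℝ} (φ : Ell2 s → Ell2 s) (U : Set (Ell2 s))
    (X : (ℕ+ → ℂ) → ℕ+ → ℂ) (X' : Ell2 s → ℕ+ → ℂ) : Prop :=
  ∀ z ∈ U, IsSobolev (s + 1) z → IsSobolev (s + 1) (φ z) ∧
    ∃ v : Ell2 s, (∀ a, v a = X' z a) ∧ ∀ a, (fderiv ℝ φ z v) a = X (φ z) a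

/-- The `z_a`-component of `Z_5`. -/
def kirZ5 (z : ℕ+ → ℂ) (a : ℕ+) : ℂ :=
  Complex.I * z a *
    (27 / (64 * (a : ℂ)) * ((‖z a‖ ^ 2 : ℝ) : ℂ) ^ 2
      + 1 / 8 * ((‖z a‖ ^ 2 : ℝ) : ℂ) * ∑' d : {d : ℕ+ // d ≠ a},
          (3 / (d : ℂ) + (d : ℂ) / ((d : ℂ) ^ 2 - (a : ℂ) ^ 2)) * ((‖z d‖ ^ 2 : ℝ) : ℂ)
      - (a : ℂ) / 16 * ∑' d : {d : ℕ+ // d ≠ a},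
          1 / ((d : ℂ) ^ 2 - (a : ℂ) ^ 2) * ((‖z d‖ ^ 2 : ℝ) : ℂ) ^ 2)

/-- The `z_a`-component of `K_5`. -/
def kirK5 (z : ℕ+ → ℂ) (a : ℕ+) : ℂ :=
  kirZ5 z a + Complex.I * (3 * (a : ℂ) / 32) * conj (z a) *
    ((∑' p : {p : ℕ+ × ℕ+ // p.1 + p.2 = a},
        z p.1.1 ^ 2 * z p.1.2 ^ 2 / ((p.1.1 : ℂ) * (p.1.2 : ℂ)))
      + ∑' p : {p : ℕ+ × ℕ+ // p.1 = p.2 + a},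
        2 * z p.1.1 ^ 2 * conj (z p.1.2) ^ 2 / ((p.1.1 : ℂ) * (p.1.2 : ℂ)))

end

/-! The transformation is sought in one stroke, as a polynomial map id + F, and not as a composition
of flows. The z_a-component of F is z_a A_a(ζ) + z̄_a B_a(ζ), where A_a and B_a are polynomials in
the quadratic monomials ζ_j; the normal form is Z_1 + iκ, with κ of the same shape and coefficients
kA_a, kB_a. All four families are real, which is what makes the normal form reversible. Along Z_1 a
monomial of weight Δ is multiplied by -2iΔ. Comparing coefficients in D(id + F)[Z_1 + iκ] = X∘(id +
F) therefore gives kA_a - 2Δ A_a = ρA_a and kB_a + 2(a - Δ) B_a = ρB_a. The right-hand sides `rhoA`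
and `rhoB` collect the polynomial part of X along id + F and the derivative of F along iκ.

These equations are triangular: in degree n + 1 the right-hand side depends only on coefficients of
degree at most n (`Agree.rhoA`, `Agree.rhoB`). They are solved degree by degree (`nf`, `nf_spec`):
resonant words go into κ, all others are divided by twice a nonzero integer and go into F. There are
no small divisors. The letters do not commute in the formal computation. Coefficients are thus
functions of words, products are convolutions, and proofs go by recursion on the first letter;
symmetrization is needed only at the end, to obtain elements of 𝓜 (`tsum_symF`).

The quantitative part is a majorant argument. With k_n = ∑_{i ≤ n} c^{i(i-1)} X^i majorizing κ and
k_n/2 majorizing A and B, the right-hand side has the majorant `qPoly`. At the point c^{-n} both k_n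
and X k_n' are at most 1/20, hence `qPoly`, cut off at Taylor index n + 1, is at most 1
(`qPoly_eval_le`). Cauchy's estimate bounds its coefficient of degree n + 1 by c^{n(n+1)}, which is
the next coefficient of the majorant (`coeff_qPoly_le`, `maj_nf`). The Taylor coefficients of f
enter through `CoeffBound`, which an admissible constant implies by testing P_{2l+1} on one explicit
sequence.

In the analysis, coefficient families form a sup-normed space on which summable families act by
contraction of the first letter, so F is a smooth map of ℓ²_s (`contDiff_polyMap`). On the balls in
question ‖DF‖ ≤ 1/4, so id + F is a diffeomorphism with quantitative image
(`exists_openPartialHomeomorph`), and 1 + DF can be inverted to define R' (`exists_pullback`). What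
R' has to absorb is the part of ρ of degree above r and the Taylor remainder of X. The first is
small because it vanishes to order r + 1 in ζ (`norm_E_le_of_eq_zero`). The identity
`transformed_field` joins the algebra to the analysis.

The formulas for Z_3, K_5 and Z_5 come from evaluating the recursion on words of length one and two
(`nf_B_singleton`, `nf_kA_values`, `nf_kB_values`) and summing. -/

noncomputable section

/-! ### Series in noncommuting letters -/

/-- A formal series with real coefficients in the noncommuting letters `ZIndex`, given by its
coefficients. -/
abbrev Ser : Type := List ZIndex → ℝ

namespace Ser

/-- The series `c_j` in `c = c_∅ + ∑ j c_j`. -/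
def tl (c : Ser) (j : ZIndex) : Ser := fun w => c (j :: w)

theorem tl_apply (c : Ser) (j : ZIndex) (w : List ZIndex) : tl c j w = c (j :: w) := rfl

/-- The coefficient of the product `c d` at a word. -/
def convAux : List ZIndex → Ser → Ser → ℝ
  | [], c, d => c [] * d []
  | j :: w, c, d => c [] * d (j :: w) + convAux w (tl c j) d

/-- The product of two series. -/
def conv (c d : Ser) : Ser := fun w => convAux w c d

theorem conv_nil (c d : Ser) : conv c d [] = c [] * d [] := rfl

theorem conv_cons (c d : Ser) (j : ZIndex) (w : List ZIndex) :
    conv c d (j :: w) = c [] * d (j :: w) + conv (tl c j) d w := rfl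

theorem tl_conv (c d : Ser) (j : ZIndex) :
    tl (conv c d) j = c [] • tl d j + conv (tl c j) d := by
  funext w
  simp [tl_apply, conv_cons]

/-- The unit series. -/
def one : Ser := fun w => if w = [] then 1 else 0

/-- The linear combination `∑ j g_j` of letters. -/
def lin (g : ZIndex → Ser) : Ser
  | [] => 0
  | j :: w => g j w

theorem lin_nil (g : ZIndex → Ser) : lin g [] = 0 := rfl

theorem lin_cons (g : ZIndex → Ser) (j : ZIndex) (w : List ZIndex) : lin g (j :: w) = g j w := rfl

/-- The conjugate of a series. -/
def bar (c : Ser) : Ser := fun w => c (w.map ZIndex.bar)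

theorem bar_apply (c : Ser) (w : List ZIndex) : bar c w = c (w.map ZIndex.bar) := rfl

/-- The powers of a series. -/
def powS (c : Ser) : ℕ → Ser
  | 0 => one
  | n + 1 => conv c (powS c n)

/-- The part of the derivative of `c` along the field with coefficients `iκ` that results from
the first letters, as a family indexed by the new first letter. -/
def derHead (kA kB : ℕ+ → Ser) (c : Ser) : ZIndex → Ser
  -- Along iκ, divided by i, ζ_{(1,b)} has derivative 2 kA ζ_1 + 2 kB ζ_0, ζ_{(-1,b)} has -2 k̄A
  -- ζ_{-1} - 2 k̄B ζ_0, and ζ_{(0,b)} has (kA - k̄A) ζ_0 + kB ζ_{-1} - k̄B ζ_1. The cases sort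
  -- these terms by the letter that they produce.
  | (SignType.pos, b) =>
      conv ((2 : ℝ) • kA b) (tl c (1, b)) - conv (bar (kB b)) (tl c (0, b))
  | (SignType.neg, b) =>
      conv (kB b) (tl c (0, b)) - conv ((2 : ℝ) • bar (kA b)) (tl c (-1, b))
  | (SignType.zero, b) =>
      conv ((2 : ℝ) • kB b) (tl c (1, b)) - conv ((2 : ℝ) • bar (kB b)) (tl c (-1, b))
        + conv (kA b - bar (kA b)) (tl c (0, b))

/-- The coefficient of `derS` at a word. -/
def derAux (kA kB : ℕ+ → Ser) : List ZIndex → Ser → ℝ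
  | [], _ => 0
  | j :: w, c => derHead kA kB c j w + derAux kA kB w (tl c j)

/-- The derivative of `c` along the field `iκ`, divided by `i`. -/
def derS (kA kB : ℕ+ → Ser) (c : Ser) : Ser := fun w => derAux kA kB w c

theorem derS_nil (kA kB : ℕ+ → Ser) (c : Ser) : derS kA kB c [] = 0 := rfl

theorem derS_cons (kA kB : ℕ+ → Ser) (c : Ser) (j : ZIndex) (w : List ZIndex) :
    derS kA kB c (j :: w) = derHead kA kB c j w + derS kA kB (tl c j) w := rfl

/-- `φ_b + φ̄_b = z_b G_b + z̄_b Ḡ_b`. -/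
def serG (A B : ℕ+ → Ser) (b : ℕ+) : Ser := one + A b + bar (B b)

/-- `φ_b - φ̄_b = z_b H_b - z̄_b H̄_b`. -/
def serH (A B : ℕ+ → Ser) (b : ℕ+) : Ser := one + A b - bar (B b)

/-- The coefficients of `∑ (φ_b + φ̄_b)² / b`. -/
def yHead (A B : ℕ+ → Ser) : ZIndex → Ser
  | (SignType.pos, b) => (b : ℝ)⁻¹ • conv (serG A B b) (serG A B b)
  | (SignType.neg, b) => (b : ℝ)⁻¹ • conv (bar (serG A B b)) (bar (serG A B b))
  | (SignType.zero, b) => (2 * (b : ℝ)⁻¹) • conv (serG A B b) (bar (serG A B b))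

/-- The coefficients of `∑ (φ_b² - φ̄_b²)`. -/
def sHead (A B : ℕ+ → Ser) : ZIndex → Ser
  | (SignType.pos, b) => conv (serH A B b) (serG A B b)
  | (SignType.neg, b) => -conv (bar (serH A B b)) (bar (serG A B b))
  | (SignType.zero, b) => conv (serH A B b) (bar (serG A B b))
      - conv (bar (serH A B b)) (serG A B b)

/-- `∑_{m ≤ r} c_m Y^{m-1} S` evaluated along the transformation with coefficients `A`, `B`. -/
def pSer (r : ℕ) (cf : ℕ → ℝ) (A B : ℕ+ → Ser) : Ser :=
  ∑ m ∈ Finset.Icc 1 r, cf m • conv (powS (lin (yHead A B)) (m - 1)) (lin (sHead A B))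

/-- The `z_a`-coefficient of the derivative of `F` along `iκ`, divided by `i`. -/
def dSerA (A B kA kB : ℕ+ → Ser) (a : ℕ+) : Ser :=
  conv (kA a) (A a) - conv (bar (kB a)) (B a) + derS kA kB (A a)

/-- The `z̄_a`-coefficient of the derivative of `F` along `iκ`, divided by `i`. -/
def dSerB (A B kA kB : ℕ+ → Ser) (a : ℕ+) : Ser :=
  conv (kB a) (A a) - conv (bar (kA a)) (B a) + derS kA kB (B a)

/-- The `z_a`-coefficient of the right-hand side of the homological equation. -/
def rhoA (r : ℕ) (cf : ℕ → ℝ) (A B kA kB : ℕ+ → Ser) (a : ℕ+) : Ser :=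
  -conv (pSer r cf A B) (bar (B a)) - dSerA A B kA kB a

/-- The `z̄_a`-coefficient of the right-hand side of the homological equation. -/
def rhoB (r : ℕ) (cf : ℕ → ℝ) (A B kA kB : ℕ+ → Ser) (a : ℕ+) : Ser :=
  -conv (pSer r cf A B) (one + bar (A a)) - dSerB A B kA kB a

/-! ### Majorants -/

open Polynomial in
/-- The polynomial `p` majorizes the series `c`. -/
def Maj (c : Ser) (p : ℝ[X]) : Prop := ∀ w, |c w| ≤ p.coeff w.length

section majorants

open Polynomial

variable {c d : Ser} {p q : ℝ[X]}

theorem Maj.coeff_nonneg (h : Maj c p) (l : ℕ) : 0 ≤ p.coeff l := by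
  have := h (List.replicate l (0, 1))
  rw [List.length_replicate] at this
  exact (abs_nonneg _).trans this

theorem Maj.mono (h : Maj c p) (hpq : ∀ l, p.coeff l ≤ q.coeff l) : Maj c q :=
  fun w => (h w).trans (hpq _)

theorem Maj.zero : Maj 0 0 := fun w => by simp

theorem Maj.neg (h : Maj c p) : Maj (-c) p := fun w => by simpa using h w

theorem Maj.add (hc : Maj c p) (hd : Maj d q) : Maj (c + d) (p + q) := fun w => by
  rw [coeff_add]
  exact (abs_add_le _ _).trans (add_le_add (hc w) (hd w))

theorem Maj.sub (hc : Maj c p) (hd : Maj d q) : Maj (c - d) (p + q) := by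
  rw [sub_eq_add_neg]
  exact hc.add hd.neg

theorem Maj.smul (x : ℝ) (hc : Maj c p) : Maj (x • c) (C |x| * p) := fun w => by
  rw [coeff_C_mul, Pi.smul_apply, smul_eq_mul, abs_mul]
  exact mul_le_mul_of_nonneg_left (hc w) (abs_nonneg _)

theorem Maj.sum {ι : Type*} (s : Finset ι) {f : ι → Ser} {g : ι → ℝ[X]}
    (h : ∀ i ∈ s, Maj (f i) (g i)) : Maj (∑ i ∈ s, f i) (∑ i ∈ s, g i) := by
  classical
  induction s using Finset.induction_on with
  | empty => simpa using Maj.zero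
  | insert i s hi ih =>
    rw [Finset.sum_insert hi, Finset.sum_insert hi]
    exact (h i (Finset.mem_insert_self _ _)).add
      (ih fun k hk => h k (Finset.mem_insert_of_mem hk))

theorem Maj.tl (hc : Maj c p) (j : ZIndex) : Maj (tl c j) (divX p) := fun w => by
  rw [coeff_divX]
  exact hc (j :: w)

theorem Maj.bar (hc : Maj c p) : Maj (bar c) p := fun w => by
  simpa only [bar_apply, List.length_map] using hc (w.map ZIndex.bar)

theorem Maj.one : Maj one 1 := fun w => by
  rw [coeff_one, Ser.one]
  cases w <;> simp

/-- `divX` does to a majorant what `tl` does to a series, so this is the counterpart of `conv_cons`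
and lets `Maj.conv` go through by induction on the word. -/
theorem coeff_mul_succ_divX (p q : ℝ[X]) (n : ℕ) :
    (p * q).coeff (n + 1) = p.coeff 0 * q.coeff (n + 1) + (divX p * q).coeff n := by
  conv_lhs => rw [← divX_mul_X_add p]
  rw [add_mul, coeff_add, mul_right_comm, coeff_mul_X, coeff_C_mul, add_comm]

theorem Maj.conv (hc : Maj c p) (hd : Maj d q) : Maj (conv c d) (p * q) := by
  intro w
  induction w generalizing c p with
  | nil =>
    rw [conv_nil, abs_mul, List.length_nil, mul_coeff_zero]
    exact mul_le_mul (hc []) (hd []) (abs_nonneg _) (hc.coeff_nonneg 0)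
  | cons j w ih =>
    rw [conv_cons, List.length_cons, coeff_mul_succ_divX]
    refine (abs_add_le _ _).trans (add_le_add ?_ (ih (hc.tl j)))
    rw [abs_mul]
    exact mul_le_mul (hc []) (hd (j :: w)) (abs_nonneg _) (hc.coeff_nonneg 0)

theorem Maj.powS (hc : Maj c p) (n : ℕ) : Maj (powS c n) (p ^ n) := by
  induction n with
  | zero => simpa only [pow_zero] using! Maj.one
  | succ n ih =>
    rw [pow_succ', Ser.powS]
    exact hc.conv ih

theorem Maj.lin {g : ZIndex → Ser} (h : ∀ j, Maj (g j) p) : Maj (lin g) (X * p) := by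
  intro w
  cases w with
  | nil => simp [lin_nil]
  | cons j w =>
    rw [lin_cons, List.length_cons, coeff_X_mul]
    exact h j w

/-- The Euler operator obeys the same first-letter recursion as `derS`: one term for the first
letter, one for the rest. -/
theorem X_mul_derivative_divX (p : ℝ[X]) :
    X * derivative p = X * divX p + X * (X * derivative (divX p)) := by
  conv_lhs => rw [← divX_mul_X_add p]
  simp only [derivative_add, derivative_mul, derivative_X, derivative_C]
  ring

/-- The letter of sign zero is the worst case and gives the constant: 2 + 2 + (1 + 1) = 6. -/
theorem Maj.derHead {kA kB : ℕ+ → Ser} {k : ℝ[X]} (hA : ∀ a, Maj (kA a) k)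
    (hB : ∀ a, Maj (kB a) k) (hc : Maj c p) (j : ZIndex) :
    Maj (derHead kA kB c j) (C 6 * k * divX p) := by
  have hk := (hA 1).coeff_nonneg
  have hkp : ∀ l, 0 ≤ (k * divX p).coeff l := ((hA 1).conv (hc.tl (0, 1))).coeff_nonneg
  have h2 : |(2 : ℝ)| = 2 := by norm_num
  obtain ⟨δ, b⟩ := j
  cases δ
  · refine Maj.mono ((((hB b).smul 2).conv (hc.tl _)).sub (((hB b).bar.smul 2).conv (hc.tl _))
      |>.add (((hA b).sub (hA b).bar).conv (hc.tl _))) fun l => le_of_eq ?_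
    congr 1
    rw [h2, show (C 6 : ℝ[X]) = C 2 + C 2 + (C 1 + C 1) by rw [← C_add, ← C_add, ← C_add]; norm_num,
      C_1]
    ring
  · refine Maj.mono (((hB b).conv (hc.tl _)).sub (((hA b).bar.smul 2).conv (hc.tl _))) fun l => ?_
    rw [h2, mul_assoc, mul_assoc, coeff_add, coeff_C_mul, coeff_C_mul]
    linarith [hkp l]
  · refine Maj.mono ((((hA b).smul 2).conv (hc.tl _)).sub ((hB b).bar.conv (hc.tl _))) fun l => ?_
    rw [h2, mul_assoc, mul_assoc, coeff_add, coeff_C_mul, coeff_C_mul]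
    linarith [hkp l]

/-- The derivative acts on each letter in turn, so a word of length l contributes l terms, which is
the effect of X d/dX on the majorant. -/
theorem Maj.derS {kA kB : ℕ+ → Ser} {k : ℝ[X]} (hA : ∀ a, Maj (kA a) k)
    (hB : ∀ a, Maj (kB a) k) (hc : Maj c p) :
    Maj (derS kA kB c) (C 6 * k * (X * derivative p)) := by
  intro w
  induction w generalizing c p with
  | nil => simp [derS_nil]
  | cons j w ih =>
    have h1 : C 6 * k * (X * derivative p)
        = X * (C 6 * k * divX p) + X * (C 6 * k * (X * derivative (divX p))) := by
      rw [X_mul_derivative_divX]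
      ring
    rw [derS_cons, List.length_cons, h1, coeff_add, coeff_X_mul, coeff_X_mul]
    exact (abs_add_le _ _).trans (add_le_add (Maj.derHead hA hB hc j w) (ih (hc.tl j)))

end majorants

/-! ### Locality -/

/-- The coefficients of `c` and `c'` agree on the words of length at most `n`. -/
def Agree (n : ℕ) (c c' : Ser) : Prop := ∀ w : List ZIndex, w.length ≤ n → c w = c' w

section locality

variable {n : ℕ} {c c' d d' : Ser}

/-- A coefficient of a product only sees the splittings of the word into a prefix and a suffix. -/
theorem conv_congr {w : List ZIndex} (h : ∀ u v, u ++ v = w → c u * d v = c' u * d' v) :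
    conv c d w = conv c' d' w := by
  induction w generalizing c c' with
  | nil => exact h [] [] rfl
  | cons j w ih =>
    rw [conv_cons, conv_cons, h [] (j :: w) rfl,
      ih (c := tl c j) (c' := tl c' j) fun u v huv => h (j :: u) v (by rw [← huv, List.cons_append])]

theorem Agree.mono {m : ℕ} (h : Agree n c c') (hmn : m ≤ n) : Agree m c c' :=
  fun w hw => h w (hw.trans hmn)

theorem Agree.refl (n : ℕ) (c : Ser) : Agree n c c := fun _ _ => rfl

theorem Agree.add (hc : Agree n c c') (hd : Agree n d d') : Agree n (c + d) (c' + d') :=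
  fun w hw => by simp only [Pi.add_apply, hc w hw, hd w hw]

theorem Agree.sub (hc : Agree n c c') (hd : Agree n d d') : Agree n (c - d) (c' - d') :=
  fun w hw => by simp only [Pi.sub_apply, hc w hw, hd w hw]

theorem Agree.neg (hc : Agree n c c') : Agree n (-c) (-c') :=
  fun w hw => by simp only [Pi.neg_apply, hc w hw]

theorem Agree.smul (x : ℝ) (hc : Agree n c c') : Agree n (x • c) (x • c') :=
  fun w hw => by simp only [Pi.smul_apply, hc w hw]

theorem Agree.sum {ι : Type*} (s : Finset ι) {f f' : ι → Ser} (h : ∀ i ∈ s, Agree n (f i) (f' i)) :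
    Agree n (∑ i ∈ s, f i) (∑ i ∈ s, f' i) := fun w hw => by
  rw [Finset.sum_apply, Finset.sum_apply]
  exact Finset.sum_congr rfl fun i hi => h i hi w hw

theorem Agree.bar (hc : Agree n c c') : Agree n (bar c) (bar c') :=
  fun w hw => hc _ (by simpa using hw)

theorem Agree.tl (hc : Agree (n + 1) c c') (j : ZIndex) : Agree n (tl c j) (tl c' j) :=
  fun w hw => hc (j :: w) (by simpa using hw)

theorem Agree.lin {g g' : ZIndex → Ser} (h : ∀ j, Agree n (g j) (g' j)) :
    Agree (n + 1) (lin g) (lin g') := by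
  intro w hw
  cases w with
  | nil => rfl
  | cons j w => exact h j w (by simpa using hw)

theorem Agree.conv (hc : Agree n c c') (hd : Agree n d d') : Agree n (conv c d) (conv c' d') := by
  intro w hw
  refine conv_congr fun u v huv => ?_
  have : u.length + v.length = w.length := by rw [← huv, List.length_append]
  rw [hc u (by omega), hd v (by omega)]

/-- A first factor without constant term uses up at least one letter, so the second factor is needed
one degree less far. -/
theorem Agree.conv_of_nil (hc0 : c [] = 0) (hc0' : c' [] = 0) (hc : Agree (n + 1) c c')
    (hd : Agree n d d') : Agree (n + 1) (Ser.conv c d) (Ser.conv c' d') := by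
  intro w hw
  refine conv_congr fun u v huv => ?_
  have : u.length + v.length = w.length := by rw [← huv, List.length_append]
  cases u with
  | nil => rw [hc0, hc0', zero_mul, zero_mul]
  | cons j u =>
    rw [List.length_cons] at this
    rw [hc _ (by rw [List.length_cons]; omega), hd v (by omega)]

/-- If neither factor has a constant term, each leaves a letter to the other, and one order is
gained for both. This makes the quadratic terms of the homological equation harmless. -/
theorem Agree.conv_of_nil_of_nil (hc0 : c [] = 0) (hc0' : c' [] = 0) (hd0 : d [] = 0)
    (hd0' : d' [] = 0) (hc : Agree n c c') (hd : Agree n d d') :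
    Agree (n + 1) (Ser.conv c d) (Ser.conv c' d') := by
  intro w hw
  refine conv_congr fun u v huv => ?_
  have : u.length + v.length = w.length := by rw [← huv, List.length_append]
  cases u with
  | nil => rw [hc0, hc0', zero_mul, zero_mul]
  | cons j u =>
    cases v with
    | nil => rw [hd0, hd0', mul_zero, mul_zero]
    | cons i v =>
      rw [List.length_cons, List.length_cons] at this
      rw [hc _ (by rw [List.length_cons]; omega), hd _ (by rw [List.length_cons]; omega)]

theorem Agree.powS (hc : Agree n c c') (m : ℕ) : Agree n (powS c m) (powS c' m) := by
  induction m with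
  | zero => exact Agree.refl _ _
  | succ m ih => exact hc.conv ih

/-- The product of a series without constant term and the derivative of another one. -/
theorem Agree.conv_tl (hc0 : c [] = 0) (hc0' : c' [] = 0) (hc : Agree n c c')
    (hd : Agree n d d') (j : ZIndex) :
    Agree n (Ser.conv c (Ser.tl d j)) (Ser.conv c' (Ser.tl d' j)) := by
  intro w hw
  refine conv_congr fun u v huv => ?_
  have : u.length + v.length = w.length := by rw [← huv, List.length_append]
  cases u with
  | nil => rw [hc0, hc0', zero_mul, zero_mul]
  | cons i u =>
    rw [List.length_cons] at this
    rw [hc _ (by rw [List.length_cons]; omega), tl_apply, tl_apply,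
      hd _ (by rw [List.length_cons]; omega)]

/-- Replacing a letter by its derivative along a field without constant term lengthens the word, so
degree n + 1 of the result uses only degree n of the data. -/
theorem Agree.derS {kA kB kA' kB' : ℕ+ → Ser} (hA0 : ∀ a, kA a [] = 0) (hB0 : ∀ a, kB a [] = 0)
    (hA0' : ∀ a, kA' a [] = 0) (hB0' : ∀ a, kB' a [] = 0) (hA : ∀ a, Agree n (kA a) (kA' a))
    (hB : ∀ a, Agree n (kB a) (kB' a)) (hc : Agree n c c') :
    Agree (n + 1) (derS kA kB c) (derS kA' kB' c') := by
  intro w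
  induction w generalizing c c' n with
  | nil => intro _; rfl
  | cons j w ih =>
    intro hw
    have hw' : w.length ≤ n := by simpa using hw
    have h1 : derHead kA kB c j w = derHead kA' kB' c' j w := by
      obtain ⟨δ, b⟩ := j
      have a0 : Ser.bar (kA b) [] = 0 := hA0 b
      have a0' : Ser.bar (kA' b) [] = 0 := hA0' b
      have b0 : Ser.bar (kB b) [] = 0 := hB0 b
      have b0' : Ser.bar (kB' b) [] = 0 := hB0' b
      cases δ
      · refine Agree.add (Agree.sub (Agree.conv_tl ?_ ?_ ((hB b).smul 2) hc _)
          (Agree.conv_tl ?_ ?_ ((hB b).bar.smul 2) hc _))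
          (Agree.conv_tl ?_ ?_ ((hA b).sub (hA b).bar) hc _) w hw'
        all_goals simp [hA0, hB0, hA0', hB0', a0, a0', b0, b0']
      · refine Agree.sub (Agree.conv_tl ?_ ?_ (hB b) hc _)
          (Agree.conv_tl ?_ ?_ ((hA b).bar.smul 2) hc _) w hw'
        all_goals simp [hB0, hB0', a0, a0']
      · refine Agree.sub (Agree.conv_tl ?_ ?_ ((hA b).smul 2) hc _)
          (Agree.conv_tl ?_ ?_ (hB b).bar hc _) w hw'
        all_goals simp [hA0, hA0', b0, b0']
    rw [derS_cons, derS_cons, h1]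
    congr 1
    -- For n = 0 nothing is known about the tails, but the remaining word is empty and `derS`
    -- vanishes there.
    cases n with
    | zero =>
      rw [List.eq_nil_of_length_eq_zero (Nat.le_zero.1 hw')]
      rfl
    | succ n =>
      exact ih (fun a => (hA a).mono n.le_succ) (fun a => (hB a).mono n.le_succ) (hc.tl j) hw'

theorem pSer_nil (r : ℕ) (cf : ℕ → ℝ) (A B : ℕ+ → Ser) : pSer r cf A B [] = 0 := by
  rw [pSer, Finset.sum_apply]
  refine Finset.sum_eq_zero fun m _ => ?_
  rw [Pi.smul_apply, conv_nil, lin_nil, mul_zero, smul_zero]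

variable {A B kA kB A' B' kA' kB' : ℕ+ → Ser}

/-- Each summand ends with a factor `lin`, and `lin` consumes one letter; this is the gain of one
degree. -/
theorem Agree.pSer (r : ℕ) (cf : ℕ → ℝ) (hA : ∀ a, Agree n (A a) (A' a))
    (hB : ∀ a, Agree n (B a) (B' a)) :
    Agree (n + 1) (pSer r cf A B) (pSer r cf A' B') := by
  have hG (b : ℕ+) : Agree n (serG A B b) (serG A' B' b) :=
    ((Agree.refl _ _).add (hA b)).add (hB b).bar
  have hH (b : ℕ+) : Agree n (serH A B b) (serH A' B' b) :=
    ((Agree.refl _ _).add (hA b)).sub (hB b).bar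
  have hY (j : ZIndex) : Agree n (yHead A B j) (yHead A' B' j) := by
    obtain ⟨δ, b⟩ := j
    cases δ
    · exact ((hG b).conv (hG b).bar).smul _
    · exact ((hG b).bar.conv (hG b).bar).smul _
    · exact ((hG b).conv (hG b)).smul _
  have hS (j : ZIndex) : Agree n (sHead A B j) (sHead A' B' j) := by
    obtain ⟨δ, b⟩ := j
    cases δ
    · exact ((hH b).conv (hG b).bar).sub ((hH b).bar.conv (hG b))
    · exact ((hH b).bar.conv (hG b).bar).neg
    · exact (hH b).conv (hG b)
  exact Agree.sum _ fun m _ => (((Agree.lin hY).powS _).conv (Agree.lin hS)).smul _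

/-- This is the triangularity of the homological equation: no coefficient of the unknowns in the new
degree enters its right-hand side. -/
theorem Agree.rhoA (r : ℕ) (cf : ℕ → ℝ) (hA : ∀ a, Agree n (A a) (A' a))
    (hB : ∀ a, Agree n (B a) (B' a)) (hkA : ∀ a, Agree n (kA a) (kA' a))
    (hkB : ∀ a, Agree n (kB a) (kB' a))
    (h0 : ∀ a, A a [] = 0 ∧ B a [] = 0 ∧ kA a [] = 0 ∧ kB a [] = 0)
    (h0' : ∀ a, A' a [] = 0 ∧ B' a [] = 0 ∧ kA' a [] = 0 ∧ kB' a [] = 0) (a : ℕ+) :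
    Agree (n + 1) (rhoA r cf A B kA kB a) (rhoA r cf A' B' kA' kB' a) :=
  (Agree.conv_of_nil (pSer_nil _ _ _ _) (pSer_nil _ _ _ _) (Agree.pSer r cf hA hB)
    (hB a).bar).neg.sub
  (((Agree.conv_of_nil_of_nil (h0 a).2.2.1 (h0' a).2.2.1 (h0 a).1 (h0' a).1 (hkA a) (hA a)).sub
    (Agree.conv_of_nil_of_nil (c := Ser.bar (kB a)) (c' := Ser.bar (kB' a))
      (h0 a).2.2.2 (h0' a).2.2.2 (h0 a).2.1 (h0' a).2.1 (hkB a).bar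
      (hB a))).add (Agree.derS (fun a => (h0 a).2.2.1) (fun a => (h0 a).2.2.2)
        (fun a => (h0' a).2.2.1) (fun a => (h0' a).2.2.2) hkA hkB (hA a)))

theorem Agree.rhoB (r : ℕ) (cf : ℕ → ℝ) (hA : ∀ a, Agree n (A a) (A' a))
    (hB : ∀ a, Agree n (B a) (B' a)) (hkA : ∀ a, Agree n (kA a) (kA' a))
    (hkB : ∀ a, Agree n (kB a) (kB' a))
    (h0 : ∀ a, A a [] = 0 ∧ B a [] = 0 ∧ kA a [] = 0 ∧ kB a [] = 0)
    (h0' : ∀ a, A' a [] = 0 ∧ B' a [] = 0 ∧ kA' a [] = 0 ∧ kB' a [] = 0) (a : ℕ+) :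
    Agree (n + 1) (rhoB r cf A B kA kB a) (rhoB r cf A' B' kA' kB' a) :=
  (Agree.conv_of_nil (pSer_nil _ _ _ _) (pSer_nil _ _ _ _) (Agree.pSer r cf hA hB)
    ((Agree.refl _ _).add (hA a).bar)).neg.sub
  (((Agree.conv_of_nil_of_nil (h0 a).2.2.2 (h0' a).2.2.2 (h0 a).1 (h0' a).1 (hkB a) (hA a)).sub
    (Agree.conv_of_nil_of_nil (c := Ser.bar (kA a)) (c' := Ser.bar (kA' a))
      (h0 a).2.2.1 (h0' a).2.2.1 (h0 a).2.1 (h0' a).2.1 (hkA a).bar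
      (hB a))).add (Agree.derS (fun a => (h0 a).2.2.1) (fun a => (h0 a).2.2.2)
        (fun a => (h0' a).2.2.1) (fun a => (h0' a).2.2.2) hkA hkB (hB a)))

end locality

end Ser

end

noncomputable section

namespace Ser

open Polynomial

/-! ### Evaluation of series -/

/-- The part of degree `l` of the series `c`, evaluated at `v`. -/
def ev : ℕ → Ser → (ZIndex → ℂ) → ℂ
  | 0, c, _ => (c [] : ℂ)
  | l + 1, c, v => ∑' j, v j * ev l (tl c j) v

theorem ev_succ (l : ℕ) (c : Ser) (v : ZIndex → ℂ) :
    ev (l + 1) c v = ∑' j, v j * ev l (tl c j) v := rfl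

/-- The derivative of `ev l c` at `v` in the direction `u`. -/
def dev : ℕ → Ser → (ZIndex → ℂ) → (ZIndex → ℂ) → ℂ
  | 0, _, _, _ => 0
  | l + 1, c, v, u => ∑' j, (u j * ev l (tl c j) v + v j * dev l (tl c j) v u)

theorem dev_succ (l : ℕ) (c : Ser) (v u : ZIndex → ℂ) :
    dev (l + 1) c v u = ∑' j, (u j * ev l (tl c j) v + v j * dev l (tl c j) v u) := rfl

/-- The series `c` evaluated at `v`. -/
def E (c : Ser) (v : ZIndex → ℂ) : ℂ := ∑' l, ev l c v

/-- The derivative of `E c` at `v` in the direction `u`. -/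
def dE (c : Ser) (v u : ZIndex → ℂ) : ℂ := ∑' l, dev l c v u

/-- The series has bounded coefficients and finite degree. -/
def Bd (c : Ser) : Prop := ∃ p, Maj c p

/-- Removing the first letter lowers the degree of a majorant, so finitely many removals reach the
zero series. This induction yields the multiplicative, conjugation and differentiation identities
for `E`. -/
theorem Bd.induction {P : Ser → Prop} (h0 : P 0)
    (hs : ∀ c, Bd c → (∀ j, P (tl c j)) → P c) {c : Ser} (hc : Bd c) : P c := by
  have key : ∀ (n : ℕ) (c : Ser) (p : ℝ[X]), Maj c p → (∀ l, n ≤ l → p.coeff l = 0) → P c := by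
    intro n
    induction n with
    | zero =>
      intro c p hc hp
      have : c = 0 := by
        funext w
        have := hc w
        rw [hp _ (Nat.zero_le _)] at this
        exact abs_nonpos_iff.1 this
      rwa [this]
    | succ n ih =>
      intro c p hc hp
      exact hs c ⟨p, hc⟩ fun j => ih _ _ (hc.tl j) fun l hl => by
        rw [coeff_divX]
        exact hp _ (Nat.succ_le_succ hl)
  obtain ⟨p, hp⟩ := hc
  exact key (p.natDegree + 1) c p hp fun l hl => coeff_eq_zero_of_natDegree_lt hl

variable {c d : Ser} {p q : ℝ[X]} {v u : ZIndex → ℂ}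

theorem Bd.tl (hc : Bd c) (j : ZIndex) : Bd (tl c j) := let ⟨_, h⟩ := hc; ⟨_, h.tl j⟩

theorem Bd.add (hc : Bd c) (hd : Bd d) : Bd (c + d) :=
  let ⟨_, h⟩ := hc; let ⟨_, h'⟩ := hd; ⟨_, h.add h'⟩

theorem Bd.sub (hc : Bd c) (hd : Bd d) : Bd (c - d) :=
  let ⟨_, h⟩ := hc; let ⟨_, h'⟩ := hd; ⟨_, h.sub h'⟩

theorem Bd.neg (hc : Bd c) : Bd (-c) := let ⟨_, h⟩ := hc; ⟨_, h.neg⟩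

theorem Bd.smul (x : ℝ) (hc : Bd c) : Bd (x • c) := let ⟨_, h⟩ := hc; ⟨_, h.smul x⟩

theorem Bd.conv (hc : Bd c) (hd : Bd d) : Bd (conv c d) :=
  let ⟨_, h⟩ := hc; let ⟨_, h'⟩ := hd; ⟨_, h.conv h'⟩

theorem Bd.bar (hc : Bd c) : Bd (bar c) := let ⟨_, h⟩ := hc; ⟨_, h.bar⟩

theorem Bd.powS (hc : Bd c) (n : ℕ) : Bd (powS c n) := let ⟨_, h⟩ := hc; ⟨_, h.powS n⟩

theorem Bd.one : Bd one := ⟨_, Maj.one⟩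

theorem Bd.zero : Bd 0 := ⟨_, Maj.zero⟩

theorem norm_ev_le (hv : Summable fun j => ‖v j‖) (hc : Maj c p) (l : ℕ) :
    ‖ev l c v‖ ≤ p.coeff l * (∑' j, ‖v j‖) ^ l := by
  induction l generalizing c p with
  | zero =>
    rw [pow_zero, mul_one]
    exact (Complex.norm_real _).trans_le (hc [])
  | succ l ih =>
    have h1 (j : ZIndex) :
        ‖v j * ev l (tl c j) v‖ ≤ ‖v j‖ * (p.coeff (l + 1) * (∑' j, ‖v j‖) ^ l) := by
      rw [norm_mul, ← coeff_divX]
      exact mul_le_mul_of_nonneg_left (ih (hc.tl j)) (norm_nonneg _)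
    refine (tsum_of_norm_bounded (hv.hasSum.mul_right _) h1).trans (le_of_eq ?_)
    ring

theorem summable_mul_ev (hw : Summable fun j => ‖u j‖) (hv : Summable fun j => ‖v j‖)
    (hc : Bd c) (l : ℕ) : Summable fun j => u j * ev l (tl c j) v := by
  obtain ⟨p, hp⟩ := hc
  refine Summable.of_norm_bounded (hw.mul_right ((divX p).coeff l * (∑' j, ‖v j‖) ^ l)) fun j => ?_
  rw [norm_mul]
  exact mul_le_mul_of_nonneg_left (norm_ev_le hv (hp.tl j) l) (norm_nonneg _)

theorem ev_add (hv : Summable fun j => ‖v j‖) (hc : Bd c) (hd : Bd d) (l : ℕ) :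
    ev l (c + d) v = ev l c v + ev l d v := by
  induction l generalizing c d with
  | zero => exact Complex.ofReal_add _ _
  | succ l ih =>
    rw [ev_succ, ev_succ, ev_succ, ← (summable_mul_ev hv hv hc l).tsum_add
      (summable_mul_ev hv hv hd l)]
    refine tsum_congr fun j => ?_
    rw [← mul_add, ← ih (hc.tl j) (hd.tl j)]
    rfl

theorem ev_smul (x : ℝ) (c : Ser) (v : ZIndex → ℂ) (l : ℕ) :
    ev l (x • c) v = x * ev l c v := by
  induction l generalizing c with
  | zero => exact Complex.ofReal_mul _ _
  | succ l ih =>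
    rw [ev_succ, ev_succ, ← tsum_mul_left]
    refine tsum_congr fun j => ?_
    rw [mul_left_comm, ← ih]
    rfl

theorem ev_zero (l : ℕ) (v : ZIndex → ℂ) : ev l 0 v = 0 := by
  have := ev_smul 0 0 v l
  rwa [zero_smul, Complex.ofReal_zero, zero_mul] at this

theorem norm_dev_le (hv : Summable fun j => ‖v j‖) (hu : Summable fun j => ‖u j‖) (hc : Maj c p)
    (l : ℕ) : ‖dev l c v u‖ ≤ p.coeff l * (l * (∑' j, ‖v j‖) ^ (l - 1)) * ∑' j, ‖u j‖ := by
  induction l generalizing c p with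
  | zero => simp [dev]
  | succ l ih =>
    set V := ∑' j, ‖v j‖
    set U := ∑' j, ‖u j‖
    have h1 (j : ZIndex) : ‖u j * ev l (tl c j) v + v j * dev l (tl c j) v u‖
        ≤ ‖u j‖ * (p.coeff (l + 1) * V ^ l)
          + ‖v j‖ * (p.coeff (l + 1) * (l * V ^ (l - 1)) * U) := by
      refine (norm_add_le _ _).trans ?_
      rw [norm_mul, norm_mul, ← coeff_divX]
      exact add_le_add (mul_le_mul_of_nonneg_left (norm_ev_le hv (hc.tl j) l) (norm_nonneg _))
        (mul_le_mul_of_nonneg_left (ih (hc.tl j)) (norm_nonneg _))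
    refine (tsum_of_norm_bounded ((hu.hasSum.mul_right _).add (hv.hasSum.mul_right _)) h1).trans
      (le_of_eq ?_)
    change U * _ + V * _ = _
    cases l with
    | zero => simp; ring
    | succ l =>
      rw [Nat.add_sub_cancel, Nat.add_sub_cancel]
      push_cast
      ring

theorem summable_dev (hv : Summable fun j => ‖v j‖) (hu : Summable fun j => ‖u j‖)
    (hc : Bd c) (l : ℕ) :
    Summable fun j => u j * ev l (tl c j) v + v j * dev l (tl c j) v u := by
  refine (summable_mul_ev hu hv hc l).add ?_
  obtain ⟨p, hp⟩ := hc
  refine Summable.of_norm_bounded (hv.mul_right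
    ((divX p).coeff l * (l * (∑' j, ‖v j‖) ^ (l - 1)) * ∑' j, ‖u j‖)) fun j => ?_
  rw [norm_mul]
  exact mul_le_mul_of_nonneg_left (norm_dev_le hv hu (hp.tl j) l) (norm_nonneg _)

theorem dev_zero (l : ℕ) (v u : ZIndex → ℂ) : dev l 0 v u = 0 := by
  induction l with
  | zero => rfl
  | succ l ih =>
    rw [dev_succ, ← tsum_zero (α := ℂ) (β := ZIndex)]
    refine tsum_congr fun j => ?_
    have : tl 0 j = 0 := rfl
    rw [this, ev_zero, ih, mul_zero, mul_zero, add_zero]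

theorem ev_eq_zero (hv : Summable fun j => ‖v j‖) (hc : Maj c p) {l : ℕ} (hl : p.natDegree < l) :
    ev l c v = 0 := by
  have := norm_ev_le hv hc l
  rw [coeff_eq_zero_of_natDegree_lt hl, zero_mul] at this
  exact norm_le_zero_iff.1 this

theorem dev_eq_zero (hv : Summable fun j => ‖v j‖) (hu : Summable fun j => ‖u j‖) (hc : Maj c p)
    {l : ℕ} (hl : p.natDegree < l) : dev l c v u = 0 := by
  have := norm_dev_le hv hu hc l
  rw [coeff_eq_zero_of_natDegree_lt hl, zero_mul, zero_mul] at this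
  exact norm_le_zero_iff.1 this

theorem E_eq_sum (hv : Summable fun j => ‖v j‖) (hc : Maj c p) {n : ℕ} (hn : p.natDegree < n) :
    E c v = ∑ l ∈ Finset.range n, ev l c v :=
  tsum_eq_sum fun l hl => ev_eq_zero hv hc (by rw [Finset.mem_range] at hl; omega)

theorem dE_eq_sum (hv : Summable fun j => ‖v j‖) (hu : Summable fun j => ‖u j‖) (hc : Maj c p)
    {n : ℕ} (hn : p.natDegree < n) : dE c v u = ∑ l ∈ Finset.range n, dev l c v u :=
  tsum_eq_sum fun l hl => dev_eq_zero hv hu hc (by rw [Finset.mem_range] at hl; omega)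

theorem summable_ev (hv : Summable fun j => ‖v j‖) (hc : Bd c) : Summable fun l => ev l c v := by
  obtain ⟨p, hp⟩ := hc
  exact summable_of_ne_finset_zero (s := Finset.range (p.natDegree + 1)) fun l hl =>
    ev_eq_zero hv hp (by rw [Finset.mem_range] at hl; omega)

theorem E_add (hv : Summable fun j => ‖v j‖) (hc : Bd c) (hd : Bd d) :
    E (c + d) v = E c v + E d v := by
  rw [E, E, E, ← (summable_ev hv hc).tsum_add (summable_ev hv hd)]
  exact tsum_congr fun l => ev_add hv hc hd l

theorem E_smul (x : ℝ) (c : Ser) (v : ZIndex → ℂ) : E (x • c) v = x * E c v := by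
  rw [E, E, ← tsum_mul_left]
  exact tsum_congr fun l => ev_smul x c v l

theorem E_zero (v : ZIndex → ℂ) : E 0 v = 0 := by
  simp [E, ev_zero]

theorem dE_zero (v u : ZIndex → ℂ) : dE 0 v u = 0 := by
  simp [dE, dev_zero]

theorem E_neg (c : Ser) (v : ZIndex → ℂ) : E (-c) v = -E c v := by
  have := E_smul (-1) c v
  rwa [neg_one_smul, Complex.ofReal_neg, Complex.ofReal_one, neg_one_mul] at this

theorem E_sub (hv : Summable fun j => ‖v j‖) (hc : Bd c) (hd : Bd d) :
    E (c - d) v = E c v - E d v := by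
  rw [sub_eq_add_neg, E_add hv hc hd.neg, E_neg, sub_eq_add_neg]

theorem Bd.sum {ι : Type*} (s : Finset ι) {f : ι → Ser} (h : ∀ i ∈ s, Bd (f i)) :
    Bd (∑ i ∈ s, f i) := by
  classical
  induction s using Finset.induction_on with
  | empty => simpa using Bd.zero
  | insert i s hi ih =>
    rw [Finset.sum_insert hi]
    exact (h i (Finset.mem_insert_self _ _)).add (ih fun k hk => h k (Finset.mem_insert_of_mem hk))

theorem E_sum (hv : Summable fun j => ‖v j‖) {ι : Type*} (s : Finset ι) {f : ι → Ser}
    (h : ∀ i ∈ s, Bd (f i)) : E (∑ i ∈ s, f i) v = ∑ i ∈ s, E (f i) v := by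
  classical
  induction s using Finset.induction_on with
  | empty => simp [E_zero]
  | insert i s hi ih =>
    have h' : ∀ k ∈ s, Bd (f k) := fun k hk => h k (Finset.mem_insert_of_mem hk)
    rw [Finset.sum_insert hi, Finset.sum_insert hi,
      E_add hv (h i (Finset.mem_insert_self _ _)) (Bd.sum s h'), ih h']

theorem norm_E_le (hv : Summable fun j => ‖v j‖) (hc : Maj c p) :
    ‖E c v‖ ≤ p.eval (∑' j, ‖v j‖) := by
  rw [E_eq_sum hv hc (Nat.lt_succ_self _), eval_eq_sum_range]
  exact (norm_sum_le _ _).trans (Finset.sum_le_sum fun l _ => norm_ev_le hv hc l)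

/-- A Schwarz lemma for majorized series: if the terms of degree at most r vanish, passing from
radius T to the smaller sum of the ‖v j‖ gains the ratio to the power r + 1. -/
theorem norm_E_le_of_eq_zero (hv : Summable fun j => ‖v j‖) (hc : Maj c p) {r : ℕ}
    (h0 : ∀ w : List ZIndex, w.length ≤ r → c w = 0) {T : ℝ} (hT : 0 < T)
    (hVT : ∑' j, ‖v j‖ ≤ T) :
    ‖E c v‖ ≤ ((∑' j, ‖v j‖) / T) ^ (r + 1) * p.eval T := by
  have hV : 0 ≤ ∑' j, ‖v j‖ := tsum_nonneg fun j => norm_nonneg _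
  set V := ∑' j, ‖v j‖
  have hzero : ∀ l ≤ r, ev l c v = 0 := by
    have aux : ∀ (l : ℕ) (c : Ser), (∀ w : List ZIndex, w.length = l → c w = 0) →
        ev l c v = 0 := by
      intro l
      induction l with
      | zero => intro c hc; rw [ev, hc [] rfl, Complex.ofReal_zero]
      | succ l ih =>
        intro c hc
        rw [ev_succ, ← tsum_zero (α := ℂ) (β := ZIndex)]
        refine tsum_congr fun j => ?_
        rw [ih (tl c j) fun w hw => hc (j :: w) (by rw [List.length_cons, hw]), mul_zero]
    exact fun l hl => aux l c fun w hw => h0 w (by omega)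
  rw [E_eq_sum hv hc (Nat.lt_succ_self _), eval_eq_sum_range, Finset.mul_sum]
  refine (norm_sum_le _ _).trans (Finset.sum_le_sum fun l _ => ?_)
  have hp := hc.coeff_nonneg l
  have hq : 0 ≤ V / T := div_nonneg hV hT.le
  rcases le_or_gt l r with hl | hl
  · rw [hzero l hl, norm_zero]
    positivity
  · refine (norm_ev_le hv hc l).trans ?_
    have h1 : V ^ l = (V / T) ^ l * T ^ l := by rw [div_pow, div_mul_cancel₀ _ (by positivity)]
    rw [h1, mul_left_comm]
    refine mul_le_mul_of_nonneg_right ?_ (by positivity)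
    exact pow_le_pow_of_le_one hq ((div_le_one hT).2 hVT) hl

/-- The unrolling of the first letter. Finite degree turns the outer sum into a finite one, which
may be interchanged with the sum over letters. -/
theorem E_rec (hv : Summable fun j => ‖v j‖) (hc : Bd c) :
    E c v = c [] + ∑' j, v j * E (tl c j) v := by
  obtain ⟨p, hp⟩ := hc
  have hd (j : ZIndex) : (divX p).natDegree < p.natDegree + 1 := by
    rw [natDegree_divX_eq_natDegree_tsub_one]
    omega
  rw [E_eq_sum hv hp (show p.natDegree < p.natDegree + 1 + 1 by omega), Finset.sum_range_succ']
  rw [add_comm]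
  congr 1
  simp only [ev_succ]
  rw [← Summable.tsum_finsetSum fun l _ => summable_mul_ev hv hv ⟨p, hp⟩ l]
  exact tsum_congr fun j => by rw [E_eq_sum hv (hp.tl j) (hd j), Finset.mul_sum]

theorem summable_mul_E (hw : Summable fun j => ‖u j‖) (hv : Summable fun j => ‖v j‖)
    {g : ZIndex → Ser} (hg : ∀ j, Maj (g j) p) : Summable fun j => u j * E (g j) v := by
  refine Summable.of_norm_bounded (hw.mul_right (p.eval (∑' j, ‖v j‖))) fun j => ?_
  rw [norm_mul]
  exact mul_le_mul_of_nonneg_left (norm_E_le hv (hg j)) (norm_nonneg _)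

theorem summable_mul_E_tl (hw : Summable fun j => ‖u j‖) (hv : Summable fun j => ‖v j‖)
    (hc : Bd c) : Summable fun j => u j * E (tl c j) v :=
  let ⟨_, hp⟩ := hc; summable_mul_E hw hv hp.tl

theorem dE_rec (hv : Summable fun j => ‖v j‖) (hu : Summable fun j => ‖u j‖) (hc : Bd c) :
    dE c v u = ∑' j, (u j * E (tl c j) v + v j * dE (tl c j) v u) := by
  obtain ⟨p, hp⟩ := hc
  have hd (j : ZIndex) : (divX p).natDegree < p.natDegree + 1 := by
    rw [natDegree_divX_eq_natDegree_tsub_one]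
    omega
  rw [dE_eq_sum hv hu hp (show p.natDegree < p.natDegree + 1 + 1 by omega),
    Finset.sum_range_succ']
  change _ + 0 = _
  rw [add_zero]
  simp only [dev_succ]
  rw [← Summable.tsum_finsetSum fun l _ => summable_dev hv hu ⟨p, hp⟩ l]
  exact tsum_congr fun j => by
    rw [E_eq_sum hv (hp.tl j) (hd j), dE_eq_sum hv hu (hp.tl j) (hd j), Finset.mul_sum,
      Finset.mul_sum, Finset.sum_add_distrib]

theorem norm_dE_le (hv : Summable fun j => ‖v j‖) (hu : Summable fun j => ‖u j‖)
    (hc : Maj c p) :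
    ‖dE c v u‖ ≤ (derivative p).eval (∑' j, ‖v j‖) * ∑' j, ‖u j‖ := by
  set V := ∑' j, ‖v j‖ with hV
  rw [dE_eq_sum hv hu hc (Nat.lt_succ_self _)]
  have h1 : (derivative p).eval V
      = ∑ l ∈ Finset.range (p.natDegree + 1), p.coeff l * (l * V ^ (l - 1)) := by
    rw [derivative_eval, Polynomial.sum_over_range' _ _ (p.natDegree + 1) (Nat.lt_succ_self _)]
    · exact Finset.sum_congr rfl fun l _ => by ring
    · intro l
      simp
  rw [h1, Finset.sum_mul]
  exact (norm_sum_le _ _).trans (Finset.sum_le_sum fun l _ => norm_dev_le hv hu hc l)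

theorem summable_dE (hv : Summable fun j => ‖v j‖) (hu : Summable fun j => ‖u j‖)
    (hc : Bd c) : Summable fun j => v j * dE (tl c j) v u := by
  obtain ⟨p, hp⟩ := hc
  refine Summable.of_norm_bounded (hv.mul_right
    ((derivative (divX p)).eval (∑' j, ‖v j‖) * ∑' j, ‖u j‖)) fun j => ?_
  rw [norm_mul]
  exact mul_le_mul_of_nonneg_left (norm_dE_le hv hu (hp.tl j)) (norm_nonneg _)

theorem E_lin (hv : Summable fun j => ‖v j‖) {g : ZIndex → Ser} (hg : ∀ j, Maj (g j) p) :
    E (lin g) v = ∑' j, v j * E (g j) v := by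
  rw [E_rec hv ⟨_, Maj.lin hg⟩, lin_nil, Complex.ofReal_zero, zero_add]
  rfl

theorem E_one (hv : Summable fun j => ‖v j‖) : E one v = 1 := by
  have h (j : ZIndex) : tl one j = 0 := by
    funext w
    simp [tl_apply, one]
  rw [E_rec hv Bd.one]
  simp [h, E_zero, one]

/-- Both sides satisfy the recursion `E_rec`, by `tl_conv`. The letters do not commute but their
values do, so evaluation is a homomorphism. -/
theorem E_conv (hv : Summable fun j => ‖v j‖) (hc : Bd c) (hd : Bd d) :
    E (conv c d) v = E c v * E d v := by
  refine Bd.induction (P := fun c => E (conv c d) v = E c v * E d v) ?_ ?_ hc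
  · have : conv 0 d = 0 := by
      funext w
      have := (Maj.zero.conv hd.choose_spec) w
      rw [zero_mul, coeff_zero] at this
      exact abs_nonpos_iff.1 this
    rw [this, E_zero, zero_mul]
  · intro c hc ih
    have h1 (j : ZIndex) : v j * E (tl (conv c d) j) v
        = c [] * (v j * E (tl d j) v) + v j * E (tl c j) v * E d v := by
      rw [tl_conv, E_add hv ((hd.tl j).smul _) ((hc.tl j).conv hd), ih j, E_smul]
      ring
    rw [E_rec hv (hc.conv hd), E_rec hv hc, tsum_congr h1, Summable.tsum_add, tsum_mul_left,
      tsum_mul_right, conv_nil, add_mul]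
    · rw [Complex.ofReal_mul]
      linear_combination (-(c [] : ℂ)) * E_rec hv hd
    · exact (summable_mul_E_tl hv hv hd).mul_left _
    · exact (summable_mul_E_tl hv hv hc).mul_right _

theorem E_powS (hv : Summable fun j => ‖v j‖) (hc : Bd c) (n : ℕ) :
    E (powS c n) v = E c v ^ n := by
  induction n with
  | zero => rw [powS, E_one hv, pow_zero]
  | succ n ih => rw [powS, E_conv hv hc (hc.powS n), ih, pow_succ']

theorem _root_.ZIndex.bar_bar (j : ZIndex) : j.bar.bar = j := by
  obtain ⟨δ, a⟩ := j
  simp [ZIndex.bar]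

theorem tl_bar (c : Ser) (j : ZIndex) : tl (bar c) j = bar (tl c j.bar) := rfl

theorem E_bar (hv : Summable fun j => ‖v j‖) (hvb : ∀ j : ZIndex, v j.bar = conj (v j))
    (hc : Bd c) : E (bar c) v = conj (E c v) := by
  refine Bd.induction (P := fun c => E (bar c) v = conj (E c v)) ?_ ?_ hc
  · change E 0 v = _
    rw [E_zero, map_zero]
  · intro c hc ih
    rw [E_rec hv hc.bar, E_rec hv hc, map_add, Complex.conj_ofReal, Complex.conj_tsum]
    congr 1
    rw [← (Function.Involutive.toPerm ZIndex.bar ZIndex.bar_bar).tsum_eq]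
    refine tsum_congr fun j => ?_
    change v j.bar * E (tl (bar c) j.bar) v = _
    rw [tl_bar, ZIndex.bar_bar, ih, map_mul, hvb]

/-- Sums over `ZIndex`, grouped by the second entry. -/
theorem _root_.ZIndex.tsum_eq {h : ZIndex → ℂ} (hh : Summable h) :
    ∑' j, h j = ∑' b : ℕ+, (h (1, b) + h (0, b) + h (-1, b)) := by
  have h2 : Summable fun p : ℕ+ × SignType => h (p.2, p.1) :=
    (Equiv.prodComm ℕ+ SignType).summable_iff.2 hh
  rw [← (Equiv.prodComm ℕ+ SignType).tsum_eq]
  refine h2.tsum_prod.trans ?_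
  refine tsum_congr fun b => ?_
  rw [tsum_fintype, SignType.univ_eq]
  simp
  ring

/-- The derivative of a series along a diagonal linear field. -/
theorem dE_diag (hv : Summable fun j => ‖v j‖) (hu : Summable fun j => ‖u j‖)
    (hvu : ∀ j : ZIndex, u j = -2 * Complex.I * ((j.1 : ℤ) * (j.2 : ℤ) : ℤ) * v j)
    (wt : List ZIndex → ℤ) (hwt : ∀ j w, wt (j :: w) = (j.1 : ℤ) * (j.2 : ℤ) + wt w)
    (hwt0 : wt [] = 0) (hc : Bd c) (hwc : Bd fun w => wt w * c w) :
    dE c v u = -2 * Complex.I * E (fun w => wt w * c w) v := by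
  revert hwc
  refine Bd.induction (P := fun c => Bd (fun w => wt w * c w) →
    dE c v u = -2 * Complex.I * E (fun w => wt w * c w) v) ?_ ?_ hc
  · intro _
    have : (fun w => wt w * (0 : Ser) w) = (0 : Ser) := by funext w; simp
    rw [dE_zero, this, E_zero, mul_zero]
  · intro c hc ih hwc
    rw [dE_rec hv hu hc, E_rec hv hwc, hwt0]
    simp only [Int.cast_zero, zero_mul, Complex.ofReal_zero, zero_add]
    rw [← tsum_mul_left]
    refine tsum_congr fun j => ?_
    have h1 : (fun w => wt w * tl c j w)
        = tl (fun w => wt w * c w) j - (((j.1 : ℤ) * (j.2 : ℤ) : ℤ) : ℝ) • tl c j := by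
      funext w
      simp only [tl_apply, hwt, Pi.sub_apply, Pi.smul_apply, smul_eq_mul]
      push_cast
      ring
    have h2 : Bd (fun w => wt w * tl c j w) := by
      rw [h1]
      exact (hwc.tl j).sub ((hc.tl j).smul _)
    rw [ih j h2, h1, E_sub hv (hwc.tl j) ((hc.tl j).smul _), E_smul, hvu,
      Complex.ofReal_intCast]
    ring

theorem exists_maj_derHead {kA kB : ℕ+ → Ser} {k : ℝ[X]} (hA : ∀ a, Maj (kA a) k)
    (hB : ∀ a, Maj (kB a) k) (hc : Bd c) : ∃ p, ∀ j, Maj (derHead kA kB c j) p :=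
  let ⟨_, hp⟩ := hc; ⟨_, Maj.derHead hA hB hp⟩

/-- The derivative of a series along the field with coefficients `iκ`. -/
theorem dE_eq_E_derS {kA kB : ℕ+ → Ser} {k : ℝ[X]} (hA : ∀ a, Maj (kA a) k)
    (hB : ∀ a, Maj (kB a) k) (hv : Summable fun j => ‖v j‖) (hu : Summable fun j => ‖u j‖)
    (hvb : ∀ j : ZIndex, v j.bar = conj (v j))
    (hu1 : ∀ b, u (1, b) = Complex.I * (2 * v (1, b) * E (kA b) v + 2 * v (0, b) * E (kB b) v))
    (hu2 : ∀ b, u (-1, b) = -Complex.I * (2 * v (-1, b) * conj (E (kA b) v)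
      + 2 * v (0, b) * conj (E (kB b) v)))
    (hu0 : ∀ b, u (0, b) = Complex.I * (v (0, b) * (E (kA b) v - conj (E (kA b) v))
      + v (-1, b) * E (kB b) v - v (1, b) * conj (E (kB b) v)))
    (hc : Bd c) : dE c v u = Complex.I * E (derS kA kB c) v := by
  have bA (b : ℕ+) : Bd (kA b) := ⟨k, hA b⟩
  have bB (b : ℕ+) : Bd (kB b) := ⟨k, hB b⟩
  refine Bd.induction (P := fun c => dE c v u = Complex.I * E (derS kA kB c) v) ?_ ?_ hc
  · have : derS kA kB 0 = 0 := by
      funext w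
      have := (Maj.derS hA hB Maj.zero) w
      rw [derivative_zero, mul_zero, mul_zero, coeff_zero] at this
      exact abs_nonpos_iff.1 this
    rw [this, dE_zero, E_zero, mul_zero]
  · intro c hc ih
    obtain ⟨ph, hph⟩ := exists_maj_derHead hA hB hc
    have hder (c : Ser) (hc : Bd c) : Bd (derS kA kB c) :=
      let ⟨_, hp⟩ := hc; ⟨_, Maj.derS hA hB hp⟩
    have htl (j : ZIndex) :
        tl (derS kA kB c) j = derHead kA kB c j + derS kA kB (tl c j) := rfl
    have hEtl (j : ZIndex) : v j * E (tl (derS kA kB c) j) v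
        = v j * E (derHead kA kB c j) v + v j * E (derS kA kB (tl c j)) v := by
      rw [htl, E_add hv ⟨_, hph j⟩ (hder _ (hc.tl j)), mul_add]
    have hs1 : Summable fun j => v j * E (derHead kA kB c j) v := summable_mul_E hv hv hph
    -- Summability of this part comes by subtraction: the total is the evaluation of a majorized
    -- series, and the head part is already summable.
    have hs2 : Summable fun j => v j * E (derS kA kB (tl c j)) v := by
      have := summable_mul_E_tl hv hv (hder c hc)
      simp only [hEtl] at this
      simpa using this.sub hs1
    have hs3 : Summable fun j => u j * E (tl c j) v := summable_mul_E_tl hu hv hc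
    have hs4 : Summable fun j => v j * dE (tl c j) v u := summable_dE hv hu hc
    rw [dE_rec hv hu hc, hs3.tsum_add hs4, E_rec hv (hder c hc), derS_nil, Complex.ofReal_zero,
      zero_add, tsum_congr hEtl, hs1.tsum_add hs2, mul_add]
    congr 1
    -- The head terms do not agree letter by letter, because the field mixes z_b², z̄_b² and I_b.
    -- They agree once the three letters with the same b are added.
    · rw [ZIndex.tsum_eq hs3, ZIndex.tsum_eq hs1, ← tsum_mul_left]
      refine tsum_congr fun b => ?_
      have e1 : E (derHead kA kB c (1, b)) v = 2 * E (kA b) v * E (tl c (1, b)) v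
          - conj (E (kB b) v) * E (tl c (0, b)) v := by
        change E (conv ((2 : ℝ) • kA b) (tl c (1, b)) - conv (bar (kB b)) (tl c (0, b))) v = _
        rw [E_sub hv (((bA b).smul _).conv (hc.tl _)) ((bB b).bar.conv (hc.tl _)),
          E_conv hv ((bA b).smul _) (hc.tl _), E_conv hv (bB b).bar (hc.tl _), E_smul,
          E_bar hv hvb (bB b)]
        push_cast
        ring
      have e2 : E (derHead kA kB c (-1, b)) v = E (kB b) v * E (tl c (0, b)) v
          - 2 * conj (E (kA b) v) * E (tl c (-1, b)) v := by
        change E (conv (kB b) (tl c (0, b)) - conv ((2 : ℝ) • bar (kA b)) (tl c (-1, b))) v = _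
        rw [E_sub hv ((bB b).conv (hc.tl _)) (((bA b).bar.smul _).conv (hc.tl _)),
          E_conv hv (bB b) (hc.tl _), E_conv hv ((bA b).bar.smul _) (hc.tl _), E_smul,
          E_bar hv hvb (bA b)]
        push_cast
        ring
      have e0 : E (derHead kA kB c (0, b)) v = 2 * E (kB b) v * E (tl c (1, b)) v
          - 2 * conj (E (kB b) v) * E (tl c (-1, b)) v
          + (E (kA b) v - conj (E (kA b) v)) * E (tl c (0, b)) v := by
        change E (conv ((2 : ℝ) • kB b) (tl c (1, b)) - conv ((2 : ℝ) • bar (kB b)) (tl c (-1, b))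
          + conv (kA b - bar (kA b)) (tl c (0, b))) v = _
        rw [E_add hv ((((bB b).smul _).conv (hc.tl _)).sub (((bB b).bar.smul _).conv (hc.tl _)))
            (((bA b).sub (bA b).bar).conv (hc.tl _)),
          E_sub hv (((bB b).smul _).conv (hc.tl _)) (((bB b).bar.smul _).conv (hc.tl _)),
          E_conv hv ((bB b).smul _) (hc.tl _), E_conv hv ((bB b).bar.smul _) (hc.tl _),
          E_conv hv ((bA b).sub (bA b).bar) (hc.tl _), E_smul, E_smul, E_bar hv hvb (bB b),
          E_sub hv (bA b) (bA b).bar, E_bar hv hvb (bA b)]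
        push_cast
        ring
      rw [e1, e2, e0, hu1, hu2, hu0]
      ring
    · rw [← tsum_mul_left]
      exact tsum_congr fun j => by rw [ih j]; ring

end Ser

end

noncomputable section

namespace Ser

open Polynomial

/-! ### The homological equation -/

/-- `Δ` of a word. -/
def wt (w : List ZIndex) : ℤ := (w.map fun j => (j.1 : ℤ) * (j.2 : ℤ)).sum

theorem wt_nil : wt [] = 0 := rfl

theorem wt_cons (j : ZIndex) (w : List ZIndex) : wt (j :: w) = (j.1 : ℤ) * (j.2 : ℤ) + wt w := by
  simp [wt]

/-- The solution of the homological equation with right-hand side `ρ`, `z_a`-coefficient. -/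
def solA (ρ : Ser) : Ser := fun w => if wt w = 0 then 0 else -ρ w / (2 * wt w)

/-- The resonant part of the `z_a`-coefficient `ρ`. -/
def resA (ρ : Ser) : Ser := fun w => if wt w = 0 then ρ w else 0

/-- The solution of the homological equation with right-hand side `ρ`, `z̄_a`-coefficient. -/
def solB (a : ℕ+) (ρ : Ser) : Ser := fun w =>
  if wt w = (a : ℤ) then 0 else ρ w / (2 * ((a : ℤ) - wt w : ℤ))

/-- The resonant part of the `z̄_a`-coefficient `ρ`. -/
def resB (a : ℕ+) (ρ : Ser) : Ser := fun w => if wt w = (a : ℤ) then ρ w else 0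

/-- The divisors are nonzero integers, so division never loses; the factor two is even gained, and
it is why A and B are majorized by half of the majorant of κ. -/
theorem abs_div_two_mul_le (x : ℝ) {m : ℤ} (hm : m ≠ 0) : |x / (2 * m)| ≤ 1 / 2 * |x| := by
  have h1 : (1 : ℝ) ≤ |(m : ℝ)| := by exact_mod_cast Int.one_le_abs hm
  have h2 : |2 * (m : ℝ)| = 2 * |(m : ℝ)| := by rw [abs_mul, abs_two]
  rw [abs_div, h2, div_le_iff₀ (by linarith)]
  nlinarith [abs_nonneg x]

theorem abs_solA_le (ρ : Ser) (w : List ZIndex) : |solA ρ w| ≤ 1 / 2 * |ρ w| := by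
  unfold solA
  split_ifs with h
  · simp
  · simpa only [abs_neg] using abs_div_two_mul_le (-ρ w) h

theorem abs_solB_le (a : ℕ+) (ρ : Ser) (w : List ZIndex) : |solB a ρ w| ≤ 1 / 2 * |ρ w| := by
  unfold solB
  split_ifs with h
  · simp
  · exact abs_div_two_mul_le _ (sub_ne_zero.2 (Ne.symm h))

theorem abs_resA_le (ρ : Ser) (w : List ZIndex) : |resA ρ w| ≤ |ρ w| := by
  unfold resA
  split_ifs <;> simp

theorem abs_resB_le (a : ℕ+) (ρ : Ser) (w : List ZIndex) : |resB a ρ w| ≤ |ρ w| := by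
  unfold resB
  split_ifs <;> simp

/-- The homological equation for the z_a-coefficient. The frequency of z_a itself cancels against
Z_1 applied to F, so only the weight of the word remains. -/
theorem resA_sub (ρ : Ser) (w : List ZIndex) : resA ρ w - 2 * wt w * solA ρ w = ρ w := by
  unfold resA solA
  split_ifs with h
  · simp
  · have : (wt w : ℝ) ≠ 0 := Int.cast_ne_zero.2 h
    field_simp
    ring

/-- The homological equation for the z̄_a-coefficient. Here the frequency of z̄_a is opposite to
that of Z_1 in the z_a-component, so a is added to it instead of cancelling, and the resonance moves
to weight a. -/
theorem resB_add (a : ℕ+) (ρ : Ser) (w : List ZIndex) :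
    resB a ρ w + 2 * ((a : ℤ) - wt w : ℤ) * solB a ρ w = ρ w := by
  unfold resB solB
  split_ifs with h
  · simp
  · have : (((a : ℤ) - wt w : ℤ) : ℝ) ≠ 0 := Int.cast_ne_zero.2 (sub_ne_zero.2 (Ne.symm h))
    field_simp
    ring

/-- The coefficients of a transformation `id + F` and of a normal form `iκ`. -/
structure NF where
  A : ℕ+ → Ser
  B : ℕ+ → Ser
  kA : ℕ+ → Ser
  kB : ℕ+ → Ser

/-- The right-hand side of the homological equation, `z_a`-coefficient. -/
def NF.rA (S : NF) (r : ℕ) (cf : ℕ → ℝ) (a : ℕ+) : Ser := rhoA r cf S.A S.B S.kA S.kB a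

/-- The right-hand side of the homological equation, `z̄_a`-coefficient. -/
def NF.rB (S : NF) (r : ℕ) (cf : ℕ → ℝ) (a : ℕ+) : Ser := rhoB r cf S.A S.B S.kA S.kB a

/-- The series with the coefficients of `c` on words of length `n` and those of `d` on others. -/
def ext (n : ℕ) (c d : Ser) : Ser := fun w => if w.length = n then c w else d w

/-- The solution of the homological equation up to degree `n`. -/
def nf (r : ℕ) (cf : ℕ → ℝ) : ℕ → NF
  | 0 => ⟨fun _ => 0, fun _ => 0, fun _ => 0, fun _ => 0⟩
  | n + 1 =>
    let S := nf r cf n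
    ⟨fun a => ext (n + 1) (solA (S.rA r cf a)) (S.A a),
      fun a => ext (n + 1) (solB a (S.rB r cf a)) (S.B a),
      fun a => ext (n + 1) (resA (S.rA r cf a)) (S.kA a),
      fun a => ext (n + 1) (resB a (S.rB r cf a)) (S.kB a)⟩

variable {r : ℕ} {cf : ℕ → ℝ}

theorem nf_eq_zero (n : ℕ) (a : ℕ+) (w : List ZIndex) (hw : w = [] ∨ n < w.length) :
    (nf r cf n).A a w = 0 ∧ (nf r cf n).B a w = 0 ∧ (nf r cf n).kA a w = 0 ∧
      (nf r cf n).kB a w = 0 := by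
  induction n with
  | zero => exact ⟨rfl, rfl, rfl, rfl⟩
  | succ n ih =>
    have h1 : w.length ≠ n + 1 := by
      rcases hw with rfl | hw
      · simp
      · omega
    have h2 := ih (hw.imp_right fun h => by omega)
    simpa only [nf, ext, if_neg h1] using h2

theorem nf_nil (n : ℕ) (a : ℕ+) : (nf r cf n).A a [] = 0 ∧ (nf r cf n).B a [] = 0 ∧
    (nf r cf n).kA a [] = 0 ∧ (nf r cf n).kB a [] = 0 := nf_eq_zero n a [] (Or.inl rfl)

theorem agree_ext {n : ℕ} (c d : Ser) : Agree n (ext (n + 1) c d) d := fun w hw => by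
  rw [ext, if_neg (by omega)]

theorem Agree.trans {n : ℕ} {c d e : Ser} (h : Agree n c d) (h' : Agree n d e) : Agree n c e :=
  fun w hw => (h w hw).trans (h' w hw)

/-- Each stage writes only on words of one new length, so coefficients that have been assigned never
change. -/
theorem agree_nf {m n : ℕ} (hmn : m ≤ n) (a : ℕ+) :
    Agree m ((nf r cf n).A a) ((nf r cf m).A a) ∧ Agree m ((nf r cf n).B a) ((nf r cf m).B a) ∧
    Agree m ((nf r cf n).kA a) ((nf r cf m).kA a) ∧
    Agree m ((nf r cf n).kB a) ((nf r cf m).kB a) := by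
  induction n, hmn using Nat.le_induction with
  | base => exact ⟨Agree.refl _ _, Agree.refl _ _, Agree.refl _ _, Agree.refl _ _⟩
  | succ n hmn ih =>
    exact ⟨((agree_ext _ _).mono hmn).trans ih.1, ((agree_ext _ _).mono hmn).trans ih.2.1,
      ((agree_ext _ _).mono hmn).trans ih.2.2.1, ((agree_ext _ _).mono hmn).trans ih.2.2.2⟩

theorem NF.rA_nil {S : NF} (h : ∀ a, S.A a [] = 0 ∧ S.B a [] = 0 ∧ S.kA a [] = 0 ∧ S.kB a [] = 0)
    (a : ℕ+) : S.rA r cf a [] = 0 ∧ S.rB r cf a [] = 0 := by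
  have hb : bar (S.kA a) [] = 0 := (h a).2.2.1
  have hb' : bar (S.kB a) [] = 0 := (h a).2.2.2
  simp [NF.rA, NF.rB, rhoA, rhoB, dSerA, dSerB, conv_nil, pSer_nil, derS_nil, h a, hb, hb']

/-- A coefficient is assigned from the right-hand side formed at an earlier stage. By locality that
right-hand side has the same value at the word when it is formed from the final data, so the
equations hold simultaneously in all degrees up to n. -/
theorem nf_spec {n : ℕ} (a : ℕ+) {w : List ZIndex} (hw : w.length ≤ n) :
    (nf r cf n).A a w = solA ((nf r cf n).rA r cf a) w ∧
    (nf r cf n).B a w = solB a ((nf r cf n).rB r cf a) w ∧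
    (nf r cf n).kA a w = resA ((nf r cf n).rA r cf a) w ∧
    (nf r cf n).kB a w = resB a ((nf r cf n).rB r cf a) w := by
  rcases w.length.eq_zero_or_pos with h0 | h0
  · have hw0 := List.eq_nil_of_length_eq_zero h0
    subst hw0
    have h1 := NF.rA_nil (S := nf r cf n) (r := r) (cf := cf) (nf_nil n) a
    simp [nf_nil, solA, solB, resA, resB, h1]
  · obtain ⟨m, hm⟩ : ∃ m, w.length = m + 1 := ⟨w.length - 1, by omega⟩
    have h1 := agree_nf (r := r) (cf := cf) (show m + 1 ≤ n by omega) a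
    have h2 (b : ℕ+) := agree_nf (r := r) (cf := cf) (show m ≤ n by omega) b
    have hA : (nf r cf n).rA r cf a w = (nf r cf m).rA r cf a w :=
      Agree.rhoA r cf (fun b => (h2 b).1) (fun b => (h2 b).2.1) (fun b => (h2 b).2.2.1)
        (fun b => (h2 b).2.2.2) (nf_nil n) (nf_nil m) a w hm.le
    have hB : (nf r cf n).rB r cf a w = (nf r cf m).rB r cf a w :=
      Agree.rhoB r cf (fun b => (h2 b).1) (fun b => (h2 b).2.1) (fun b => (h2 b).2.2.1)
        (fun b => (h2 b).2.2.2) (nf_nil n) (nf_nil m) a w hm.le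
    rw [h1.1 w hm.le, h1.2.1 w hm.le, h1.2.2.1 w hm.le, h1.2.2.2 w hm.le]
    simp only [nf, ext, if_pos hm, solA, solB, resA, resB, hA, hB, and_self]

/-! ### Bounds for the solution -/

/-- The majorant of `∑ c_m Y^{m-1} S`. -/
def pPoly (M : ℕ) (cf : ℕ → ℝ) (k : ℝ[X]) : ℝ[X] :=
  ∑ m ∈ Finset.Icc 1 M, C |cf m| * (X ^ m * (C 2 * ((1 + k) * (1 + k))) ^ m)

/-- The majorant of the right-hand side of the homological equation. -/
def qPoly (M : ℕ) (cf : ℕ → ℝ) (k : ℝ[X]) : ℝ[X] :=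
  pPoly M cf k * (1 + k) + (k * k + C 3 * k * (X * derivative k))

section

variable {A B kA kB : ℕ+ → Ser} {k : ℝ[X]}

/-- The halves for A and B add up to k, so both `serG` and `serH` are majorized by 1 + k. The
summand of index m has m factors `lin` and hence the factor X^m. -/
theorem Maj.pSer (hA : ∀ a, Maj (A a) (C (1 / 2) * k)) (hB : ∀ a, Maj (B a) (C (1 / 2) * k)) :
    Maj (pSer r cf A B) (pPoly r cf k) := by
  have hk : (1 : ℝ[X]) + C (1 / 2) * k + C (1 / 2) * k = 1 + k := by
    rw [add_assoc, ← add_mul, ← C_add, add_halves, C_1, one_mul]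
  have hG (b : ℕ+) : Maj (serG A B b) (1 + k) := by
    rw [← hk]
    exact (Maj.one.add (hA b)).add (hB b).bar
  have hH (b : ℕ+) : Maj (serH A B b) (1 + k) := by
    rw [← hk]
    exact (Maj.one.add (hA b)).sub (hB b).bar
  have hu : ∀ l, 0 ≤ ((1 + k) * (1 + k)).coeff l := ((hG 1).conv (hG 1)).coeff_nonneg
  have hinv (b : ℕ+) : |((b : ℕ) : ℝ)⁻¹| ≤ 1 := by
    rw [abs_of_nonneg (by positivity)]
    exact inv_le_one_of_one_le₀ (by exact_mod_cast Nat.succ_le_of_lt b.pos)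
  have hY (j : ZIndex) : Maj (yHead A B j) (C 2 * ((1 + k) * (1 + k))) := by
    obtain ⟨δ, b⟩ := j
    cases δ
    · refine (((hG b).conv (hG b).bar).smul _).mono fun l => ?_
      rw [coeff_C_mul, coeff_C_mul, abs_mul, abs_two]
      exact mul_le_mul_of_nonneg_right (by linarith [hinv b]) (hu l)
    · refine (((hG b).bar.conv (hG b).bar).smul _).mono fun l => ?_
      rw [coeff_C_mul, coeff_C_mul]
      exact mul_le_mul_of_nonneg_right (by linarith [hinv b]) (hu l)
    · refine (((hG b).conv (hG b)).smul _).mono fun l => ?_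
      rw [coeff_C_mul, coeff_C_mul]
      exact mul_le_mul_of_nonneg_right (by linarith [hinv b]) (hu l)
  have hS (j : ZIndex) : Maj (sHead A B j) (C 2 * ((1 + k) * (1 + k))) := by
    obtain ⟨δ, b⟩ := j
    cases δ
    · refine (((hH b).conv (hG b).bar).sub ((hH b).bar.conv (hG b))).mono fun l => ?_
      rw [coeff_C_mul, coeff_add]
      linarith [hu l]
    · refine ((hH b).bar.conv (hG b).bar).neg.mono fun l => ?_
      rw [coeff_C_mul]
      linarith [hu l]
    · refine ((hH b).conv (hG b)).mono fun l => ?_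
      rw [coeff_C_mul]
      linarith [hu l]
  refine Maj.sum _ fun m hm => ?_
  have h1 := (((Maj.lin hY).powS (m - 1)).conv (Maj.lin hS)).smul (cf m)
  rwa [← pow_succ, Nat.sub_add_cancel (Finset.mem_Icc.1 hm).1, mul_pow] at h1

theorem Maj.rho (hA : ∀ a, Maj (A a) (C (1 / 2) * k)) (hB : ∀ a, Maj (B a) (C (1 / 2) * k))
    (hkA : ∀ a, Maj (kA a) k) (hkB : ∀ a, Maj (kB a) k) (a : ℕ+) :
    Maj (rhoA r cf A B kA kB a) (qPoly r cf k) ∧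
    Maj (rhoB r cf A B kA kB a) (qPoly r cf k) := by
  have hP := Maj.pSer (r := r) (cf := cf) hA hB
  have hk := (hkA 1).coeff_nonneg
  -- The halves in the majorants of A and B turn the two products into one k² and the constant 6 of
  -- `Maj.derS` into 3.
  have hd : k * (C (1 / 2) * k) + k * (C (1 / 2) * k)
      + C 6 * k * (X * derivative (C (1 / 2) * k)) = k * k + C 3 * k * (X * derivative k) := by
    have h1 : (C (1 / 2) + C (1 / 2) : ℝ[X]) = 1 := by rw [← C_add, add_halves, C_1]
    have h2 : (C 6 * C (1 / 2) : ℝ[X]) = C 3 := by rw [← C_mul]; norm_num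
    rw [derivative_C_mul, ← h2]
    linear_combination (k * k) * h1
  have hu : Maj (Ser.bar (B a)) (1 + k) := (hB a).bar.mono fun l => by
    rw [coeff_C_mul, coeff_add, coeff_one]
    split_ifs <;> linarith [hk l]
  have hu' : Maj (Ser.one + Ser.bar (A a)) (1 + k) := (Maj.one.add (hA a).bar).mono fun l => by
    rw [coeff_add, coeff_add, coeff_C_mul]
    linarith [hk l]
  unfold qPoly
  rw [← hd]
  exact ⟨(hP.conv hu).neg.sub ((((hkA a).conv (hA a)).sub ((hkB a).bar.conv (hB a))).add
      (Maj.derS hkA hkB (hA a))),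
    (hP.conv hu').neg.sub ((((hkB a).conv (hA a)).sub ((hkA a).bar.conv (hB a))).add
      (Maj.derS hkA hkB (hB a)))⟩

end

/-- The majorant `∑_{1 ≤ i ≤ n} c^{i(i-1)} X^i` of the normal form. -/
def kPoly (c : ℝ) (n : ℕ) : ℝ[X] := ∑ i ∈ Finset.Icc 1 n, C (c ^ (i * (i - 1))) * X ^ i

theorem coeff_kPoly (c : ℝ) (n l : ℕ) :
    (kPoly c n).coeff l = if 1 ≤ l ∧ l ≤ n then c ^ (l * (l - 1)) else 0 := by
  simp only [kPoly, finsetSum_coeff, coeff_C_mul, coeff_X_pow, mul_ite, mul_one, mul_zero]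
  rw [Finset.sum_ite_eq]
  simp only [Finset.mem_Icc]

theorem eval_kPoly (c : ℝ) (n : ℕ) (t : ℝ) :
    (kPoly c n).eval t = ∑ i ∈ Finset.Icc 1 n, c ^ (i * (i - 1)) * t ^ i := by
  simp [kPoly, eval_finsetSum]

theorem eval_derivative_kPoly (c : ℝ) (n : ℕ) (t : ℝ) :
    t * (derivative (kPoly c n)).eval t
      = ∑ i ∈ Finset.Icc 1 n, i * (c ^ (i * (i - 1)) * t ^ i) := by
  simp only [kPoly, derivative_sum, eval_finsetSum, Finset.mul_sum]
  refine Finset.sum_congr rfl fun i hi => ?_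
  obtain ⟨m, rfl⟩ : ∃ m, i = m + 1 := ⟨i - 1, by have := (Finset.mem_Icc.1 hi).1; omega⟩
  simp only [derivative_C_mul, derivative_X_pow, eval_mul, eval_C, eval_pow, eval_X,
    Nat.add_sub_cancel]
  ring

theorem coeff_mul_pow_le_eval {p : ℝ[X]} (hp : ∀ l, 0 ≤ p.coeff l) {t : ℝ} (ht : 0 ≤ t) (l : ℕ) :
    p.coeff l * t ^ l ≤ p.eval t := by
  rw [eval_eq_sum_range' (n := max p.natDegree l + 1) (by omega)]
  exact Finset.single_le_sum (f := fun i => p.coeff i * t ^ i)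
    (fun i _ => mul_nonneg (hp i) (by positivity)) (Finset.mem_range.2 (by omega))

/-- Bounds for the Taylor coefficients `c_m`. -/
def CoeffBound (c : ℝ) (r : ℕ) (cf : ℕ → ℝ) : Prop :=
  |cf 1| ≤ 1 / 4 ∧ |cf 2| ≤ 3 / 16 ∧ ∀ m, 3 ≤ m → m ≤ r → |cf m| ≤ 2 * (3 / 2 * c) ^ m

/-- This is where the number 20 enters: n terms of size at most n · 20^{-n} must add up to at most
1/20. Equality holds for n = 1. -/
theorem sq_le_twenty_pow (n : ℕ) : (n : ℝ) ^ 2 * 20 ≤ 20 ^ n := by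
  have h : n ^ 2 * 20 ≤ 20 ^ n := by
    induction n with
    | zero => simp
    | succ n ih =>
      rcases n with _ | n
      · simp
      · have h : (n + 1 + 1) ^ 2 ≤ (2 * (n + 1)) ^ 2 := Nat.pow_le_pow_left (by omega) 2
        rw [mul_pow] at h
        rw [pow_succ 20]
        linarith [Nat.zero_le (20 ^ (n + 1))]
  exact_mod_cast h

/-- The quadratic exponent fits the radius c^{-n}: i(i - 1) + n ≤ ni, that is (i - 1)(n - i) ≥ 0, so
every term is at most c^{-n}. -/
theorem pow_mul_inv_pow_le {c : ℝ} (hc : 20 ≤ c) {n i : ℕ} (h1 : 1 ≤ i) (h2 : i ≤ n) :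
    c ^ (i * (i - 1)) * ((c ^ n)⁻¹) ^ i ≤ (20 ^ n)⁻¹ := by
  have hc0 : 0 < c := by linarith
  have h3 : i * (i - 1) + n ≤ n * i := by
    obtain ⟨m, rfl⟩ : ∃ m, i = m + 1 := ⟨i - 1, by omega⟩
    obtain ⟨d, rfl⟩ : ∃ d, n = m + 1 + d := ⟨n - (m + 1), by omega⟩
    rw [Nat.add_sub_cancel]
    nlinarith [Nat.zero_le (m * d)]
  have h4 : c ^ (i * (i - 1)) * c ^ n ≤ (c ^ n) ^ i := by
    rw [← pow_add, ← pow_mul]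
    exact pow_le_pow_right₀ (by linarith) h3
  have h5 : (20 : ℝ) ^ n ≤ c ^ n := pow_le_pow_left₀ (by norm_num) hc n
  calc c ^ (i * (i - 1)) * ((c ^ n)⁻¹) ^ i ≤ (c ^ n)⁻¹ := by
        rw [inv_pow, ← div_eq_mul_inv, div_le_iff₀ (by positivity), ← div_eq_inv_mul,
          le_div_iff₀ (by positivity)]
        exact h4
    _ ≤ _ := inv_anti₀ (by positivity) h5

theorem kPoly_eval_le {c : ℝ} (hc : 20 ≤ c) (n : ℕ) :
    0 ≤ (kPoly c n).eval (c ^ n)⁻¹ ∧ (kPoly c n).eval (c ^ n)⁻¹ ≤ 1 / 20 ∧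
      0 ≤ (c ^ n)⁻¹ * (derivative (kPoly c n)).eval (c ^ n)⁻¹ ∧
      (c ^ n)⁻¹ * (derivative (kPoly c n)).eval (c ^ n)⁻¹ ≤ 1 / 20 := by
  have hc0 : 0 < c := by linarith
  have hsq : (n : ℝ) ^ 2 * (20 ^ n)⁻¹ ≤ 1 / 20 := by
    rw [← div_eq_mul_inv, div_le_div_iff₀ (by positivity) (by norm_num)]
    linarith [sq_le_twenty_pow n]
  have hb (i : ℕ) (hi : i ∈ Finset.Icc 1 n) :
      i * (c ^ (i * (i - 1)) * ((c ^ n)⁻¹) ^ i) ≤ n * (20 ^ n)⁻¹ := by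
    obtain ⟨h1, h2⟩ := Finset.mem_Icc.1 hi
    exact mul_le_mul (by exact_mod_cast h2) (pow_mul_inv_pow_le hc h1 h2) (by positivity)
      (by positivity)
  have hs : ∑ i ∈ Finset.Icc 1 n, (i : ℝ) * (c ^ (i * (i - 1)) * ((c ^ n)⁻¹) ^ i) ≤ 1 / 20 := by
    refine (Finset.sum_le_sum hb).trans ?_
    rw [Finset.sum_const, Nat.card_Icc, Nat.add_sub_cancel, nsmul_eq_mul]
    linarith
  rw [eval_kPoly, eval_derivative_kPoly]
  refine ⟨Finset.sum_nonneg fun i _ => by positivity,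
    le_trans (Finset.sum_le_sum fun i hi => ?_) hs,
    Finset.sum_nonneg fun i _ => by positivity, hs⟩
  have h1 : (1 : ℝ) ≤ i := by exact_mod_cast (Finset.mem_Icc.1 hi).1
  exact le_mul_of_one_le_left (by positivity) h1

theorem sum_one_sixth_pow_le (M : ℕ) : ∑ m ∈ Finset.Icc 1 M, (1 / 6 : ℝ) ^ m ≤ 1 / 5 := by
  have : ∑ m ∈ Finset.Icc 1 M, (1 / 6 : ℝ) ^ m = 1 / 5 - 1 / 5 * (1 / 6) ^ M := by
    induction M with
    | zero => simp
    | succ M ih =>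
      rw [Finset.sum_Icc_succ_top (by omega), ih, pow_succ]
      ring
  rw [this]
  have : (0 : ℝ) ≤ (1 / 6) ^ M := by positivity
  linarith

/-- The cut-off M ≤ n + 1 matters: c is not small compared with the radius c^{-n} until n ≥ 2, and
that is exactly when Taylor coefficients with m ≥ 3, bounded only in terms of c, begin to appear. -/
theorem qPoly_eval_le {c : ℝ} (hc : 20 ≤ c) (hcf : CoeffBound c r cf) {n M : ℕ} (hM : M ≤ n + 1)
    (hMr : M ≤ r) : (qPoly M cf (kPoly c n)).eval (c ^ n)⁻¹ ≤ 1 := by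
  obtain ⟨hk0, hk1, hd0, hd1⟩ := kPoly_eval_le hc n
  have hc0 : 0 < c := by linarith
  set K := (kPoly c n).eval (c ^ n)⁻¹ with hK
  set D := (c ^ n)⁻¹ * (derivative (kPoly c n)).eval (c ^ n)⁻¹ with hD
  have he : (qPoly M cf (kPoly c n)).eval (c ^ n)⁻¹
      = (∑ m ∈ Finset.Icc 1 M, |cf m| * (2 * (c ^ n)⁻¹ * ((1 + K) * (1 + K))) ^ m) * (1 + K)
        + (K * K + 3 * K * D) := by
    simp only [qPoly, pPoly, eval_add, eval_mul, eval_finsetSum, eval_C, eval_pow, eval_X, eval_one,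
      ← hK, ← hD]
    congr 2
    refine Finset.sum_congr rfl fun m _ => ?_
    rw [← mul_pow]
    ring
  rw [he]
  have hKD : K * K + 3 * K * D ≤ 1 / 100 := by nlinarith
  have hP : (∑ m ∈ Finset.Icc 1 M, |cf m| * (2 * (c ^ n)⁻¹ * ((1 + K) * (1 + K))) ^ m) ≤ 1 / 2 := by
    -- For n = 0 the evaluation point is 1. Nothing is small, but only m = 1 occurs, and 2 · 1/4 is
    -- the claimed bound.
    rcases n.eq_zero_or_pos with rfl | hn
    · have hK0 : K = 0 := by simp [hK, kPoly]
      rw [hK0]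
      rcases Nat.le_one_iff_eq_zero_or_eq_one.1 hM with rfl | rfl
      · simp
      · have := hcf.1
        simp
        linarith
    · have hx : (c ^ n)⁻¹ ≤ 1 / 20 := by
        rw [one_div]
        refine inv_anti₀ (by norm_num) (hc.trans ?_)
        exact le_self_pow₀ (by linarith) (by omega)
      have hx0 : 0 ≤ (c ^ n)⁻¹ := by positivity
      set x := (c ^ n)⁻¹ with hxd
      have hy : 2 * x * ((1 + K) * (1 + K)) ≤ 1 / 6 := by
        have : (1 + K) * (1 + K) ≤ 1.1025 := by nlinarith
        nlinarith
      have hy0 : 0 ≤ 2 * x * ((1 + K) * (1 + K)) := by positivity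
      have hterm (m : ℕ) (hm : m ∈ Finset.Icc 1 M) :
          |cf m| * (2 * x * ((1 + K) * (1 + K))) ^ m ≤ 2 * (1 / 6) ^ m := by
        obtain ⟨hm1, hm2⟩ := Finset.mem_Icc.1 hm
        rcases (show m = 1 ∨ m = 2 ∨ 3 ≤ m by omega) with rfl | rfl | hm3
        · exact mul_le_mul (by linarith [hcf.1]) (pow_le_pow_left₀ hy0 hy _) (by positivity)
            (by norm_num)
        · exact mul_le_mul (by linarith [hcf.2.1]) (pow_le_pow_left₀ hy0 hy _) (by positivity)
            (by norm_num)
        -- Since m ≤ M ≤ n + 1, the case m ≥ 3 forces n ≥ 2. One power of c in the radius then pays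
        -- for the c in the coefficient bound, and another one gives the 1/20.
        · have hcx : c * x ≤ 1 / 20 := by
            obtain ⟨k, rfl⟩ : ∃ k, n = k + 1 + 1 := ⟨n - 2, by omega⟩
            have h1 : c * x = (c ^ (k + 1))⁻¹ := by
              rw [hxd, pow_succ' c (k + 1), mul_inv, mul_inv_cancel_left₀ hc0.ne']
            rw [h1, one_div]
            exact inv_anti₀ (by norm_num) (hc.trans (le_self_pow₀ (by linarith) (by omega)))
          have h2 : (3 / 2 * c) * (2 * x * ((1 + K) * (1 + K))) ≤ 1 / 6 := by
            have h3 : (1 + K) * (1 + K) ≤ 1.1025 := by nlinarith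
            have h4 : (3 / 2 * c) * (2 * x * ((1 + K) * (1 + K)))
              = 3 * (c * x) * ((1 + K) * (1 + K)) := by ring
            have h5 : 0 ≤ c * x := by positivity
            rw [h4]
            nlinarith
          calc |cf m| * (2 * x * ((1 + K) * (1 + K))) ^ m
              ≤ 2 * (3 / 2 * c) ^ m * (2 * x * ((1 + K) * (1 + K))) ^ m :=
                mul_le_mul_of_nonneg_right (hcf.2.2 m hm3 (hm2.trans hMr)) (by positivity)
            _ = 2 * ((3 / 2 * c) * (2 * x * ((1 + K) * (1 + K)))) ^ m := by
                rw [mul_assoc, ← mul_pow]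
            _ ≤ 2 * (1 / 6) ^ m := by gcongr
      refine (Finset.sum_le_sum hterm).trans ?_
      rw [← Finset.mul_sum]
      linarith [sum_one_sixth_pow_le M]
  have hP' := mul_le_mul_of_nonneg_right hP (by linarith : 0 ≤ 1 + K)
  linarith

theorem coeff_qPoly_nonneg {c : ℝ} (hc : 0 ≤ c) (M n l : ℕ) :
    0 ≤ (qPoly M cf (kPoly c n)).coeff l := by
  have hk (l : ℕ) : 0 ≤ (kPoly c n).coeff l := by
    rw [coeff_kPoly]
    split_ifs <;> positivity
  have hmul {p q : ℝ[X]} (hp : ∀ l, 0 ≤ p.coeff l) (hq : ∀ l, 0 ≤ q.coeff l) (l : ℕ) :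
      0 ≤ (p * q).coeff l := by
    rw [coeff_mul]
    exact Finset.sum_nonneg fun i _ => mul_nonneg (hp _) (hq _)
  have hpow {p : ℝ[X]} (hp : ∀ l, 0 ≤ p.coeff l) (m l : ℕ) : 0 ≤ (p ^ m).coeff l := by
    induction m generalizing l with
    | zero => rw [pow_zero, coeff_one]; split_ifs <;> norm_num
    | succ m ih => exact pow_succ p m ▸ hmul ih hp l
  have hC {x : ℝ} (hx : 0 ≤ x) (l : ℕ) : 0 ≤ (C x : ℝ[X]).coeff l := by
    rw [coeff_C]; split_ifs <;> simp [hx]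
  have hX (l : ℕ) : 0 ≤ (X : ℝ[X]).coeff l := by
    rw [coeff_X]; split_ifs <;> norm_num
  have hu (l : ℕ) : 0 ≤ (1 + kPoly c n).coeff l := by
    rw [coeff_add]
    exact add_nonneg (hC zero_le_one l) (hk l)
  have hder (l : ℕ) : 0 ≤ (derivative (kPoly c n)).coeff l := by
    rw [coeff_derivative]
    exact mul_nonneg (hk _) (by positivity)
  have hp (l : ℕ) : 0 ≤ (pPoly M cf (kPoly c n)).coeff l := by
    rw [pPoly, finsetSum_coeff]
    exact Finset.sum_nonneg fun m _ => hmul (hC (abs_nonneg _))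
      (hmul (hpow hX m) (hpow (hmul (hC zero_le_two) (hmul hu hu)) m)) l
  rw [qPoly, coeff_add, coeff_add]
  exact add_nonneg (hmul hp hu l) (add_nonneg (hmul hk hk l)
    (hmul (hmul (hC zero_le_three) hk) (hmul hX hder) l))

/-- The summand of index m is divisible by X^m, so Taylor coefficients with m > l cannot influence
degree l. -/
theorem coeff_qPoly_eq (k : ℝ[X]) {M r l : ℕ} (hMr : M ≤ r) (hl : l ≤ M) :
    (qPoly r cf k).coeff l = (qPoly M cf k).coeff l := by
  simp only [qPoly, coeff_add, add_left_inj]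
  simp only [pPoly, Finset.sum_mul, finsetSum_coeff]
  symm
  refine Finset.sum_subset (Finset.Icc_subset_Icc_right hMr) fun m hm hm' => ?_
  have hml : l < m := by
    rw [Finset.mem_Icc] at hm hm'
    omega
  rw [mul_assoc, mul_assoc, coeff_C_mul, coeff_X_pow_mul', if_neg (by omega), mul_zero]

/-- Cauchy's estimate on the radius c^{-n}: the coefficients are nonnegative, so the one of degree n
+ 1 times c^{-n(n+1)} is at most the value there, which is at most 1. -/
theorem coeff_qPoly_le {c : ℝ} (hc : 20 ≤ c) (hcf : CoeffBound c r cf) {n : ℕ} (hn : n < r) :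
    (qPoly r cf (kPoly c n)).coeff (n + 1) ≤ c ^ ((n + 1) * n) := by
  have hc0 : 0 < c := by linarith
  have h1 := coeff_mul_pow_le_eval (coeff_qPoly_nonneg (cf := cf) hc0.le (n + 1) n)
    (show 0 ≤ (c ^ n)⁻¹ by positivity) (n + 1)
  have h2 := h1.trans (qPoly_eval_le hc hcf le_rfl hn)
  rw [coeff_qPoly_eq _ hn le_rfl]
  rwa [inv_pow, ← div_eq_mul_inv, div_le_one (by positivity), ← pow_mul, mul_comm n] at h2

/-- Induction on the stage. The new coefficients are bounded by those of `qPoly` in degree n + 1,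
and `coeff_qPoly_le` says that these do not exceed the coefficient which `kPoly` acquires. -/
theorem maj_nf {c : ℝ} (hc : 20 ≤ c) (hcf : CoeffBound c r cf) {n : ℕ} (hn : n ≤ r) (a : ℕ+) :
    Maj ((nf r cf n).A a) (C (1 / 2) * kPoly c n) ∧
    Maj ((nf r cf n).B a) (C (1 / 2) * kPoly c n) ∧
    Maj ((nf r cf n).kA a) (kPoly c n) ∧ Maj ((nf r cf n).kB a) (kPoly c n) := by
  have hc0 : 0 < c := by linarith
  induction n generalizing a with
  | zero =>
    have h : kPoly c 0 = 0 := rfl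
    rw [h, mul_zero]
    exact ⟨Maj.zero, Maj.zero, Maj.zero, Maj.zero⟩
  | succ n ih =>
    have ih' := fun a => ih (by omega) a
    have hρ := Maj.rho (r := r) (cf := cf) (fun a => (ih' a).1) (fun a => (ih' a).2.1)
      (fun a => (ih' a).2.2.1) (fun a => (ih' a).2.2.2) a
    have hq := coeff_qPoly_le hc hcf (show n < r by omega)
    have hcoeff (l : ℕ) : (kPoly c n).coeff l ≤ (kPoly c (n + 1)).coeff l := by
      rw [coeff_kPoly, coeff_kPoly]
      by_cases h : 1 ≤ l ∧ l ≤ n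
      · rw [if_pos h, if_pos ⟨h.1, by omega⟩]
      · rw [if_neg h]
        split_ifs <;> positivity
    have hc1 : (kPoly c (n + 1)).coeff (n + 1) = c ^ ((n + 1) * n) := by
      rw [coeff_kPoly, if_pos ⟨by omega, le_rfl⟩, Nat.add_sub_cancel]
    refine ⟨fun w => ?_, fun w => ?_, fun w => ?_, fun w => ?_⟩
    · by_cases hw : w.length = n + 1
      · have := (abs_solA_le _ w).trans (mul_le_mul_of_nonneg_left (hρ.1 w) (by norm_num))
        simp only [nf, ext, if_pos hw, coeff_C_mul]
        rw [hw] at this ⊢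
        rw [hc1]
        exact this.trans (mul_le_mul_of_nonneg_left hq (by norm_num))
      · simp only [nf, ext, if_neg hw]
        refine ((ih' a).1 w).trans ?_
        rw [coeff_C_mul, coeff_C_mul]
        exact mul_le_mul_of_nonneg_left (hcoeff _) (by norm_num)
    · by_cases hw : w.length = n + 1
      · have := (abs_solB_le a _ w).trans (mul_le_mul_of_nonneg_left (hρ.2 w) (by norm_num))
        simp only [nf, ext, if_pos hw, coeff_C_mul]
        rw [hw] at this ⊢
        rw [hc1]
        exact this.trans (mul_le_mul_of_nonneg_left hq (by norm_num))
      · simp only [nf, ext, if_neg hw]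
        refine ((ih' a).2.1 w).trans ?_
        rw [coeff_C_mul, coeff_C_mul]
        exact mul_le_mul_of_nonneg_left (hcoeff _) (by norm_num)
    · by_cases hw : w.length = n + 1
      · have := (abs_resA_le _ w).trans (hρ.1 w)
        simp only [nf, ext, if_pos hw]
        rw [hw] at this ⊢
        rw [hc1]
        exact this.trans hq
      · simp only [nf, ext, if_neg hw]
        exact ((ih' a).2.2.1 w).trans (hcoeff _)
    · by_cases hw : w.length = n + 1
      · have := (abs_resB_le a _ w).trans (hρ.2 w)
        simp only [nf, ext, if_pos hw]
        rw [hw] at this ⊢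
        rw [hc1]
        exact this.trans hq
      · simp only [nf, ext, if_neg hw]
        exact ((ih' a).2.2.2 w).trans (hcoeff _)

end Ser

end

noncomputable section

/-! ### The spaces `ℓ²_s` -/

namespace Ell2

variable {s : ℝ}

/-- The element of `ℓ²_s` with the given entries. -/
def of (u : ℕ+ → ℂ) (h : IsSobolev s u) : Ell2 s := (⟨u, h⟩ : ↥(sobolevSubmodule s))

theorem of_apply (u : ℕ+ → ℂ) (h : IsSobolev s u) (a : ℕ+) : (of u h) a = u a := rfl

theorem ext' {x y : Ell2 s} (h : ∀ a, x a = y a) : x = y := Subtype.ext (funext h)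

theorem add_apply (x y : Ell2 s) (a : ℕ+) : (x + y) a = x a + y a := rfl

theorem smul_apply (c : ℂ) (x : Ell2 s) (a : ℕ+) : (c • x) a = c * x a := rfl

theorem real_smul_apply (c : ℝ) (x : Ell2 s) (a : ℕ+) : (c • x) a = c * x a := rfl

end Ell2

theorem IsSobolev.of_le {s : ℝ} {u z : ℕ+ → ℂ} (hz : IsSobolev s z) {M : ℝ}
    (h : ∀ a, ‖u a‖ ≤ M * ‖z a‖) : IsSobolev s u := by
  refine Summable.of_nonneg_of_le (fun a => by positivity) (fun a => ?_) (hz.mul_left (M ^ 2))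
  rw [mul_left_comm, ← mul_pow]
  exact mul_le_mul_of_nonneg_left (pow_le_pow_left₀ (norm_nonneg _) (h a) 2) (by positivity)

theorem sobNorm_nonneg (s : ℝ) (u : ℕ+ → ℂ) : 0 ≤ sobNorm s u := Real.sqrt_nonneg _

theorem sobNorm_le_of_le {s : ℝ} {u z : ℕ+ → ℂ} (hz : IsSobolev s z) {M : ℝ} (hM : 0 ≤ M)
    (h : ∀ a, ‖u a‖ ≤ M * ‖z a‖) : sobNorm s u ≤ M * sobNorm s z := by
  unfold sobNorm
  rw [← Real.sqrt_sq hM, ← Real.sqrt_mul (by positivity)]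
  refine Real.sqrt_le_sqrt ?_
  rw [← tsum_mul_left]
  refine (hz.of_le h).tsum_le_tsum (fun a => ?_) (hz.mul_left _)
  rw [mul_left_comm, ← mul_pow]
  exact mul_le_mul_of_nonneg_left (pow_le_pow_left₀ (norm_nonneg _) (h a) 2) (by positivity)

theorem phaseNorm_eq (s : ℝ) (u : ℕ+ → ℂ) : phaseNorm s u = √2 * sobNorm s u := by
  have h : sobNorm s (fun a => conj (u a)) = sobNorm s u := by simp [sobNorm]
  rw [phaseNorm, h, ← two_mul, Real.sqrt_mul (by norm_num), Real.sqrt_sq (sobNorm_nonneg _ _)]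

namespace Ell2

variable {s : ℝ}

theorem norm_le_of_le (u z : Ell2 s) {M : ℝ} (hM : 0 ≤ M) (h : ∀ a, ‖u a‖ ≤ M * ‖z a‖) :
    ‖u‖ ≤ M * ‖z‖ := by
  rw [norm_eq, norm_eq]
  exact sobNorm_le_of_le z.isSobolev hM h

/-- For s ≥ 0 the weights a^s are at least 1, so this is Hölder's inequality for the weighted
sequences. It is what makes ζ(z) absolutely summable. -/
theorem summable_mul (hs : 0 ≤ s) (x y : Ell2 s) :
    (Summable fun a => ‖x a‖ * ‖y a‖) ∧ ∑' a, ‖x a‖ * ‖y a‖ ≤ ‖x‖ * ‖y‖ := by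
  have hpq : (2 : ENNReal).toReal.HolderConjugate (2 : ENNReal).toReal := by
    rw [ENNReal.toReal_ofNat]
    exact Real.HolderConjugate.two_two
  obtain ⟨h1, h2⟩ := lp.tsum_mul_le_mul_norm hpq (toLp s x) (toLp s y)
  have h3 (x : Ell2 s) (a : ℕ+) : ‖x a‖ ≤ ‖(toLp s x : ℕ+ → ℂ) a‖ := by
    change _ ≤ ‖(((a : ℝ) ^ s : ℝ) : ℂ) * x a‖
    rw [norm_mul, Complex.norm_real, Real.norm_of_nonneg (by positivity)]
    refine le_mul_of_one_le_left (norm_nonneg _) (Real.one_le_rpow ?_ hs)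
    exact_mod_cast Nat.succ_le_of_lt a.pos
  have h4 (a : ℕ+) : ‖x a‖ * ‖y a‖
      ≤ ‖(toLp s x : ℕ+ → ℂ) a‖ * ‖(toLp s y : ℕ+ → ℂ) a‖ :=
    mul_le_mul (h3 x a) (h3 y a) (norm_nonneg _) (norm_nonneg _)
  have h5 : Summable fun a => ‖x a‖ * ‖y a‖ :=
    Summable.of_nonneg_of_le (fun a => by positivity) h4 h1
  exact ⟨h5, (h5.tsum_le_tsum h4 h1).trans h2⟩

/-- Complex conjugation of sequences. -/
def conjL (s : ℝ) : Ell2 s →L[ℝ] Ell2 s :=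
  LinearMap.mkContinuous
    { toFun := fun z => of (fun a => conj (z a)) (z.isSobolev.of_le (M := 1) fun a => by simp)
      map_add' := fun x y => ext' fun a => map_add _ _ _
      map_smul' := fun c x => ext' fun a => by simp [of_apply, real_smul_apply] } 1
    fun z => norm_le_of_le _ _ zero_le_one fun a => by simp [of_apply]

theorem conjL_apply (z : Ell2 s) (a : ℕ+) : conjL s z a = conj (z a) := rfl

end Ell2

/-! ### Bounded families of coefficients and their contraction with absolutely summable families -/

/-- Absolutely summable families indexed by `ZIndex`. -/
abbrev L1 : Type := lp (fun _ : ZIndex => ℂ) 1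

/-- Bounded families of coefficients. -/
abbrev BddCoeff : Type := lp (fun _ : ℕ+ × List ZIndex => ℂ) ⊤

theorem L1.norm_eq (v : L1) : ‖v‖ = ∑' j, ‖v j‖ := by
  rw [lp.norm_eq_tsum_rpow (by norm_num)]
  simp

theorem L1.summable (v : L1) : Summable fun j => ‖v j‖ := by
  have := (lp.memℓp v).summable (by norm_num)
  simpa using this

/-- The element of `L1` with the given entries. -/
def L1.of (v : ZIndex → ℂ) (h : Summable fun j => ‖v j‖) : L1 :=
  ⟨v, memℓp_gen (by simpa using h)⟩

theorem L1.of_apply (v : ZIndex → ℂ) (h : Summable fun j => ‖v j‖) (j : ZIndex) :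
    L1.of v h j = v j := rfl

namespace BddCoeff

/-- The element of `BddCoeff` with the given entries. -/
def of (c : ℕ+ × List ZIndex → ℂ) {M : ℝ} (h : ∀ x, ‖c x‖ ≤ M) : BddCoeff :=
  ⟨c, memℓp_infty ⟨M, by rintro _ ⟨x, rfl⟩; exact h x⟩⟩

theorem norm_apply_le (c : BddCoeff) (x : ℕ+ × List ZIndex) : ‖c x‖ ≤ ‖c‖ :=
  lp.norm_apply_le_norm ENNReal.top_ne_zero c x

theorem norm_mul_le (v : L1) (c : BddCoeff) (x : ℕ+ × List ZIndex) (j : ZIndex) :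
    ‖v j * c (x.1, j :: x.2)‖ ≤ ‖v j‖ * ‖c‖ := by
  rw [norm_mul]
  exact mul_le_mul_of_nonneg_left (norm_apply_le c _) (norm_nonneg _)

theorem summable_mul (v : L1) (c : BddCoeff) (x : ℕ+ × List ZIndex) :
    Summable fun j => v j * c (x.1, j :: x.2) :=
  Summable.of_norm_bounded (v.summable.mul_right _) (norm_mul_le v c x)

theorem norm_tsum_le (v : L1) (c : BddCoeff) (x : ℕ+ × List ZIndex) :
    ‖∑' j, v j * c (x.1, j :: x.2)‖ ≤ ‖v‖ * ‖c‖ := by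
  rw [L1.norm_eq]
  exact tsum_of_norm_bounded (v.summable.hasSum.mul_right _) (norm_mul_le v c x)

/-- The contraction of the first letter. -/
def contr : L1 →L[ℂ] BddCoeff →L[ℂ] BddCoeff :=
  LinearMap.mkContinuous₂
    (LinearMap.mk₂ ℂ (fun v c => of (fun x => ∑' j, v j * c (x.1, j :: x.2)) (norm_tsum_le v c))
      (fun v v' c => by
        ext x
        change ∑' j, (v j + v' j) * c (x.1, j :: x.2) = (∑' j, v j * c (x.1, j :: x.2))
          + ∑' j, v' j * c (x.1, j :: x.2)
        rw [← (summable_mul v c x).tsum_add (summable_mul v' c x)]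
        exact tsum_congr fun j => add_mul _ _ _)
      (fun t v c => by
        ext x
        change ∑' j, (t • v j) * c (x.1, j :: x.2) = t • ∑' j, v j * c (x.1, j :: x.2)
        rw [← (summable_mul v c x).tsum_const_smul]
        exact tsum_congr fun j => smul_mul_assoc _ _ _)
      (fun v c c' => by
        ext x
        change ∑' j, v j * (c (x.1, j :: x.2) + c' (x.1, j :: x.2))
          = (∑' j, v j * c (x.1, j :: x.2)) + ∑' j, v j * c' (x.1, j :: x.2)
        rw [← (summable_mul v c x).tsum_add (summable_mul v c' x)]
        exact tsum_congr fun j => mul_add _ _ _)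
      (fun t v c => by
        ext x
        change ∑' j, v j * (t • c (x.1, j :: x.2)) = t • ∑' j, v j * c (x.1, j :: x.2)
        rw [← (summable_mul v c x).tsum_const_smul]
        exact tsum_congr fun j => mul_smul_comm _ _ _))
    1 fun v c => by
      rw [one_mul]
      exact lp.norm_le_of_forall_le (by positivity) fun x => norm_tsum_le v c x

/-- The coefficients of the words with first letter `j`. -/
def tl (c : BddCoeff) (j : ZIndex) : BddCoeff :=
  of (fun x => c (x.1, j :: x.2)) fun _ => norm_apply_le c _

theorem norm_tl_le (c : BddCoeff) (j : ZIndex) : ‖tl c j‖ ≤ ‖c‖ :=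
  lp.norm_le_of_forall_le (norm_nonneg _) fun _ => norm_apply_le c _

/-- Convergence in the sup norm, and not only entrywise, so that bounded operators can be applied
term by term. -/
theorem hasSum_contr (v : L1) (c : BddCoeff) : HasSum (fun j => v j • tl c j) (contr v c) := by
  have h : Summable fun j => v j • tl c j := by
    refine Summable.of_norm_bounded (v.summable.mul_right ‖c‖) fun j => ?_
    rw [norm_smul]
    exact mul_le_mul_of_nonneg_left (norm_tl_le c j) (norm_nonneg _)
  convert h.hasSum
  ext x
  have h1 := (lp.evalCLM ℂ (fun _ : ℕ+ × List ZIndex => ℂ) ⊤ x).hasSum h.hasSum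
  exact h1.tsum_eq

/-- Multiplication of a sequence by the coefficients of the empty word. -/
def mulL (s : ℝ) : BddCoeff →L[ℝ] Ell2 s →L[ℝ] Ell2 s :=
  LinearMap.mkContinuous₂
    (LinearMap.mk₂ ℝ (fun c z => Ell2.of (fun a => c (a, []) * z a)
        (z.isSobolev.of_le (M := ‖c‖) fun a => by
          rw [norm_mul]
          exact mul_le_mul_of_nonneg_right (norm_apply_le c _) (norm_nonneg _)))
      (fun c c' z => Ell2.ext' fun a => add_mul _ _ _)
      (fun t c z => Ell2.ext' fun a => smul_mul_assoc t (c (a, [])) (z a))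
      (fun c z z' => Ell2.ext' fun a => mul_add _ _ _)
      (fun t c z => Ell2.ext' fun a => mul_smul_comm t (c (a, [])) (z a)))
    1 fun c z => by
      rw [one_mul]
      refine Ell2.norm_le_of_le _ _ (norm_nonneg c) fun a => ?_
      change ‖c (a, []) * z a‖ ≤ _
      rw [norm_mul]
      exact mul_le_mul_of_nonneg_right (norm_apply_le c _) (norm_nonneg _)

end BddCoeff

/-! ### The quadratic monomials -/

/-- The symmetric bilinear form of the quadratic map `z ↦ ζ(z)`. -/
def zetaBil (z h : ℕ+ → ℂ) (j : ZIndex) : ℂ :=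
  match j.1 with
  | SignType.pos => z j.2 * h j.2
  | SignType.neg => conj (z j.2) * conj (h j.2)
  | SignType.zero => (z j.2 * conj (h j.2) + conj (z j.2) * h j.2) / 2

theorem zetaBil_self (z : ℕ+ → ℂ) (j : ZIndex) : zetaBil z z j = zeta z j := by
  obtain ⟨δ, a⟩ := j
  cases δ
  · change (z a * conj (z a) + conj (z a) * z a) / 2 = ((‖z a‖ ^ 2 : ℝ) : ℂ)
    rw [mul_comm (conj (z a)), ← Complex.normSq_eq_norm_sq, Complex.mul_conj]
    ring
  · exact (sq _).symm
  · exact (sq _).symm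

theorem norm_zetaBil_le (z h : ℕ+ → ℂ) (j : ZIndex) : ‖zetaBil z h j‖ ≤ ‖z j.2‖ * ‖h j.2‖ := by
  obtain ⟨δ, a⟩ := j
  cases δ
  · change ‖(z a * conj (h a) + conj (z a) * h a) / 2‖ ≤ _
    rw [norm_div, div_le_iff₀ (by norm_num)]
    refine (norm_add_le _ _).trans (le_of_eq ?_)
    simp
    ring
  · change ‖conj (z a) * conj (h a)‖ ≤ _
    simp
  · change ‖z a * h a‖ ≤ _
    simp

/-- The factor 3 is the number of signs; it is the 3 in every later bound of ∑ ‖ζ_j‖ by 3‖z‖². -/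
theorem hasSum_zindex {f : ℕ+ → ℝ} {x : ℝ} (hf : HasSum f x) (h0 : ∀ a, 0 ≤ f a) :
    HasSum (fun j : ZIndex => f j.2) (3 * x) := by
  have h1 : Summable fun j : ZIndex => f j.2 := by
    rw [summable_prod_of_nonneg fun j => h0 j.2]
    exact ⟨fun _ => hf.summable, Summable.of_finite⟩
  have h2 := h1.hasSum
  rw [h1.tsum_prod, tsum_fintype] at h2
  simpa [hf.tsum_eq, show Fintype.card SignType = 3 from rfl] using h2

theorem summable_zetaBil {s : ℝ} (hs : 0 ≤ s) (z h : Ell2 s) :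
    (Summable fun j => ‖zetaBil z h j‖) ∧ ∑' j, ‖zetaBil z h j‖ ≤ 3 * (‖z‖ * ‖h‖) := by
  obtain ⟨h1, h2⟩ := Ell2.summable_mul hs z h
  have h3 := hasSum_zindex h1.hasSum fun a => by positivity
  have h4 : Summable fun j => ‖zetaBil z h j‖ :=
    Summable.of_nonneg_of_le (fun _ => norm_nonneg _) (norm_zetaBil_le z h) h3.summable
  refine ⟨h4, (h4.tsum_le_tsum (norm_zetaBil_le z h) h3.summable).trans ?_⟩
  rw [h3.tsum_eq]
  linarith

/-- `zetaBil` as a continuous bilinear map. -/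
def zetaL (s : ℝ) (hs : 0 ≤ s) : Ell2 s →L[ℝ] Ell2 s →L[ℝ] L1 :=
  LinearMap.mkContinuous₂
    (LinearMap.mk₂ ℝ (fun z h => L1.of (zetaBil z h) (summable_zetaBil hs z h).1)
      (fun x y h => by
        ext ⟨δ, a⟩
        cases δ
        · change ((x a + y a) * conj (h a) + conj (x a + y a) * h a) / 2
            = (x a * conj (h a) + conj (x a) * h a) / 2
              + (y a * conj (h a) + conj (y a) * h a) / 2
          rw [map_add]; ring
        · change conj (x a + y a) * conj (h a) = conj (x a) * conj (h a) + conj (y a) * conj (h a)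
          rw [map_add]; ring
        · exact add_mul _ _ _)
      (fun t x h => by
        ext ⟨δ, a⟩
        cases δ
        · change ((t * x a) * conj (h a) + conj (t * x a) * h a) / 2
            = t * ((x a * conj (h a) + conj (x a) * h a) / 2)
          rw [map_mul, Complex.conj_ofReal]; ring
        · change conj (t * x a) * conj (h a) = t * (conj (x a) * conj (h a))
          rw [map_mul, Complex.conj_ofReal]; ring
        · exact mul_assoc _ _ _)
      (fun h x y => by
        ext ⟨δ, a⟩
        cases δ
        · change (h a * conj (x a + y a) + conj (h a) * (x a + y a)) / 2
            = (h a * conj (x a) + conj (h a) * x a) / 2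
              + (h a * conj (y a) + conj (h a) * y a) / 2
          rw [map_add]; ring
        · change conj (h a) * conj (x a + y a) = conj (h a) * conj (x a) + conj (h a) * conj (y a)
          rw [map_add]; ring
        · exact mul_add _ _ _)
      (fun t h x => by
        ext ⟨δ, a⟩
        cases δ
        · change (h a * conj (t * x a) + conj (h a) * (t * x a)) / 2
            = t * ((h a * conj (x a) + conj (h a) * x a) / 2)
          rw [map_mul, Complex.conj_ofReal]; ring
        · change conj (h a) * conj (t * x a) = t * (conj (h a) * conj (x a))
          rw [map_mul, Complex.conj_ofReal]; ring
        · exact mul_left_comm _ _ _))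
    3 fun z h => by
      rw [L1.norm_eq, mul_assoc]
      exact (summable_zetaBil hs z h).2

end

/-! ### Iterated contractions and smooth polynomial maps of ℓ²_s -/

noncomputable section

namespace BddCoeff

open Ser Polynomial

/-- The contraction of the first `l` letters. -/
def pw (l : ℕ) (v : L1) : BddCoeff →L[ℂ] BddCoeff := contr v ^ l

theorem pw_succ (l : ℕ) : pw (l + 1) = fun v => pw l v * contr v := funext fun _ => pow_succ _ _

/-- A power of a bounded operator that depends linearly on v: smoothness in operator norm needs no
estimate of the individual homogeneous terms. -/
theorem contDiff_pw (l : ℕ) {n : ℕ∞ω} : ContDiff ℂ n (pw l) := by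
  induction l with
  | zero => exact contDiff_const
  | succ l ih =>
    rw [pw_succ]
    exact ih.mul contr.contDiff

set_option synthInstance.maxHeartbeats 200000 in
theorem fderiv_pw_succ (l : ℕ) (v u : L1) :
    fderiv ℂ (pw (l + 1)) v u = fderiv ℂ (pw l) v u * contr v + pw l v * contr u := by
  have h := ((contDiff_pw l (n := 1)).differentiable one_ne_zero v).hasFDerivAt.mul'
    (contr.hasFDerivAt (x := v))
  have h2 : fderiv ℂ (pw (l + 1)) v = _ := (congrArg (fderiv ℂ · v) (pw_succ l)).trans h.fderiv
  rw [h2]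
  change pw l v * contr u + fderiv ℂ (pw l) v u * contr v = _
  exact add_comm _ _

/-- The coefficients of a family of series. -/
def ofSer (A : ℕ+ → Ser) {p : ℝ[X]} (h : ∀ a, Maj (A a) p) : BddCoeff :=
  of (fun x => (A x.1 x.2 : ℂ)) (M := p.eval 1) fun x => by
    rw [Complex.norm_real]
    have := coeff_mul_pow_le_eval (h 1).coeff_nonneg zero_le_one x.2.length
    rw [one_pow, mul_one] at this
    exact (h x.1 x.2).trans this

theorem tl_ofSer (A : ℕ+ → Ser) {p : ℝ[X]} (h : ∀ a, Maj (A a) p) (j : ZIndex) :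
    tl (ofSer A h) j = ofSer (fun a => Ser.tl (A a) j) fun a => (h a).tl j := rfl

theorem hasSum_apply_contr (L : BddCoeff →L[ℂ] BddCoeff) (v : L1) (c : BddCoeff)
    (x : ℕ+ × List ZIndex) : HasSum (fun j => v j * L (tl c j) x) (L (contr v c) x) := by
  have h := ((lp.evalCLM ℂ (fun _ : ℕ+ × List ZIndex => ℂ) ⊤ x).comp L).hasSum (hasSum_contr v c)
  have e : (fun j => v j * L (tl c j) x) = fun j =>
      ((lp.evalCLM ℂ (fun _ : ℕ+ × List ZIndex => ℂ) ⊤ x).comp L) (v j • tl c j) :=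
    funext fun j => by rw [map_smul]; rfl
  rw [e]
  exact h

/-- Contracting l letters and reading off the empty word evaluates the degree-l part. This
identifies the operator picture, which is smooth, with `ev`, which is computable. -/
theorem pw_ofSer (A : ℕ+ → Ser) {p : ℝ[X]} (h : ∀ a, Maj (A a) p) (v : L1) (l : ℕ) (a : ℕ+) :
    pw l v (ofSer A h) (a, []) = ev l (A a) v := by
  induction l generalizing A p with
  | zero => rfl
  | succ l ih =>
    rw [pw_succ, ev_succ]
    change pw l v (contr v _) _ = _
    rw [← (hasSum_apply_contr (pw l v) v (ofSer A h) (a, [])).tsum_eq]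
    exact tsum_congr fun j => by rw [tl_ofSer, ih]

/-- The product rule for operator powers and the recursion that defines `dev` agree, so the analytic
derivative is the formal one. -/
theorem fderiv_pw_ofSer (A : ℕ+ → Ser) {p : ℝ[X]} (h : ∀ a, Maj (A a) p) (v u : L1) (l : ℕ)
    (a : ℕ+) : fderiv ℂ (pw l) v u (ofSer A h) (a, []) = dev l (A a) v u := by
  induction l generalizing A p with
  | zero =>
    have : pw 0 = fun _ => 1 := rfl
    rw [this, fderiv_fun_const]
    rfl
  | succ l ih =>
    rw [fderiv_pw_succ, dev_succ]
    change (fderiv ℂ (pw l) v u (contr v _)) _ + pw l v (contr u _) _ = _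
    have h1 := hasSum_apply_contr (fderiv ℂ (pw l) v u) v (ofSer A h) (a, [])
    have h2 := hasSum_apply_contr (pw l v) u (ofSer A h) (a, [])
    rw [add_comm, ← (h2.add h1).tsum_eq]
    exact tsum_congr fun j => by rw [tl_ofSer, ih, pw_ofSer]

variable {s : ℝ} (hs : 0 ≤ s)

/-- `ζ(z)` as an element of `L1`. -/
def zetaQ (z : Ell2 s) : L1 := zetaL s hs z z

theorem zetaQ_coe (z : Ell2 s) : (zetaQ hs z : ZIndex → ℂ) = zeta z :=
  funext fun j => zetaBil_self z j

theorem contDiff_zetaQ {n : ℕ∞ω} : ContDiff ℝ n (zetaQ hs) :=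
  (zetaL s hs).contDiff.clm_apply contDiff_id

theorem zetaL_comm (z h : Ell2 s) : zetaL s hs z h = zetaL s hs h z := by
  ext ⟨δ, a⟩
  cases δ
  · change (z a * conj (h a) + conj (z a) * h a) / 2 = (h a * conj (z a) + conj (h a) * z a) / 2
    ring
  · exact mul_comm _ _
  · exact mul_comm _ _

theorem hasFDerivAt_zetaQ (z : Ell2 s) :
    HasFDerivAt (zetaQ hs) ((2 : ℝ) • zetaL s hs z) z := by
  have h := (zetaL s hs).hasFDerivAt (x := z) |>.clm_apply (hasFDerivAt_id z)
  have e : (2 : ℝ) • zetaL s hs z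
      = (zetaL s hs z).comp (ContinuousLinearMap.id ℝ (Ell2 s)) + (zetaL s hs).flip z := by
    rw [two_smul]
    ext1 x
    change zetaL s hs z x + zetaL s hs z x = zetaL s hs z x + zetaL s hs x z
    rw [zetaL_comm hs x z]
  rw [e]
  exact h

/-- The part of degree at most `N` of a family of series at `ζ(z)`. -/
def pol (c : BddCoeff) (N : ℕ) (z : Ell2 s) : BddCoeff :=
  ∑ l ∈ Finset.range (N + 1), pw l (zetaQ hs z) c

theorem contDiff_pol (c : BddCoeff) (N : ℕ) {n : ℕ∞ω} : ContDiff ℝ n (pol hs c N) := by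
  refine ContDiff.sum fun l _ => ?_
  have h1 : ContDiff ℝ n fun z : Ell2 s => pw l (zetaQ hs z) :=
    ((contDiff_pw l).restrict_scalars ℝ).comp (contDiff_zetaQ hs)
  exact (((ContinuousLinearMap.apply ℂ BddCoeff c).contDiff (n := n)).restrict_scalars ℝ).comp h1

theorem pol_apply (A : ℕ+ → Ser) {p : ℝ[X]} (h : ∀ a, Maj (A a) p) (z : Ell2 s) (a : ℕ+) :
    pol hs (ofSer A h) p.natDegree z (a, []) = E (A a) (zeta z) := by
  rw [E_eq_sum (n := p.natDegree + 1) _ (h a) (Nat.lt_succ_self _), pol, lp.coeFn_sum,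
    Finset.sum_apply]
  · exact Finset.sum_congr rfl fun l _ => by rw [pw_ofSer, zetaQ_coe]
  · rw [← zetaQ_coe hs]
    exact L1.summable _

theorem fderiv_pol_apply (A : ℕ+ → Ser) {p : ℝ[X]} (h : ∀ a, Maj (A a) p) (z x : Ell2 s)
    (a : ℕ+) : fderiv ℝ (pol hs (ofSer A h) p.natDegree) z x (a, [])
      = dE (A a) (zeta z) (fun j => 2 * zetaBil z x j) := by
  have h1 (l : ℕ) : HasFDerivAt (fun z : Ell2 s => pw l (zetaQ hs z) (ofSer A h))
      (((ContinuousLinearMap.apply ℂ BddCoeff (ofSer A h)).restrictScalars ℝ).comp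
        (((fderiv ℂ (pw l) (zetaQ hs z)).restrictScalars ℝ).comp ((2 : ℝ) • zetaL s hs z))) z := by
    have h2 := (((contDiff_pw l (n := 1)).differentiable one_ne_zero
      (zetaQ hs z)).hasFDerivAt.restrictScalars ℝ).comp z (hasFDerivAt_zetaQ hs z)
    exact ((ContinuousLinearMap.apply ℂ BddCoeff
      (ofSer A h)).restrictScalars ℝ).hasFDerivAt.comp z h2
  have h3 := (HasFDerivAt.fun_sum (u := Finset.range (p.natDegree + 1)) fun l _ => h1 l).fderiv
  change fderiv ℝ (pol hs (ofSer A h) p.natDegree) z = _ at h3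
  have h4 : ((((2 : ℝ) • zetaL s hs z) x : L1) : ZIndex → ℂ)
      = fun j => 2 * zetaBil z x j := by
    funext j
    change (2 : ℝ) • zetaBil z x j = _
    rw [Complex.real_smul, Complex.ofReal_ofNat]
  have hu : Summable fun j => ‖2 * zetaBil z x j‖ := by
    have := L1.summable (((2 : ℝ) • zetaL s hs z) x)
    rw [h4] at this
    exact this
  have hv : Summable fun j => ‖zeta z j‖ := by
    rw [← zetaQ_coe hs]
    exact L1.summable _
  rw [h3, _root_.sum_apply, lp.coeFn_sum, Finset.sum_apply,
    dE_eq_sum (n := p.natDegree + 1) hv hu (h a) (Nat.lt_succ_self _)]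
  refine Finset.sum_congr rfl fun l _ => ?_
  change (fderiv ℂ (pw l) (zetaQ hs z)) (((2 : ℝ) • zetaL s hs z) x) (ofSer A h) (a, []) = _
  rw [fderiv_pw_ofSer, zetaQ_coe, h4]

end BddCoeff

open Ser Polynomial BddCoeff

section polynomialMaps

variable {s : ℝ} (hs : 0 ≤ s) {A B : ℕ+ → Ser} {p : ℝ[X]} (hA : ∀ a, Maj (A a) p)
  (hB : ∀ a, Maj (B a) p)

/-- The map with entries `z_a A_a(ζ(z)) + z̄_a B_a(ζ(z))`. -/
def polyMap (z : Ell2 s) : Ell2 s :=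
  mulL s (pol hs (ofSer A hA) p.natDegree z) z
    + mulL s (pol hs (ofSer B hB) p.natDegree z) (Ell2.conjL s z)

/-- The coefficients are controlled uniformly in a, so they form a smooth map into a sup-normed
space that acts boundedly on ℓ²_s by multiplication. Complex conjugation makes this real smoothness
only. -/
theorem contDiff_polyMap {n : ℕ∞ω} : ContDiff ℝ n (polyMap hs hA hB) :=
  (((mulL s).contDiff.comp (contDiff_pol hs _ _)).clm_apply contDiff_id).add
    (((mulL s).contDiff.comp (contDiff_pol hs _ _)).clm_apply (Ell2.conjL s).contDiff)

theorem polyMap_apply (z : Ell2 s) (a : ℕ+) :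
    polyMap hs hA hB z a = E (A a) (zeta z) * z a + E (B a) (zeta z) * conj (z a) := by
  rw [← pol_apply hs A hA, ← pol_apply hs B hB]
  rfl

theorem fderiv_polyMap_apply (z x : Ell2 s) (a : ℕ+) :
    fderiv ℝ (polyMap hs hA hB) z x a
      = E (A a) (zeta z) * x a + E (B a) (zeta z) * conj (x a)
        + dE (A a) (zeta z) (fun j => 2 * zetaBil z x j) * z a
        + dE (B a) (zeta z) (fun j => 2 * zetaBil z x j) * conj (z a) := by
  have hd (A : ℕ+ → Ser) (hA : ∀ a, Maj (A a) p) :=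
    ((contDiff_pol hs (ofSer A hA) p.natDegree (n := 1)).differentiable one_ne_zero
      z).hasFDerivAt
  have h1 := ((mulL s).hasFDerivAt.comp z (hd A hA)).clm_apply (hasFDerivAt_id z)
  have h2 := ((mulL s).hasFDerivAt.comp z (hd B hB)).clm_apply (Ell2.conjL s).hasFDerivAt
  have h3 := (h1.add h2).fderiv
  change fderiv ℝ (polyMap hs hA hB) z = _ at h3
  rw [h3, ← pol_apply hs A hA, ← pol_apply hs B hB, ← fderiv_pol_apply hs A hA,
    ← fderiv_pol_apply hs B hB]
  change (_ * x a + _ * z a) + (_ * conj (x a) + _ * conj (z a)) = _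
  ring!

end polynomialMaps

end

noncomputable section

/-! ### Polynomial fields with symmetrized coefficients -/

section tsums

theorem summable_prod_fin {v : ZIndex → ℂ} (hv : Summable fun j => ‖v j‖) (l : ℕ) :
    Summable fun j : Fin l → ZIndex => ∏ k, ‖v (j k)‖ := by
  induction l with
  | zero => exact Summable.of_finite
  | succ l ih =>
    rw [← (Fin.consEquiv fun _ : Fin (l + 1) => ZIndex).summable_iff]
    refine (hv.mul_of_nonneg ih (fun _ => norm_nonneg _) fun _ =>
      Finset.prod_nonneg fun _ _ => norm_nonneg _).congr fun x => ?_
    simp [Fin.prod_univ_succ, Fin.consEquiv]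

theorem summable_mul_prod {v : ZIndex → ℂ} (hv : Summable fun j => ‖v j‖) {l : ℕ}
    {f : (Fin l → ZIndex) → ℝ} {M : ℝ} (hf : ∀ j, |f j| ≤ M) :
    Summable fun j : Fin l → ZIndex => (f j : ℂ) * ∏ k, v (j k) := by
  refine Summable.of_norm_bounded ((summable_prod_fin hv l).mul_left M) fun j => ?_
  rw [norm_mul, Complex.norm_real, norm_prod]
  exact mul_le_mul_of_nonneg_right (hf j) (Finset.prod_nonneg fun _ _ => norm_nonneg _)

open Ser Polynomial in
theorem Ser.ev_eq_tsum {v : ZIndex → ℂ} (hv : Summable fun j => ‖v j‖) {c : Ser} {p : ℝ[X]}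
    (hc : Maj c p) (l : ℕ) :
    ev l c v = ∑' j : Fin l → ZIndex, (c (List.ofFn j) : ℂ) * ∏ k, v (j k) := by
  induction l generalizing c p with
  | zero =>
    rw [tsum_fintype]
    simp [ev]
  | succ l ih =>
    have h1 : Summable fun j : Fin (l + 1) → ZIndex => (c (List.ofFn j) : ℂ) * ∏ k, v (j k) :=
      summable_mul_prod hv (f := fun j => c (List.ofFn j)) (M := p.coeff (l + 1)) fun j => by
        simpa using hc (List.ofFn j)
    rw [ev_succ, ← (Fin.consEquiv fun _ : Fin (l + 1) => ZIndex).tsum_eq]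
    rw [← (Fin.consEquiv fun _ : Fin (l + 1) => ZIndex).summable_iff] at h1
    refine Eq.trans ?_ h1.tsum_prod.symm
    refine tsum_congr fun j => ?_
    rw [ih (hc.tl j), ← tsum_mul_left]
    refine tsum_congr fun w => ?_
    simp only [Fin.consEquiv, Equiv.coe_fn_mk, Fin.prod_univ_succ, List.ofFn_succ, Fin.cons_zero,
      Fin.cons_succ, tl_apply, Function.comp_apply]
    ring

end tsums

section symmetrization

variable {l : ℕ}

/-- The symmetrization of a function of multiindices. -/
def symF (f : (Fin l → ZIndex) → ℝ) (j : Fin l → ZIndex) : ℝ :=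
  (l.factorial : ℝ)⁻¹ * ∑ σ : Equiv.Perm (Fin l), f fun k => j (σ k)

/-- The action of a permutation on multiindices. -/
def permIndex (σ : Equiv.Perm (Fin l)) : (Fin l → ZIndex) ≃ (Fin l → ZIndex) where
  toFun j k := j (σ k)
  invFun j k := j (σ.symm k)
  left_inv j := by simp
  right_inv j := by simp

theorem symF_perm (f : (Fin l → ZIndex) → ℝ) (j : Fin l → ZIndex) (σ : Equiv.Perm (Fin l)) :
    symF f (fun k => j (σ k)) = symF f j := by
  unfold symF
  congr 1
  exact Equiv.sum_comp (Equiv.mulLeft σ) fun τ : Equiv.Perm (Fin l) => f fun k => j (τ k)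

theorem abs_symF_le {f : (Fin l → ZIndex) → ℝ} {M : ℝ} (hf : ∀ j, |f j| ≤ M)
    (j : Fin l → ZIndex) : |symF f j| ≤ M := by
  have h0 : (0 : ℝ) < l.factorial := by exact_mod_cast l.factorial_pos
  rw [symF, abs_mul, abs_of_pos (inv_pos.2 h0), inv_mul_le_iff₀ h0]
  refine (Finset.abs_sum_le_sum_abs _ _).trans ((Finset.sum_le_sum fun σ _ => hf _).trans ?_)
  simp [Fintype.card_perm]

theorem symF_eq_zero {f : (Fin l → ZIndex) → ℝ} {j : Fin l → ZIndex}
    (h : ∀ σ : Equiv.Perm (Fin l), f (fun k => j (σ k)) = 0) : symF f j = 0 := by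
  simp [symF, h]

theorem tsum_sum_perm {F : (Fin l → ZIndex) → ℂ} (hF : Summable F) :
    ∑' j, ∑ σ : Equiv.Perm (Fin l), F (permIndex σ j) = (l.factorial : ℂ) * ∑' j, F j := by
  have h5 : ∑' j, ∑ σ : Equiv.Perm (Fin l), F (permIndex σ j)
      = ∑ σ : Equiv.Perm (Fin l), ∑' j, F (permIndex σ j) :=
    Summable.tsum_finsetSum fun σ _ => (permIndex σ).summable_iff.2 hF
  have h6 (σ : Equiv.Perm (Fin l)) : ∑' j, F (permIndex σ j) = ∑' j, F j := (permIndex σ).tsum_eq F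
  rw [h5, Finset.sum_congr rfl fun σ _ => h6 σ, Finset.sum_const, Finset.card_univ,
    Fintype.card_perm, Fintype.card_fin, nsmul_eq_mul]

theorem symF_mul_prod (f : (Fin l → ZIndex) → ℝ) (v : ZIndex → ℂ) (j : Fin l → ZIndex) :
    (symF f j : ℂ) * ∏ k, v (j k) = (l.factorial : ℂ)⁻¹ *
      ∑ σ : Equiv.Perm (Fin l), (f (permIndex σ j) : ℂ) * ∏ k, v (permIndex σ j k) := by
  have h2 (σ : Equiv.Perm (Fin l)) : ∏ k, v (permIndex σ j k) = ∏ k, v (j k) :=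
    Equiv.prod_comp σ fun k => v (j k)
  have h3 : (symF f j : ℂ)
      = (l.factorial : ℂ)⁻¹ * ∑ σ : Equiv.Perm (Fin l), (f (permIndex σ j) : ℂ) := by
    rw [symF, Complex.ofReal_mul, Complex.ofReal_inv, Complex.ofReal_natCast, Complex.ofReal_sum]
    rfl
  rw [Finset.sum_congr rfl fun σ _ => by rw [h2 σ], ← Finset.sum_mul, h3, mul_assoc]

/-- The monomials commute, so every permuted copy of the coefficients has the same sum; averaging
them does not change the field. -/
theorem tsum_symF {v : ZIndex → ℂ} (hv : Summable fun j => ‖v j‖) {f : (Fin l → ZIndex) → ℝ}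
    {M : ℝ} (hf : ∀ j, |f j| ≤ M) :
    ∑' j : Fin l → ZIndex, (symF f j : ℂ) * ∏ k, v (j k)
      = ∑' j : Fin l → ZIndex, (f j : ℂ) * ∏ k, v (j k) := by
  have h0 : (l.factorial : ℂ) ≠ 0 := Nat.cast_ne_zero.2 l.factorial_ne_zero
  rw [tsum_congr (symF_mul_prod f v), tsum_mul_left, tsum_sum_perm (summable_mul_prod hv hf),
    inv_mul_cancel_left₀ h0]

end symmetrization

namespace PolyField

variable {l : ℕ}

/-- The reversible field whose coefficients are `i` times the symmetrizations of `f` and `g`. -/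
def ofFun (f g : ℕ+ → (Fin l → ZIndex) → ℝ) (M : ℝ) (hf : ∀ a j, |f a j| ≤ M)
    (hg : ∀ a j, |g a j| ≤ M) : PolyField l where
  zz a j := Complex.I * symF (f a) j
  zb a j := Complex.I * symF (g a) j
  bb a j := -Complex.I * symF (f a) j
  bz a j := -Complex.I * symF (g a) j
  zz_eq a j := by simp
  zb_eq a j := by simp
  bddAbove := ⟨M, by
    rintro _ ⟨p, rfl⟩
    simpa using ⟨abs_symF_le (hf p.1) p.2, abs_symF_le (hg p.1) p.2⟩⟩
  zz_perm a j σ := by rw [symF_perm]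
  zb_perm a j σ := by rw [symF_perm]

variable {f g : ℕ+ → (Fin l → ZIndex) → ℝ} {M : ℝ} {hf : ∀ a j, |f a j| ≤ M}
  {hg : ∀ a j, |g a j| ≤ M}

theorem ofFun_isReversible : (ofFun f g M hf hg).IsReversible := fun a j => by simp [ofFun]

theorem coeffNorm_ofFun_le : (ofFun f g M hf hg).coeffNorm ≤ M := by
  have : Nonempty (ℕ+ × (Fin l → ZIndex)) := ⟨1, fun _ => (0, 1)⟩
  refine ciSup_le fun p => ?_
  simpa [ofFun] using ⟨abs_symF_le (hf p.1) p.2, abs_symF_le (hg p.1) p.2⟩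

theorem compZ_ofFun {z : ℕ+ → ℂ} (hz : Summable fun j => ‖zeta z j‖) (a : ℕ+) :
    (ofFun f g M hf hg).compZ z a = Complex.I *
      (z a * ∑' j : Fin l → ZIndex, (f a j : ℂ) * ∏ k, zeta z (j k)
        + conj (z a) * ∑' j : Fin l → ZIndex, (g a j : ℂ) * ∏ k, zeta z (j k)) := by
  rw [← tsum_symF hz (hf a), ← tsum_symF hz (hg a)]
  simp only [compZ, ofFun, zetaProd, mul_assoc, tsum_mul_left]
  ring

/-- Support conditions that are stable under permutations survive symmetrization. It serves both the
resonant and the integrable index sets. -/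
theorem ofFun_isIntegrable_of {S₀ : Set (Fin l → ZIndex)} {S : ℕ+ → Set (Fin l → ZIndex)}
    (hS₀ : ∀ j, ∀ σ : Equiv.Perm (Fin l), (fun k => j (σ k)) ∈ S₀ → j ∈ S₀)
    (hS : ∀ a j, ∀ σ : Equiv.Perm (Fin l), (fun k => j (σ k)) ∈ S a → j ∈ S a)
    (h0 : ∀ a j, j ∉ S₀ → f a j = 0) (h1 : ∀ a j, j ∉ S a → g a j = 0) (a : ℕ+)
    (j : Fin l → ZIndex) :
    (j ∉ S₀ → (ofFun f g M hf hg).zz a j = 0 ∧ (ofFun f g M hf hg).bb a j = 0) ∧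
    (j ∉ S a → (ofFun f g M hf hg).zb a j = 0 ∧ (ofFun f g M hf hg).bz a j = 0) := by
  refine ⟨fun hj => ?_, fun hj => ?_⟩
  · have : symF (f a) j = 0 := symF_eq_zero fun σ => h0 a _ fun h => hj (hS₀ j σ h)
    simp [ofFun, this]
  · have : symF (g a) j = 0 := symF_eq_zero fun σ => h1 a _ fun h => hj (hS a j σ h)
    simp [ofFun, this]

theorem resDelta_perm (j : Fin l → ZIndex) (σ : Equiv.Perm (Fin l)) :
    resDelta (fun k => j (σ k)) = resDelta j :=
  Equiv.sum_comp σ fun k => ((j k).1 : ℤ) * ((j k).2 : ℤ)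

theorem ofFun_isResonant (h0 : ∀ a j, resDelta j ≠ 0 → f a j = 0)
    (h1 : ∀ (a : ℕ+) j, resDelta j ≠ (a : ℤ) → g a j = 0) : (ofFun f g M hf hg).IsResonant :=
  fun a j => ofFun_isIntegrable_of (S₀ := resSet l 0) (S := fun a => resSet l (a : ℤ))
    (fun j σ h => (resDelta_perm j σ).symm.trans h)
    (fun _ j σ h => (resDelta_perm j σ).symm.trans h)
    h0 h1 a j

/-- For a permutation-invariant index set, symmetrizing and restricting commute, so the integrable
part may be computed from the unsymmetrized coefficients. -/
theorem tsum_subtype_symF {v : ZIndex → ℂ} (hv : Summable fun j => ‖v j‖)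
    {f : (Fin l → ZIndex) → ℝ} {M : ℝ} (hf : ∀ j, |f j| ≤ M) {S : Set (Fin l → ZIndex)}
    (hS : ∀ j, ∀ σ : Equiv.Perm (Fin l), (fun k => j (σ k)) ∈ S ↔ j ∈ S) :
    ∑' j : S, (symF f j : ℂ) * ∏ k, v ((j : Fin l → ZIndex) k)
      = ∑' j : Fin l → ZIndex, ((S.indicator f j : ℝ) : ℂ) * ∏ k, v (j k) := by
  have h1 (j) : symF (S.indicator f) j = S.indicator (symF f) j := by
    by_cases hj : j ∈ S
    · simp only [symF, indicator_of_mem hj, indicator_of_mem ((hS j _).2 hj)]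
    · rw [indicator_of_notMem hj]
      exact symF_eq_zero fun σ => indicator_of_notMem (fun h => hj ((hS j σ).1 h)) _
  have h2 (j) : |S.indicator f j| ≤ M := by
    by_cases hj : j ∈ S
    · rw [indicator_of_mem hj]
      exact hf j
    · rw [indicator_of_notMem hj, abs_zero]
      exact (abs_nonneg _).trans (hf j)
  rw [← tsum_symF hv h2, tsum_subtype S fun j => (symF f j : ℂ) * ∏ k, v (j k)]
  refine tsum_congr fun j => ?_
  rw [h1]
  by_cases hj : j ∈ S
  · simp [hj]
  · simp [hj]

theorem intSetZero_perm (j : Fin l → ZIndex) (σ : Equiv.Perm (Fin l)) :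
    (fun k => j (σ k)) ∈ intSetZero l ↔ j ∈ intSetZero l := by
  have key (j : Fin l → ZIndex) (σ : Equiv.Perm (Fin l)) (h : j ∈ intSetZero l) :
      (fun k => j (σ k)) ∈ intSetZero l := by
    obtain ⟨h1, τ, hτ⟩ := h
    refine ⟨(resDelta_perm j σ).trans h1, σ.trans (τ.trans σ.symm), fun k => ?_⟩
    simpa using hτ (σ k)
  refine ⟨fun h => ?_, key j σ⟩
  simpa using key _ σ.symm h

theorem intSet_perm (a : ℕ+) (j : Fin l → ZIndex) (σ : Equiv.Perm (Fin l)) :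
    (fun k => j (σ k)) ∈ intSet l a ↔ j ∈ intSet l a := by
  -- The permutation is extended to l + 1 places so that it fixes the appended letter.
  have h1 : (Fin.snoc (fun k => j (σ k)) ((-1 : SignType), a) : Fin (l + 1) → ZIndex)
      = fun k => (Fin.snoc j ((-1 : SignType), a) : Fin (l + 1) → ZIndex)
        ((finSuccEquivLast.trans (σ.optionCongr.trans finSuccEquivLast.symm)) k) := by
    funext k
    refine Fin.lastCases ?_ (fun i => ?_) k
    · simp
    · simp
  unfold intSet resSet
  simp only [mem_ofPred_eq]
  rw [resDelta_perm, h1, intSetZero_perm]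

theorem intCompZ_ofFun {z : ℕ+ → ℂ} (hz : Summable fun j => ‖zeta z j‖) (a : ℕ+) :
    (ofFun f g M hf hg).intCompZ z a = Complex.I *
      (z a * ∑' j : Fin l → ZIndex, (((intSetZero l).indicator (f a) j : ℝ) : ℂ)
          * ∏ k, zeta z (j k)
        + conj (z a) * ∑' j : Fin l → ZIndex, (((intSet l a).indicator (g a) j : ℝ) : ℂ)
          * ∏ k, zeta z (j k)) := by
  rw [← tsum_subtype_symF hz (hf a) fun j σ => intSetZero_perm j σ,
    ← tsum_subtype_symF hz (hg a) fun j σ => intSet_perm a j σ]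
  simp only [intCompZ, ofFun, zetaProd, mul_assoc, tsum_mul_left]
  ring

end PolyField

end

noncomputable section

/-! ### The function `f` -/

open Filter Topology

/-- The function `x ↦ x √(1 + 2x)`. -/
def kirG (x : ℝ) : ℝ := x * √(1 + 2 * x)

theorem kirG_zero : kirG 0 = 0 := by simp [kirG]

/-- The function has slope at least 1 on the half-line. Hence it is injective there and its inverse
is 1-Lipschitz, which gives continuity of `kirPhi` on all of [0, ∞). -/
theorem sub_le_kirG_sub {x y : ℝ} (hx : 0 ≤ x) (hxy : x ≤ y) : y - x ≤ kirG y - kirG x := by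
  have h1 : √(1 + 2 * x) ≤ √(1 + 2 * y) := Real.sqrt_le_sqrt (by linarith)
  have h2 : 1 ≤ √(1 + 2 * y) := Real.one_le_sqrt.2 (by linarith)
  unfold kirG
  nlinarith

theorem exists_kirG_eq {y : ℝ} (hy : 0 ≤ y) : ∃ x ∈ Ici (0 : ℝ), kirG x = y := by
  have hc : ContinuousOn kirG (Icc 0 y) := by unfold kirG; fun_prop
  have h1 := sub_le_kirG_sub le_rfl hy
  rw [kirG_zero, sub_zero, sub_zero] at h1
  obtain ⟨x, hx, hxy⟩ := intermediate_value_Icc hy hc ⟨by rwa [kirG_zero], h1⟩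
  exact ⟨x, hx.1, hxy⟩

theorem kirPhi_nonneg {y : ℝ} (hy : 0 ≤ y) : 0 ≤ kirPhi y :=
  Function.invFunOn_mem (f := kirG) (exists_kirG_eq hy)

theorem kirG_kirPhi {y : ℝ} (hy : 0 ≤ y) : kirG (kirPhi y) = y :=
  Function.invFunOn_eq (f := kirG) (exists_kirG_eq hy)

theorem abs_sub_le_abs_kirG_sub {x y : ℝ} (hx : 0 ≤ x) (hy : 0 ≤ y) :
    |x - y| ≤ |kirG x - kirG y| := by
  rcases le_total x y with h | h
  · rw [abs_sub_comm, abs_sub_comm (kirG x), abs_of_nonneg (sub_nonneg.2 h)]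
    exact (sub_le_kirG_sub hx h).trans (le_abs_self _)
  · rw [abs_of_nonneg (sub_nonneg.2 h)]
    exact (sub_le_kirG_sub hy h).trans (le_abs_self _)

theorem kirPhi_kirG {x : ℝ} (hx : 0 ≤ x) (h : 0 ≤ kirG x) : kirPhi (kirG x) = x := by
  have := abs_sub_le_abs_kirG_sub (kirPhi_nonneg h) hx
  rw [kirG_kirPhi h, sub_self, abs_zero] at this
  linarith [abs_nonpos_iff.1 this]

theorem continuousOn_kirPhi : ContinuousOn kirPhi (Ici 0) := by
  have : LipschitzOnWith 1 kirPhi (Ici 0) := LipschitzOnWith.of_dist_le_mul fun x hx y hy => by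
    have := abs_sub_le_abs_kirG_sub (kirPhi_nonneg hx) (kirPhi_nonneg hy)
    rwa [kirG_kirPhi hx, kirG_kirPhi hy, ← Real.dist_eq, ← Real.dist_eq,
      ← one_mul (dist x y)] at this
  exact this.continuousOn

theorem continuousOn_kirF : ContinuousOn kirF (Ici 0) := by
  unfold kirF
  refine ContinuousOn.rpow_const (continuousOn_const.add (continuousOn_const.mul
    continuousOn_kirPhi)) fun y hy => Or.inl ?_
  have := kirPhi_nonneg hy
  positivity

theorem kirF_nonneg {y : ℝ} (hy : 0 ≤ y) : 0 ≤ kirF y := by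
  have := kirPhi_nonneg hy
  unfold kirF
  positivity

theorem kirF_le_one {y : ℝ} (hy : 0 ≤ y) : kirF y ≤ 1 :=
  Real.rpow_le_one_of_one_le_of_nonpos (by linarith [kirPhi_nonneg hy]) (by norm_num)

/-- Near zero, `f` is the restriction of an analytic function. -/
theorem exists_analyticAt_kirF : ∃ F : ℝ → ℝ, AnalyticAt ℝ F 0 ∧ (F =ᶠ[𝓝[Ici 0] 0] kirF) ∧
    F 0 = 1 ∧ deriv F 0 = -3 := by
  have hG : AnalyticAt ℝ kirG 0 := by
    have h1 : ContDiffAt ℝ ω (fun x : ℝ => √(1 + 2 * x)) 0 :=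
      ContDiffAt.sqrt (by fun_prop) (by norm_num)
    exact (contDiffAt_id.mul h1).analyticAt
  have hd : HasDerivAt kirG 1 0 := by
    have h1 : HasDerivAt (fun x : ℝ => 1 + 2 * x) 2 0 := by
      simpa using ((hasDerivAt_id (0 : ℝ)).const_mul 2).const_add 1
    have h2 := (hasDerivAt_id (0 : ℝ)).mul (h1.sqrt (by norm_num))
    refine h2.congr_deriv ?_
    simp
  have hd0 : deriv kirG 0 ≠ 0 := by rw [hd.deriv]; exact one_ne_zero
  set h := hG.hasStrictDerivAt.localInverse _ _ _ hd0 with hh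
  have ha : AnalyticAt ℝ h 0 := by
    have := hG.analyticAt_localInverse hd0
    rwa [kirG_zero] at this
  have h0 : h 0 = 0 := by
    have := (hG.hasStrictDerivAt.eventually_left_inverse hd0).self_of_nhds
    rwa [kirG_zero] at this
  have hr : ∀ᶠ y in 𝓝 (0 : ℝ), kirG (h y) = y := by
    have := hG.hasStrictDerivAt.eventually_right_inverse hd0
    rwa [kirG_zero] at this
  have hhd : HasDerivAt h 1 0 := by
    have := (hG.hasStrictDerivAt.to_localInverse hd0).hasDerivAt
    rw [kirG_zero] at this
    exact this.congr_deriv (by rw [hd.deriv, inv_one])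
  have hpos : ∀ᶠ y in 𝓝 (0 : ℝ), 0 < 1 + 2 * h y := by
    have : ContinuousAt (fun y => 1 + 2 * h y) 0 :=
      continuousAt_const.add (continuousAt_const.mul ha.continuousAt)
    refine this.eventually_const_lt ?_
    simp [h0]
  refine ⟨fun y => (1 + 2 * h y) ^ (-(3 / 2) : ℝ), ?_, ?_, ?_, ?_⟩
  · have h1 : ContDiffAt ℝ ω (fun y => 1 + 2 * h y) 0 :=
      contDiffAt_const.add (contDiffAt_const.mul ha.contDiffAt)
    exact (h1.rpow_const_of_ne (by rw [h0]; norm_num)).analyticAt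
  · filter_upwards [nhdsWithin_le_nhds hr, nhdsWithin_le_nhds hpos, self_mem_nhdsWithin]
      with y h1 h2 h3
    -- The local inverse agrees with `kirPhi` only where it is nonnegative. To the right of zero it
    -- is, because `kirG` has the sign of its argument.
    have h4 : 0 ≤ h y := by
      by_contra! hneg
      have : h y * √(1 + 2 * h y) < 0 := mul_neg_of_neg_of_pos hneg (Real.sqrt_pos.2 h2)
      rw [kirG] at h1
      rw [mem_Ici] at h3
      linarith
    have h5 : kirPhi y = h y := by
      have := kirPhi_kirG h4 (by rw [h1]; exact h3)
      rwa [h1] at this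
    rw [kirF, h5]
  · simp [h0]
  · have h1 : HasDerivAt (fun y => 1 + 2 * h y) 2 0 := by
      simpa using (hhd.const_mul 2).const_add 1
    rw [(h1.rpow_const (p := -(3 / 2)) (Or.inl (by rw [h0]; norm_num))).deriv, h0]
    norm_num

/-- The Taylor coefficients of `f`. -/
def kirT (k : ℕ) : ℝ := iteratedDerivWithin k kirF (Ici 0) 0 / k.factorial

theorem kirT_eq {F : ℝ → ℝ} (hF : AnalyticAt ℝ F 0) (he : F =ᶠ[𝓝[Ici 0] 0] kirF) (k : ℕ) :
    kirT k = iteratedDeriv k F 0 / k.factorial := by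
  rw [kirT, ← he.iteratedDerivWithin_eq (he.self_of_nhdsWithin self_mem_Ici),
    iteratedDerivWithin_eq_iteratedDeriv (uniqueDiffOn_Ici 0) hF.contDiffAt self_mem_Ici]

theorem kirT_zero : kirT 0 = 1 := by
  obtain ⟨F, hF, he, h0, -⟩ := exists_analyticAt_kirF
  simp [kirT_eq hF he, h0]

theorem kirT_one : kirT 1 = -3 := by
  obtain ⟨F, hF, he, -, h1⟩ := exists_analyticAt_kirF
  simp [kirT_eq hF he, h1]

/-- Analyticity at zero controls only small y, while the remainder bound is wanted for every y ≥ 0.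
For My < 1 the Taylor estimate applies; for My ≥ 1 the right-hand side is so large that |f| ≤ 1 and
the crude bound of the partial sum, with r ≤ 2^r, suffice. -/
theorem exists_kirT_bound : ∃ L : ℝ, 1 ≤ L ∧ (∀ k, |kirT k| ≤ L ^ (k + 1)) ∧
    ∀ r : ℕ, 1 ≤ r → ∀ y : ℝ, 0 ≤ y →
      |kirF y - ∑ k ∈ Finset.range r, kirT k * y ^ k| ≤ L ^ r * y ^ r := by
  obtain ⟨F, hF, he, -, -⟩ := exists_analyticAt_kirF
  have hp := hF.hasFPowerSeriesAt
  have hc : (fun n : ℕ => iteratedDeriv n F 0 / n.factorial) = kirT :=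
    funext fun k => (kirT_eq hF he k).symm
  rw [hc] at hp
  obtain ⟨C₁, ρ, hC₁, hρ, hb⟩ := FormalMultilinearSeries.le_mul_pow_of_radius_pos _ hp.radius_pos
  obtain ⟨R, hR⟩ := hp
  obtain ⟨r', hr0, hrR⟩ := ENNReal.lt_iff_exists_nnreal_btwn.1 hR.r_pos
  obtain ⟨α, hα, C₂, hC₂, happ⟩ := hR.uniform_geometric_approx' hrR
  have hr0' : (0 : ℝ) < r' := by simpa using hr0
  obtain ⟨δ, hδ, hball⟩ := Metric.mem_nhdsWithin_iff.1 he
  have hb' (k : ℕ) : |kirT k| ≤ C₁ * ρ ^ k := by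
    have := hb k
    rwa [FormalMultilinearSeries.ofScalars_norm] at this
  -- a common constant
  set M : ℝ := 1 + C₁ + C₂ + ρ + (r' : ℝ)⁻¹ + δ⁻¹ with hM
  have hri : 0 < (r' : ℝ)⁻¹ := by positivity
  have hdi : 0 < δ⁻¹ := by positivity
  have hM1 : 1 ≤ M := by linarith
  have hT (k : ℕ) : |kirT k| ≤ M * M ^ k := (hb' k).trans (by
    gcongr <;> linarith)
  have hML : M ≤ (1 + M) * (2 * M) := by nlinarith
  refine ⟨(1 + M) * (2 * M), by linarith, fun k => (hT k).trans ?_, fun r hr y hy => ?_⟩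
  · rw [← pow_succ']
    exact pow_le_pow_left₀ (by linarith) hML _
  · have key : |kirF y - ∑ k ∈ Finset.range r, kirT k * y ^ k| ≤ (1 + M) * (2 * M * y) ^ r := by
      rcases lt_or_ge (M * y) 1 with h | h
      · have hyr : y < r' := by
          have : (r' : ℝ)⁻¹ * y < 1 := lt_of_le_of_lt (by gcongr; linarith) h
          rwa [inv_mul_lt_iff₀ hr0', mul_one] at this
        have hyδ : y < δ := by
          have : δ⁻¹ * y < 1 := lt_of_le_of_lt (by gcongr; linarith) h
          rwa [inv_mul_lt_iff₀ hδ, mul_one] at this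
        have h1 := happ y (by simpa [abs_of_nonneg hy] using hyr) r
        have h2 : F y = kirF y := hball ⟨by simpa [abs_of_nonneg hy] using hyδ, hy⟩
        rw [zero_add, h2, FormalMultilinearSeries.partialSum, Real.norm_eq_abs] at h1
        simp only [FormalMultilinearSeries.ofScalars_apply_eq, smul_eq_mul, Real.norm_eq_abs,
          abs_of_nonneg hy] at h1
        refine h1.trans ?_
        have h3 : α * (y / r') ≤ 2 * M * y := by
          have h4 : y / r' ≤ M * y := by
            rw [div_eq_inv_mul]
            gcongr
            linarith
          have h5 : 0 ≤ y / r' := by positivity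
          nlinarith [hα.1, hα.2]
        have h6 : 0 ≤ α * (y / r') := mul_nonneg hα.1.le (by positivity)
        gcongr
        linarith
      · have h0 : 0 ≤ M * y := by linarith
        have hsum : |∑ k ∈ Finset.range r, kirT k * y ^ k| ≤ r * (M * (M * y) ^ r) := by
          refine (Finset.abs_sum_le_sum_abs _ _).trans ?_
          rw [← nsmul_eq_mul, ← Finset.card_range r, ← Finset.sum_const, Finset.card_range]
          refine Finset.sum_le_sum fun k hk => ?_
          rw [abs_mul, abs_of_nonneg (pow_nonneg hy k)]
          calc |kirT k| * y ^ k ≤ M * M ^ k * y ^ k := by gcongr; exact hT k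
            _ = M * (M * y) ^ k := by rw [mul_pow, mul_assoc]
            _ ≤ M * (M * y) ^ r := by
              gcongr
              exact (Finset.mem_range.1 hk).le
        have hr2 : (r : ℝ) ≤ 2 ^ r := by exact_mod_cast r.lt_two_pow_self.le
        have h7 : 1 ≤ (2 * M * y) ^ r := one_le_pow₀ (by linarith)
        have h8 : (r : ℝ) * (M * (M * y) ^ r) ≤ M * (2 * M * y) ^ r := by
          have : (2 * M * y) ^ r = 2 ^ r * (M * y) ^ r := by rw [← mul_pow]; ring
          rw [this]
          have : 0 ≤ M * (M * y) ^ r := by positivity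
          nlinarith
        have h9 : |kirF y| ≤ 1 := by
          rw [abs_of_nonneg (kirF_nonneg hy)]
          exact kirF_le_one hy
        refine (abs_sub _ _).trans ?_
        nlinarith
    refine key.trans ?_
    rw [← mul_pow, mul_assoc (1 + M), mul_pow (1 + M)]
    -- The assumption r ≥ 1 lets the prefactor disappear into the r-th power.
    have : 1 + M ≤ (1 + M) ^ r := le_self_pow₀ (by linarith) (by omega)
    gcongr

end

noncomputable section

open Ser Polynomial

/-! ### The Kirchhoff field in terms of series -/

theorem zeta_one (z : ℕ+ → ℂ) (b : ℕ+) : zeta z (1, b) = z b * z b := sq _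

theorem zeta_neg_one (z : ℕ+ → ℂ) (b : ℕ+) : zeta z (-1, b) = conj (z b) * conj (z b) := sq _

theorem zeta_zero (z : ℕ+ → ℂ) (b : ℕ+) : zeta z (0, b) = z b * conj (z b) := by
  rw [Complex.mul_conj, Complex.normSq_eq_norm_sq]
  rfl

theorem summable_zeta {s : ℝ} (hs : 0 ≤ s) (z : Ell2 s) :
    (Summable fun j => ‖zeta z j‖) ∧ ∑' j, ‖zeta z j‖ ≤ 3 * ‖z‖ ^ 2 := by
  have := summable_zetaBil hs z z
  simp only [zetaBil_self] at this
  rwa [sq]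

/-- `∑ (z_b² + z̄_b² + 2I_b) / b`. -/
def kirW (z : ℕ+ → ℂ) : ℂ :=
  ∑' b : ℕ+, (z b ^ 2 + conj (z b) ^ 2 + 2 * ((‖z b‖ ^ 2 : ℝ) : ℂ)) / (b : ℂ)

theorem kirW_eq_tsum_sq (z : ℕ+ → ℂ) : kirW z = ∑' b : ℕ+, (z b + conj (z b)) ^ 2 / (b : ℂ) := by
  refine tsum_congr fun b => ?_
  have : ((‖z b‖ ^ 2 : ℝ) : ℂ) = z b * conj (z b) := zeta_zero z b
  rw [this]
  ring

/-- Since z_b + z̄_b is real, its square is its modulus squared. Thus powers of y are polynomials in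
z and z̄, at the price of the powers of 4 in `kirC`. -/
theorem kirW_eq (z : ℕ+ → ℂ) : kirW z = ((4 * kirY z : ℝ) : ℂ) := by
  have h (b : ℕ+) : (z b + conj (z b)) ^ 2 / (b : ℂ)
      = ((‖z b + conj (z b)‖ ^ 2 / (b : ℝ) : ℝ) : ℂ) := by
    rw [Complex.add_conj, Complex.norm_real, Real.norm_eq_abs, sq_abs]
    push_cast
    rfl
  rw [kirW_eq_tsum_sq, tsum_congr h, ← Complex.ofReal_tsum, kirY]
  congr 1
  ring

theorem kirY_nonneg (z : ℕ+ → ℂ) : 0 ≤ kirY z :=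
  mul_nonneg (by norm_num) (tsum_nonneg fun b => by positivity)

/-- The coefficients of the polynomial fields `P_{2l+1}`, divided by `-i`. -/
def kirC (l : ℕ) : ℝ := kirT (l - 1) / 4 ^ l

theorem kirC_one : kirC 1 = 1 / 4 := by rw [kirC, kirT_zero, pow_one]

theorem kirC_two : kirC 2 = -(3 / 16) := by rw [kirC, kirT_one]; norm_num

theorem kirP_eq (l : ℕ) (z : ℕ+ → ℂ) (a : ℕ+) :
    kirP l z a = -(Complex.I * (kirC l * (kirW z ^ (l - 1) * kirS z))) * conj (z a) := by
  unfold kirP kirC kirT kirW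
  push_cast
  have : ((l - 1).factorial : ℂ) ≠ 0 := Nat.cast_ne_zero.2 (Nat.factorial_ne_zero _)
  field_simp

/-- The scalar factor of the remainder of the Kirchhoff field. -/
def kirRS (r : ℕ) (z : ℕ+ → ℂ) : ℂ :=
  -(Complex.I / 4 * ((kirF (kirY z) - ∑ k ∈ Finset.range r, kirT k * kirY z ^ k : ℝ) : ℂ) * kirS z)

/-- The remainder is a scalar times z̄, so its norm in every ℓ²_s follows from a bound on one
number. -/
theorem kirR_eq (r : ℕ) (z : ℕ+ → ℂ) (a : ℕ+) : kirR r z a = kirRS r z * conj (z a) := by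
  have h : ∑ l ∈ Finset.Icc 1 r, kirP l z a = -(Complex.I / 4 *
      ((∑ k ∈ Finset.range r, kirT k * kirY z ^ k : ℝ) : ℂ) * kirS z) * conj (z a) := by
    rw [← Finset.Ico_add_one_right_eq_Icc, Finset.sum_Ico_eq_sum_range, Nat.add_sub_cancel]
    push_cast
    rw [Finset.mul_sum, Finset.sum_mul, ← Finset.sum_neg_distrib, Finset.sum_mul]
    refine Finset.sum_congr rfl fun k _ => ?_
    rw [kirP_eq, kirW_eq, kirC, Nat.add_sub_cancel_left]
    push_cast
    rw [mul_pow, pow_add]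
    field_simp
  rw [kirR, h, kirField, kirRS]
  push_cast
  ring

/-- The remainder is what the polynomial fields leave of the Kirchhoff field. -/
theorem kirField_eq (r : ℕ) (z : ℕ+ → ℂ) (a : ℕ+) :
    kirField z a = linField z a
      - Complex.I * ((∑ l ∈ Finset.Icc 1 r, kirC l * (kirW z ^ (l - 1) * kirS z)) * conj (z a))
      + kirRS r z * conj (z a) := by
  rw [← kirR_eq, kirR, Finset.sum_congr rfl fun l _ => kirP_eq l z a, Finset.sum_mul,
    Finset.mul_sum]
  simp only [neg_mul, Finset.sum_neg_distrib, mul_assoc]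
  ring

section bounds

variable {s : ℝ}

theorem summable_sq (hs : 0 ≤ s) (z : Ell2 s) :
    (Summable fun a => ‖z a‖ ^ 2) ∧ ∑' a, ‖z a‖ ^ 2 ≤ ‖z‖ ^ 2 := by
  simpa only [sq] using Ell2.summable_mul hs z z

theorem norm_kirS_le (hs : 0 ≤ s) (z : Ell2 s) : ‖kirS z‖ ≤ 2 * ‖z‖ ^ 2 := by
  obtain ⟨h1, h2⟩ := summable_sq hs z
  refine (tsum_of_norm_bounded (h1.mul_left 2).hasSum fun b => ?_).trans ?_
  · refine (norm_sub_le _ _).trans (le_of_eq ?_)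
    simp
    ring
  · rw [tsum_mul_left]
    linarith

theorem kirY_le (hs : 0 ≤ s) (z : Ell2 s) : kirY z ≤ ‖z‖ ^ 2 := by
  obtain ⟨h1, h2⟩ := summable_sq hs z
  have h (b : ℕ+) : ‖z b + conj (z b)‖ ^ 2 / (b : ℝ) ≤ 4 * ‖z b‖ ^ 2 := by
    have hb : (1 : ℝ) ≤ b := by exact_mod_cast Nat.succ_le_of_lt b.pos
    have h3 : ‖z b + conj (z b)‖ ≤ 2 * ‖z b‖ := (norm_add_le _ _).trans (by simp; linarith)
    refine (div_le_self (by positivity) hb).trans ?_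
    calc ‖z b + conj (z b)‖ ^ 2 ≤ (2 * ‖z b‖) ^ 2 := by gcongr
      _ = _ := by ring
  have h4 := (Summable.of_nonneg_of_le (fun b => by positivity) h (h1.mul_left 4)).tsum_le_tsum h
    (h1.mul_left 4)
  rw [tsum_mul_left] at h4
  rw [kirY]
  linarith

end bounds

section evaluation

variable {s : ℝ} {A B : ℕ+ → Ser} {p : ℝ[X]} {w : ℕ+ → ℂ}

theorem exists_maj_yHead (hA : ∀ a, Maj (A a) p) (hB : ∀ a, Maj (B a) p) :
    ∃ q, ∀ j, Maj (yHead A B j) q := by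
  have hG (b : ℕ+) : Maj (serG A B b) (1 + p + p) := (Maj.one.add (hA b)).add (hB b).bar
  have hn (l : ℕ) : 0 ≤ ((1 + p + p) * (1 + p + p)).coeff l := ((hG 1).conv (hG 1)).coeff_nonneg l
  refine ⟨C 2 * ((1 + p + p) * (1 + p + p)), ?_⟩
  have key (b : ℕ+) {c d : Ser} (hc : Maj c (1 + p + p)) (hd : Maj d (1 + p + p)) {x : ℝ}
      (hx : |x| ≤ 2) : Maj (x • conv c d) (C 2 * ((1 + p + p) * (1 + p + p))) :=
    ((hc.conv hd).smul x).mono fun l => by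
      rw [coeff_C_mul, coeff_C_mul]
      exact mul_le_mul_of_nonneg_right hx (hn l)
  have hb (b : ℕ+) : |(b : ℝ)⁻¹| ≤ 1 := by
    rw [abs_of_nonneg (by positivity)]
    exact inv_le_one_of_one_le₀ (by exact_mod_cast Nat.succ_le_of_lt b.pos)
  rintro ⟨δ, b⟩
  cases δ
  · refine key b (hG b) (hG b).bar ?_
    rw [abs_mul, abs_two]
    linarith [hb b]
  · exact key b (hG b).bar (hG b).bar ((hb b).trans one_le_two)
  · exact key b (hG b) (hG b) ((hb b).trans one_le_two)

theorem exists_maj_sHead (hA : ∀ a, Maj (A a) p) (hB : ∀ a, Maj (B a) p) :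
    ∃ q, ∀ j, Maj (sHead A B j) q := by
  have hG (b : ℕ+) : Maj (serG A B b) (1 + p + p) := (Maj.one.add (hA b)).add (hB b).bar
  have hH (b : ℕ+) : Maj (serH A B b) (1 + p + p) := (Maj.one.add (hA b)).sub (hB b).bar
  have hn (l : ℕ) : 0 ≤ ((1 + p + p) * (1 + p + p)).coeff l := ((hG 1).conv (hG 1)).coeff_nonneg l
  refine ⟨(1 + p + p) * (1 + p + p) + (1 + p + p) * (1 + p + p), ?_⟩
  rintro ⟨δ, b⟩
  cases δ
  · exact ((hH b).conv (hG b).bar).sub ((hH b).bar.conv (hG b))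
  · exact ((hH b).bar.conv (hG b).bar).neg.mono fun l => by
      rw [coeff_add]
      linarith [hn l]
  · exact ((hH b).conv (hG b)).mono fun l => by
      rw [coeff_add]
      linarith [hn l]

theorem add_conj_eq (hs : 0 ≤ s) (z : Ell2 s) (hA : ∀ a, Maj (A a) p)
    (hB : ∀ a, Maj (B a) p)
    (hw : ∀ b, w b = z b * (1 + E (A b) (zeta z)) + conj (z b) * E (B b) (zeta z))
    (b : ℕ+) : w b + conj (w b) = z b * E (serG A B b) (zeta z)
    + conj (z b) * conj (E (serG A B b) (zeta z)) := by
  have hv := (summable_zeta hs z).1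
  rw [serG, E_add hv (Bd.one.add ⟨_, hA b⟩) (Bd.bar ⟨_, hB b⟩), E_add hv Bd.one ⟨_, hA b⟩, E_one hv,
    E_bar hv (zeta_bar z) ⟨_, hB b⟩, hw]
  simp only [map_add, map_mul, map_one, Complex.conj_conj]
  ring

theorem sub_conj_eq (hs : 0 ≤ s) (z : Ell2 s) (hA : ∀ a, Maj (A a) p)
    (hB : ∀ a, Maj (B a) p)
    (hw : ∀ b, w b = z b * (1 + E (A b) (zeta z)) + conj (z b) * E (B b) (zeta z))
    (b : ℕ+) : w b - conj (w b) = z b * E (serH A B b) (zeta z)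
    - conj (z b) * conj (E (serH A B b) (zeta z)) := by
  have hv := (summable_zeta hs z).1
  rw [serH, E_sub hv (Bd.one.add ⟨_, hA b⟩) (Bd.bar ⟨_, hB b⟩), E_add hv Bd.one ⟨_, hA b⟩, E_one hv,
    E_bar hv (zeta_bar z) ⟨_, hB b⟩, hw]
  simp only [map_add, map_sub, map_mul, map_one, Complex.conj_conj]
  ring

theorem kirW_eq_E (hs : 0 ≤ s) (z : Ell2 s) (hA : ∀ a, Maj (A a) p)
    (hB : ∀ a, Maj (B a) p)
    (hw : ∀ b, w b = z b * (1 + E (A b) (zeta z)) + conj (z b) * E (B b) (zeta z))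
    : kirW w = E (lin (yHead A B)) (zeta z) := by
  have hv := (summable_zeta hs z).1
  have hvb := zeta_bar z
  have hG (b : ℕ+) : Bd (serG A B b) := (Bd.one.add ⟨_, hA b⟩).add (Bd.bar ⟨_, hB b⟩)
  obtain ⟨q, hq⟩ := exists_maj_yHead hA hB
  rw [E_lin hv hq, ZIndex.tsum_eq (summable_mul_E hv hv hq), kirW_eq_tsum_sq]
  refine tsum_congr fun b => ?_
  have e1 : E (yHead A B (1, b)) (zeta z) = (b : ℂ)⁻¹ * E (serG A B b) (zeta z) ^ 2 := by
    change E ((b : ℝ)⁻¹ • conv (serG A B b) (serG A B b)) (zeta z) = _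
    rw [E_smul, E_conv hv (hG b) (hG b)]
    push_cast
    ring
  have e2 : E (yHead A B (-1, b)) (zeta z) = (b : ℂ)⁻¹ * conj (E (serG A B b) (zeta z)) ^ 2 := by
    change E ((b : ℝ)⁻¹ • conv (Ser.bar (serG A B b)) (Ser.bar (serG A B b))) (zeta z) = _
    rw [E_smul, E_conv hv (hG b).bar (hG b).bar, E_bar hv hvb (hG b)]
    push_cast
    ring
  have e3 : E (yHead A B (0, b)) (zeta z)
      = 2 * (b : ℂ)⁻¹ * (E (serG A B b) (zeta z) * conj (E (serG A B b) (zeta z))) := by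
    change E ((2 * (b : ℝ)⁻¹) • conv (serG A B b) (Ser.bar (serG A B b))) (zeta z) = _
    rw [E_smul, E_conv hv (hG b) (hG b).bar, E_bar hv hvb (hG b)]
    push_cast
    ring
  rw [e1, e2, e3, zeta_one, zeta_neg_one, zeta_zero, add_conj_eq hs z hA hB hw]
  ring

theorem kirS_eq_E (hs : 0 ≤ s) (z : Ell2 s) (hA : ∀ a, Maj (A a) p)
    (hB : ∀ a, Maj (B a) p)
    (hw : ∀ b, w b = z b * (1 + E (A b) (zeta z)) + conj (z b) * E (B b) (zeta z))
    : kirS w = E (lin (sHead A B)) (zeta z) := by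
  have hv := (summable_zeta hs z).1
  have hvb := zeta_bar z
  have hG (b : ℕ+) : Bd (serG A B b) := (Bd.one.add ⟨_, hA b⟩).add (Bd.bar ⟨_, hB b⟩)
  have hH (b : ℕ+) : Bd (serH A B b) := (Bd.one.add ⟨_, hA b⟩).sub (Bd.bar ⟨_, hB b⟩)
  obtain ⟨q, hq⟩ := exists_maj_sHead hA hB
  rw [E_lin hv hq, ZIndex.tsum_eq (summable_mul_E hv hv hq)]
  refine tsum_congr fun b => ?_
  have e1 : E (sHead A B (1, b)) (zeta z) = E (serH A B b) (zeta z) * E (serG A B b) (zeta z) :=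
    E_conv hv (hH b) (hG b)
  have e2 : E (sHead A B (-1, b)) (zeta z)
      = -(conj (E (serH A B b) (zeta z)) * conj (E (serG A B b) (zeta z))) := by
    change E (-conv (Ser.bar (serH A B b)) (Ser.bar (serG A B b))) (zeta z) = _
    rw [E_neg, E_conv hv (hH b).bar (hG b).bar, E_bar hv hvb (hG b), E_bar hv hvb (hH b)]
  have e3 : E (sHead A B (0, b)) (zeta z)
      = E (serH A B b) (zeta z) * conj (E (serG A B b) (zeta z))
        - conj (E (serH A B b) (zeta z)) * E (serG A B b) (zeta z) := by
    change E (conv (serH A B b) (Ser.bar (serG A B b))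
      - conv (Ser.bar (serH A B b)) (serG A B b)) (zeta z) = _
    rw [E_sub hv ((hH b).conv (hG b).bar) ((hH b).bar.conv (hG b)), E_conv hv (hH b) (hG b).bar,
      E_conv hv (hH b).bar (hG b), E_bar hv hvb (hG b), E_bar hv hvb (hH b)]
  have e4 : w b ^ 2 - conj (w b) ^ 2 = (w b - conj (w b)) * (w b + conj (w b)) := by ring
  rw [e1, e2, e3, zeta_one, zeta_neg_one, zeta_zero, e4, add_conj_eq hs z hA hB hw,
    sub_conj_eq hs z hA hB hw]
  ring

theorem bd_term (hA : ∀ a, Maj (A a) p) (hB : ∀ a, Maj (B a) p) (m : ℕ) :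
    Bd (conv (powS (lin (yHead A B)) m) (lin (sHead A B))) := by
  obtain ⟨q, hq⟩ := exists_maj_yHead hA hB
  obtain ⟨q', hq'⟩ := exists_maj_sHead hA hB
  exact Bd.conv (Bd.powS ⟨_, Maj.lin hq⟩ m) ⟨_, Maj.lin hq'⟩

/-- The sums over b become sums over the three letters with that b, because the squares of z G ± z̄
Ḡ produce exactly z², z̄² and I. The nonlinearity along id + F is thus again a series in ζ(z). -/
theorem kirW_pow_mul_kirS (hs : 0 ≤ s) (z : Ell2 s) (hA : ∀ a, Maj (A a) p)
    (hB : ∀ a, Maj (B a) p)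
    (hw : ∀ b, w b = z b * (1 + E (A b) (zeta z)) + conj (z b) * E (B b) (zeta z))
    (m : ℕ) : kirW w ^ m * kirS w
    = E (conv (powS (lin (yHead A B)) m) (lin (sHead A B))) (zeta z) := by
  have hv := (summable_zeta hs z).1
  obtain ⟨q, hq⟩ := exists_maj_yHead hA hB
  obtain ⟨q', hq'⟩ := exists_maj_sHead hA hB
  rw [E_conv hv (Bd.powS ⟨_, Maj.lin hq⟩ m) ⟨_, Maj.lin hq'⟩, E_powS hv ⟨_, Maj.lin hq⟩,
    kirW_eq_E hs z hA hB hw, kirS_eq_E hs z hA hB hw]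

theorem sum_kirW_eq_E (hs : 0 ≤ s) (z : Ell2 s) (hA : ∀ a, Maj (A a) p)
    (hB : ∀ a, Maj (B a) p)
    (hw : ∀ b, w b = z b * (1 + E (A b) (zeta z)) + conj (z b) * E (B b) (zeta z))
    (r : ℕ) (cf : ℕ → ℝ) :
    ∑ l ∈ Finset.Icc 1 r, (cf l : ℂ) * (kirW w ^ (l - 1) * kirS w)
      = E (pSer r cf A B) (zeta z) := by
  rw [pSer, E_sum (summable_zeta hs z).1 _ fun m _ => (bd_term hA hB (m - 1)).smul _]
  refine Finset.sum_congr rfl fun m _ => ?_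
  rw [E_smul, kirW_pow_mul_kirS hs z hA hB hw]

end evaluation

end

noncomputable section

open Ser Polynomial

/-! ### The structure constants of the Kirchhoff field -/

/-- The coefficients of the monomials of `∑ (z_b² + z̄_b² + 2I_b) / b` to the power `m`, times
`∑ (z_b² - z̄_b²)`. -/
def kirSer (m : ℕ) : Ser := conv (powS (lin (yHead 0 0)) m) (lin (sHead 0 0))

theorem zero_conv (d : Ser) : conv 0 d = 0 := by
  funext w
  induction w with
  | nil => exact zero_mul _
  | cons j w ih =>
    rw [conv_cons, show tl (0 : Ser) j = 0 from rfl, ih]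
    simp

theorem one_conv (d : Ser) : conv one d = d := by
  funext w
  cases w with
  | nil => simp [conv_nil, one]
  | cons j w =>
    rw [conv_cons, show tl one j = 0 from funext fun w => by simp [tl_apply, one], zero_conv]
    simp [one]

theorem serG_zero (b : ℕ+) : serG 0 0 b = one := by
  funext w
  simp [serG, Ser.bar]

theorem serH_zero (b : ℕ+) : serH 0 0 b = one := by
  funext w
  simp [serH, Ser.bar]

theorem bar_one : Ser.bar one = one := by
  funext w
  simp [Ser.bar, one]

/-- The majorant is a single monomial. It therefore encodes the homogeneity of degree m + 1 as well
as the bound 2^m, in which each 2 comes from the term 2I_b/b. -/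
theorem maj_kirSer (m : ℕ) : Maj (kirSer m) ((X * C 2) ^ m * (X * 1)) := by
  have h1 (x : ℝ) (hx : |x| ≤ 2) : Maj (x • one) (C 2) := (Maj.one.smul x).mono fun l => by
    rw [mul_one, coeff_C, coeff_C]
    split_ifs <;> simp [hx]
  refine Maj.conv (Maj.powS (Maj.lin ?_) m) (Maj.lin ?_)
  · have hb (b : ℕ+) : |(b : ℝ)⁻¹| ≤ 1 := by
      rw [abs_of_nonneg (by positivity)]
      exact inv_le_one_of_one_le₀ (by exact_mod_cast Nat.succ_le_of_lt b.pos)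
    rintro ⟨δ, b⟩
    cases δ
    · change Maj ((2 * (b : ℝ)⁻¹) • conv (serG 0 0 b) (Ser.bar (serG 0 0 b))) _
      rw [serG_zero, bar_one, one_conv]
      refine h1 _ ?_
      rw [abs_mul, abs_two]
      linarith [hb b]
    · change Maj ((b : ℝ)⁻¹ • conv (Ser.bar (serG 0 0 b)) (Ser.bar (serG 0 0 b))) _
      rw [serG_zero, bar_one, one_conv]
      exact h1 _ ((hb b).trans one_le_two)
    · change Maj ((b : ℝ)⁻¹ • conv (serG 0 0 b) (serG 0 0 b)) _
      rw [serG_zero, one_conv]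
      exact h1 _ ((hb b).trans one_le_two)
  · rintro ⟨δ, b⟩
    cases δ
    · change Maj (conv (serH 0 0 b) (Ser.bar (serG 0 0 b))
        - conv (Ser.bar (serH 0 0 b)) (serG 0 0 b)) _
      rw [serG_zero, serH_zero, bar_one, sub_self]
      exact Maj.zero.mono fun l => by
        rw [coeff_zero, coeff_one]
        positivity
    · change Maj (-conv (Ser.bar (serH 0 0 b)) (Ser.bar (serG 0 0 b))) _
      rw [serG_zero, serH_zero, bar_one, one_conv]
      exact Maj.one.neg
    · change Maj (conv (serH 0 0 b) (serG 0 0 b)) _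
      rw [serG_zero, serH_zero, one_conv]
      exact Maj.one

theorem coeff_maj_kirSer (m l : ℕ) :
    ((X * C 2) ^ m * (X * 1) : ℝ[X]).coeff l = if l = m + 1 then 2 ^ m else 0 := by
  have : ((X * C 2) ^ m * (X * 1) : ℝ[X]) = C (2 ^ m) * X ^ (m + 1) := by
    rw [mul_pow, ← C_pow]
    ring
  rw [this, coeff_C_mul, coeff_X_pow]
  simp

theorem abs_kirSer_le (m : ℕ) (w : List ZIndex) : |kirSer m w| ≤ 2 ^ m := by
  refine (maj_kirSer m w).trans ?_
  rw [coeff_maj_kirSer]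
  split_ifs
  · exact le_rfl
  · positivity

theorem kirW_pow_mul_kirS_eq_tsum {s : ℝ} (hs : 0 ≤ s) (z : Ell2 s) (m : ℕ) :
    kirW z ^ m * kirS z
      = ∑' j : Fin (m + 1) → ZIndex, (kirSer m (List.ofFn j) : ℂ) * ∏ k, zeta z (j k) := by
  have hv := (summable_zeta hs z).1
  have h0 : ∀ b : ℕ+, z b = z b * (1 + E ((0 : ℕ+ → Ser) b) (zeta z))
      + conj (z b) * E ((0 : ℕ+ → Ser) b) (zeta z) := fun b => by
    simp [E_zero]
  have hz : ∀ a, Maj ((0 : ℕ+ → Ser) a) 0 := fun _ => Maj.zero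
  rw [kirW_pow_mul_kirS hs z hz hz h0, ← ev_eq_tsum hv (maj_kirSer m) (m + 1), E]
  refine tsum_eq_single (m + 1) fun l hl => ?_
  change ev l (kirSer m) (zeta z) = 0
  rw [ev_eq_tsum hv (maj_kirSer m) l]
  refine (tsum_congr fun j => ?_).trans tsum_zero
  have := maj_kirSer m (List.ofFn j)
  rw [List.length_ofFn, coeff_maj_kirSer, if_neg hl] at this
  rw [abs_nonpos_iff.1 this, Complex.ofReal_zero, zero_mul]

/-- The field `P_{2l+1}`. -/
def kirPoly (m : ℕ) : PolyField (m + 1) :=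
  PolyField.ofFun (fun _ _ => 0) (fun _ j => -(kirC (m + 1) * kirSer m (List.ofFn j)))
    (|kirC (m + 1)| * 2 ^ m) (fun _ _ => by simp) fun _ j => by
      rw [abs_neg, abs_mul]
      exact mul_le_mul_of_nonneg_left (abs_kirSer_le m _) (abs_nonneg _)

theorem compZ_kirPoly {s : ℝ} (hs : 0 ≤ s) (z : Ell2 s) (m : ℕ) (a : ℕ+) :
    (kirPoly m).compZ z a = kirP (m + 1) z a := by
  have e : ∑' j : Fin (m + 1) → ZIndex,
      ((-(kirC (m + 1) * kirSer m (List.ofFn j)) : ℝ) : ℂ) * ∏ k, zeta z (j k)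
      = -((kirC (m + 1) : ℂ) * (kirW z ^ m * kirS z)) := by
    rw [kirW_pow_mul_kirS_eq_tsum hs z, ← tsum_mul_left, ← tsum_neg]
    refine tsum_congr fun j => ?_
    push_cast
    ring
  rw [kirPoly, PolyField.compZ_ofFun (summable_zeta hs z).1, kirP_eq, Nat.add_sub_cancel, e]
  simp only [Complex.ofReal_zero, zero_mul, tsum_zero, mul_zero, zero_add]
  ring

theorem norm_kirRS_le {s : ℝ} (hs : 0 ≤ s) (z : Ell2 s) {r : ℕ} {L : ℝ} (hL : 0 ≤ L)
    (hR : ∀ y : ℝ, 0 ≤ y → |kirF y - ∑ k ∈ Finset.range r, kirT k * y ^ k| ≤ L ^ r * y ^ r) :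
    ‖kirRS r z‖ ≤ 1 / 2 * (L ^ r * ‖z‖ ^ (2 * r + 2)) := by
  have h1 : ‖(Complex.I / 4 : ℂ)‖ = 1 / 4 := by simp
  rw [kirRS, norm_neg, norm_mul, norm_mul, Complex.norm_real, Real.norm_eq_abs, h1]
  have h2 : kirY z ^ r ≤ (‖z‖ ^ 2) ^ r := pow_le_pow_left₀ (kirY_nonneg z) (kirY_le hs z) r
  have h3 := (hR _ (kirY_nonneg z)).trans (mul_le_mul_of_nonneg_left h2 (pow_nonneg hL r))
  calc _ ≤ 1 / 4 * (L ^ r * (‖z‖ ^ 2) ^ r) * (2 * ‖z‖ ^ 2) := by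
        gcongr
        exact norm_kirS_le hs z
    _ = _ := by ring

theorem exists_isStructureConstant : ∃ C₀ : ℝ, ∀ r : ℕ, 2 ≤ r → IsStructureConstant r C₀ := by
  obtain ⟨L, hL, hb, hR⟩ := exists_kirT_bound
  refine ⟨L, fun r hr => ⟨by linarith, fun l hl hlr => ?_, fun s hs z => ?_⟩⟩
  · obtain ⟨m, rfl⟩ := Nat.exists_eq_add_of_le' hl
    refine ⟨kirPoly m, PolyField.ofFun_isReversible, fun z a => compZ_kirPoly le_rfl z m a,
      PolyField.coeffNorm_ofFun_le.trans ?_⟩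
    rw [kirC, Nat.add_sub_cancel, abs_div, abs_of_pos (by positivity : (0 : ℝ) < 4 ^ (m + 1)),
      div_mul_eq_mul_div, div_le_iff₀ (by positivity)]
    have h2 : (2 : ℝ) ^ m ≤ 4 ^ (m + 1) := by
      calc (2 : ℝ) ^ m ≤ 4 ^ m := by gcongr; norm_num
        _ ≤ 4 ^ (m + 1) := pow_le_pow_right₀ (by norm_num) (by omega)
    exact mul_le_mul (hb m) h2 (by positivity) (by positivity)
  · have hRS : ‖kirRS r z‖ ≤ 1 / 2 * (L ^ r * ‖z‖ ^ (2 * r + 2)) :=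
      norm_kirRS_le hs z (by linarith) (hR r (by omega))
    have h1 (a : ℕ+) : ‖kirR r z a‖ ≤ 1 / 2 * (L ^ r * ‖z‖ ^ (2 * r + 2)) * ‖z a‖ := by
      rw [kirR_eq, norm_mul, RCLike.norm_conj]
      exact mul_le_mul_of_nonneg_right hRS (norm_nonneg _)
    refine ⟨z.isSobolev.of_le h1, ?_⟩
    have h2 := sobNorm_le_of_le z.isSobolev (by positivity) h1
    -- The factor 1/2 in `norm_kirRS_le` pays for the √2 by which `phaseNorm` exceeds `sobNorm`.
    have h3 : √2 ≤ 2 := by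
      rw [Real.sqrt_le_left (by norm_num)]
      norm_num
    rw [phaseNorm_eq]
    rw [← Ell2.norm_eq] at h2 ⊢
    calc √2 * sobNorm s (kirR r z) ≤ 2 * (1 / 2 * (L ^ r * ‖z‖ ^ (2 * r + 2)) * ‖z‖) :=
          mul_le_mul h3 h2 (sobNorm_nonneg _ _) (by norm_num)
      _ = _ := by ring

/-! ### Bounds for polynomial fields, and the Taylor coefficients under an admissible constant -/

theorem hasSum_prod_fin {v : ZIndex → ℂ} (hv : Summable fun j => ‖v j‖) (l : ℕ) :
    HasSum (fun j : Fin l → ZIndex => ∏ k, ‖v (j k)‖) ((∑' j, ‖v j‖) ^ l) := by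
  refine (summable_prod_fin hv l).hasSum_iff.2 ?_
  induction l with
  | zero => simp
  | succ l ih =>
    have h2 := summable_prod_fin hv l
    have h3 : Summable fun x : ZIndex × (Fin l → ZIndex) => ‖v x.1‖ * ∏ k, ‖v (x.2 k)‖ :=
      Summable.mul_of_nonneg (f := fun j => ‖v j‖) (g := fun j : Fin l → ZIndex => ∏ k, ‖v (j k)‖)
        hv h2 (fun _ => norm_nonneg _) fun _ =>
        Finset.prod_nonneg fun _ _ => norm_nonneg _
    rw [← (Fin.consEquiv fun _ : Fin (l + 1) => ZIndex).tsum_eq, pow_succ', ← ih,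
      Summable.tsum_mul_tsum (f := fun j => ‖v j‖) (g := fun j : Fin l → ZIndex => ∏ k, ‖v (j k)‖)
        hv h2 h3]
    simp [Fin.prod_univ_succ, Fin.consEquiv]

/-- Each of the two coefficient sums is at most the coefficient norm times the l-th power of ∑
‖ζ_j‖; together they give the 2. -/
theorem PolyField.norm_compZ_le {l : ℕ} (P : PolyField l) {z : ℕ+ → ℂ}
    (hz : Summable fun j => ‖zeta z j‖) (a : ℕ+) :
    ‖P.compZ z a‖ ≤ 2 * P.coeffNorm * (∑' j, ‖zeta z j‖) ^ l * ‖z a‖ := by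
  have key (c : (Fin l → ZIndex) → ℂ) (hc : ∀ j, ‖c j‖ ≤ P.coeffNorm) :
      ‖∑' j, c j * zetaProd z j‖ ≤ P.coeffNorm * (∑' j, ‖zeta z j‖) ^ l :=
    tsum_of_norm_bounded ((hasSum_prod_fin hz l).mul_left P.coeffNorm) fun j => by
      rw [norm_mul, zetaProd, norm_prod]
      exact mul_le_mul_of_nonneg_right (hc j) (Finset.prod_nonneg fun _ _ => norm_nonneg _)
  have h1 := key (P.zz a) fun j => (le_max_left _ _).trans (le_ciSup P.bddAbove (a, j))
  have h2 := key (P.zb a) fun j => (le_max_right _ _).trans (le_ciSup P.bddAbove (a, j))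
  rw [compZ]
  refine (norm_add_le _ _).trans ?_
  rw [norm_mul, norm_mul, RCLike.norm_conj]
  nlinarith [norm_nonneg (z a)]

/-- The structure constant controls the coefficients of the polynomial fields. -/
theorem IsStructureConstant.coeffBound {r : ℕ} {C₀ c : ℝ} (h : IsStructureConstant r C₀)
    (hc : C₀ ≤ c) : CoeffBound c r kirC := by
  -- The first two coefficients are explicit, since f(0) = 1 and f'(0) = -3; only from the third on
  -- is the hypothesis used.
  refine ⟨by rw [kirC_one]; norm_num [abs_of_pos], by rw [kirC_two]; norm_num [abs_of_pos],
    fun m hm hmr => ?_⟩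
  obtain ⟨P, -, hP, hPC⟩ := h.2.1 m (by omega) hmr
  -- Neither the real nor the imaginary part of the entry vanishes, so `kirW` (= 4) and `kirS` (=
  -- 4i) are both nonzero and the size of the field at u reveals |c_m|. Index 1 avoids the damping
  -- by 1/b.
  set u : ℕ+ → ℂ := Pi.single 1 (1 + Complex.I) with hu
  have hu1 : u 1 = 1 + Complex.I := Pi.single_eq_same _ _
  have hu0 (b : ℕ+) (hb : b ≠ 1) : u b = 0 := Pi.single_eq_of_ne hb _
  have hn : ‖(1 + Complex.I : ℂ)‖ ^ 2 = 2 := by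
    rw [← Complex.normSq_eq_norm_sq]
    norm_num [Complex.normSq]
  have hsum : HasSum (fun a : ℕ+ => (a : ℝ) ^ (2 * (0 : ℝ)) * ‖u a‖ ^ 2) 2 := by
    have h1 := hasSum_single (f := fun a : ℕ+ => (a : ℝ) ^ (2 * (0 : ℝ)) * ‖u a‖ ^ 2) 1
      fun b hb => by simp [hu0 b hb]
    simpa [hu1, hn] using h1
  obtain ⟨h1, h2⟩ := summable_zeta le_rfl (Ell2.of u hsum.summable)
  have h3 : ‖Ell2.of u hsum.summable‖ ^ 2 = 2 := by
    rw [Ell2.norm_eq, sobNorm]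
    change √(∑' a : ℕ+, (a : ℝ) ^ (2 * (0 : ℝ)) * ‖u a‖ ^ 2) ^ 2 = 2
    rw [hsum.tsum_eq, Real.sq_sqrt (by norm_num)]
  rw [h3] at h2
  have hW : kirW u = 4 := by
    rw [kirW_eq_tsum_sq, tsum_eq_single 1 fun b hb => by simp [hu0 b hb], hu1]
    simp
    ring
  have hS : kirS u = 4 * Complex.I := by
    rw [kirS, tsum_eq_single 1 fun b hb => by simp [hu0 b hb], hu1]
    simp
    ring
  have h4 := P.norm_compZ_le h1 1
  have h5 : P.compZ (Ell2.of u hsum.summable) 1 = kirP m u 1 := hP _ 1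
  have h6 : ‖(Ell2.of u hsum.summable) 1‖ = ‖(1 + Complex.I : ℂ)‖ := congrArg norm hu1
  rw [h5, h6, kirP_eq, hW, hS, hu1, norm_mul, norm_neg, norm_mul, norm_mul, norm_mul, norm_mul,
    RCLike.norm_conj, norm_pow] at h4
  have h7 : 0 < ‖(1 + Complex.I : ℂ)‖ := by
    by_contra! h
    have : ‖(1 + Complex.I : ℂ)‖ = 0 := le_antisymm h (norm_nonneg _)
    rw [this] at hn
    norm_num at hn
  have h8 := le_of_mul_le_mul_right h4 h7
  simp only [Complex.norm_I, Complex.norm_real, Real.norm_eq_abs, RCLike.norm_ofNat, one_mul,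
    mul_one] at h8
  have h9 : (4 : ℝ) ^ (m - 1) * 4 = 4 ^ m := by
    rw [← pow_succ]
    congr 1
    omega
  rw [h9] at h8
  -- Here 6 is 3‖u‖². Dividing by the 4^m on the left leaves (6/4)^m, the 3/2 of `CoeffBound`.
  have h10 : 2 * P.coeffNorm * (∑' j, ‖zeta (Ell2.of u hsum.summable) j‖) ^ m
      ≤ 2 * c ^ m * 6 ^ m := by
    have h12 : 0 ≤ ∑' j, ‖zeta (Ell2.of u hsum.summable) j‖ := tsum_nonneg fun _ => norm_nonneg _
    have h11 : P.coeffNorm ≤ c ^ m := hPC.trans (pow_le_pow_left₀ h.1.le hc m)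
    have : 0 ≤ c := h.1.le.trans hc
    gcongr
    linarith
  have h13 := h8.trans h10
  rw [mul_assoc, ← mul_pow, show c * 6 = 4 * (3 / 2 * c) by ring, mul_pow] at h13
  have h14 : (0 : ℝ) < 4 ^ m := by positivity
  refine le_of_mul_le_mul_right ?_ h14
  linarith

end

noncomputable section

/-! ### Small perturbations of the identity -/

section perturbation

variable {V : Type*} [NormedAddCommGroup V] [NormedSpace ℝ V] [CompleteSpace V] {F : V → V} {ρ : ℝ}

theorem isUnit_id_add {T : V →L[ℝ] V} (hT : ‖T‖ ≤ 1 / 4) : IsUnit (1 + T) := by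
  rw [← sub_neg_eq_add]
  refine isUnit_one_sub_of_norm_lt_one ?_
  rw [norm_neg]
  linarith

-- A map within Lipschitz distance 1/4 of the identity is injective and expands balls by at least 1
-- - 1/4, which gives the radius 3ρ/4 in the image. The inverse is smooth because 1 + DF is
-- invertible at each point.
open Metric in
theorem exists_openPartialHomeomorph (hF : ContDiff ℝ ∞ F) (hF0 : F 0 = 0)
    (hd : ∀ z ∈ ball (0 : V) ρ, ‖fderiv ℝ F z‖ ≤ 1 / 4) :
    ∃ φ : OpenPartialHomeomorph V V, (∀ z, φ z = z + F z) ∧ φ.source = ball 0 ρ ∧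
      ball 0 (3 / 4 * ρ) ⊆ φ.target ∧ ContDiffOn ℝ ∞ φ φ.source ∧
      ContDiffOn ℝ ∞ φ.symm φ.target := by
  have hFd : Differentiable ℝ F := hF.differentiable (by simp)
  have hder (z : V) : HasFDerivAt (fun z => z + F z) (1 + fderiv ℝ F z) z :=
    (hasFDerivAt_id z).add (hFd z).hasFDerivAt
  have happ : ApproximatesLinearOn (fun z => z + F z)
      ((ContinuousLinearEquiv.refl ℝ V : V ≃L[ℝ] V) : V →L[ℝ] V) (ball 0 ρ) (1 / 4) := by
    intro x hx y hy
    have := (convex_ball (0 : V) ρ).norm_image_sub_le_of_norm_fderiv_le (fun z _ => hFd z) hd hy hx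
    have e : x + F x - (y + F y) - (x - y) = F x - F y := by abel
    change ‖x + F x - (y + F y) - (x - y)‖ ≤ _
    rw [e]
    simpa using this
  -- The identity has norm one only on a nontrivial space, so the trivial space is treated apart.
  rcases subsingleton_or_nontrivial V with hV | hV
  · refine ⟨happ.toOpenPartialHomeomorph _ _ (Or.inl hV) isOpen_ball, fun z => rfl, rfl,
      fun w hw => ⟨w, ?_, Subsingleton.elim _ _⟩, ?_, ?_⟩
    · rw [mem_ball_zero_iff] at hw ⊢
      have := norm_nonneg w
      linarith
    · exact (contDiff_of_subsingleton).contDiffOn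
    · exact (contDiff_of_subsingleton).contDiffOn
  have hN : ‖((ContinuousLinearEquiv.refl ℝ V).symm : V →L[ℝ] V)‖₊ = 1 :=
    NNReal.eq ContinuousLinearMap.norm_id
  have hc : Subsingleton V ∨
      (1 / 4 : NNReal) < ‖((ContinuousLinearEquiv.refl ℝ V).symm : V →L[ℝ] V)‖₊⁻¹ := by
    refine Or.inr ?_
    rw [hN, inv_one, ← NNReal.coe_lt_coe]
    norm_num
  have hφ (z : V) : happ.toOpenPartialHomeomorph _ _ hc isOpen_ball z = z + F z := rfl
  refine ⟨happ.toOpenPartialHomeomorph _ _ hc isOpen_ball, hφ, rfl, fun w hw => ?_, ?_, ?_⟩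
  · rw [mem_ball_zero_iff] at hw
    -- The preimage of w is looked for in the ball of radius ‖w‖/(1 - 1/4) about the origin.
    refine happ.closedBall_subset_target hc isOpen_ball (b := 0) (ε := 4 / 3 * ‖w‖) (by positivity)
      (fun z hz => ?_) ?_
    · rw [mem_closedBall_zero_iff] at hz
      rw [mem_ball_zero_iff]
      linarith
    · rw [hN, hF0, add_zero, mem_closedBall_zero_iff]
      simp
      linarith
  · exact (contDiff_id.add hF).contDiffOn
  · intro w hw
    refine ContDiffAt.contDiffWithinAt ?_
    have hz : (happ.toOpenPartialHomeomorph _ _ hc isOpen_ball).symm w ∈ ball (0 : V) ρ :=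
      OpenPartialHomeomorph.map_target _ hw
    obtain ⟨u, hu⟩ := isUnit_id_add (hd _ hz)
    refine OpenPartialHomeomorph.contDiffAt_symm _
      (f₀' := ContinuousLinearEquiv.unitsEquiv ℝ V u) hw
      ?_ (contDiff_id.add hF).contDiffAt
    have h := hder ((happ.toOpenPartialHomeomorph _ _ hc isOpen_ball).symm w)
    rw [← hu] at h
    exact h

-- R is (1 + DF)^{-1} U. Inversion is continuous at units, and ‖R‖ - ‖DF R‖ ≤ ‖U‖ yields the factor
-- 4/3.
open Metric in
theorem exists_pullback (hF : ContDiff ℝ ∞ F)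
    (hd : ∀ z ∈ ball (0 : V) ρ, ‖fderiv ℝ F z‖ ≤ 1 / 4) {U : V → V}
    (hU : ContinuousOn U (ball 0 ρ)) :
    ∃ R : V → V, ContinuousOn R (ball 0 ρ) ∧
      ∀ z ∈ ball (0 : V) ρ, R z + fderiv ℝ F z (R z) = U z ∧ ‖R z‖ ≤ 4 / 3 * ‖U z‖ := by
  refine ⟨fun z => Ring.inverse (1 + fderiv ℝ F z) (U z), fun z hz => ?_, fun z hz => ?_⟩
  · refine ContinuousWithinAt.clm_apply ?_ (hU z hz)
    obtain ⟨u, hu⟩ := isUnit_id_add (hd z hz)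
    have h1 : ContinuousAt Ring.inverse (1 + fderiv ℝ F z) := by
      rw [← hu]
      exact NormedRing.inverse_continuousAt u
    have h2 : ContinuousAt (fun z => 1 + fderiv ℝ F z) z :=
      continuousAt_const.add (hF.continuous_fderiv (by simp)).continuousAt
    exact (ContinuousAt.comp (f := fun z => 1 + fderiv ℝ F z) h1 h2).continuousWithinAt
  · have h1 := Ring.mul_inverse_cancel _ (isUnit_id_add (hd z hz))
    have h2 := congrArg (fun T : V →L[ℝ] V => T (U z)) h1
    set y := Ring.inverse (1 + fderiv ℝ F z) (U z)
    have h3 : y + fderiv ℝ F z y = U z := h2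
    refine ⟨h3, ?_⟩
    have h4 : ‖fderiv ℝ F z y‖ ≤ 1 / 4 * ‖y‖ :=
      (ContinuousLinearMap.le_opNorm _ _).trans
        (mul_le_mul_of_nonneg_right (hd z hz) (norm_nonneg _))
    have h5 : ‖y‖ - ‖fderiv ℝ F z y‖ ≤ ‖U z‖ := by
      rw [← h3]
      simpa using norm_sub_norm_le y (-fderiv ℝ F z y)
    linarith

end perturbation

/-! ### Estimates for polynomial maps -/

namespace Ell2

variable {s : ℝ}

theorem norm_toLp (z : Ell2 s) : ‖toLp s z‖ = ‖z‖ := rfl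

theorem toLp_surjective (s : ℝ) : Function.Surjective (toLp s) := by
  intro u
  have hpos (a : ℕ+) : (((a : ℝ) ^ s : ℝ) : ℂ) ≠ 0 := by
    have : (0 : ℝ) < (a : ℝ) := by exact_mod_cast a.pos
    exact_mod_cast (Real.rpow_pos_of_pos this s).ne'
  have h (a : ℕ+) : (((a : ℝ) ^ s : ℝ) : ℂ) * ((((a : ℝ) ^ s : ℝ) : ℂ)⁻¹ * u a) = u a :=
    mul_inv_cancel_left₀ (hpos a) _
  have hu : IsSobolev s fun a => (((a : ℝ) ^ s : ℝ) : ℂ)⁻¹ * u a := by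
    rw [isSobolev_iff]
    simp only [h]
    exact lp.memℓp u
  exact ⟨of _ hu, lp.ext (funext h)⟩

instance (s : ℝ) : CompleteSpace (Ell2 s) := by
  let e : Ell2 s ≃ₗᵢ[ℂ] lp (fun _ : ℕ+ => ℂ) 2 :=
    ⟨LinearEquiv.ofBijective (toLp s) ⟨toLp_injective s, toLp_surjective s⟩, norm_toLp⟩
  exact (e.isometry.isUniformInducing.completeSpace_congr e.surjective).2 inferInstance

/-- The pointwise bound is turned into a comparison with the sequence M|x| + N|z| of moduli, to
which the triangle inequality of ℓ²_s applies. -/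
theorem norm_le_of_le_add (u x z : Ell2 s) {M N : ℝ} (hM : 0 ≤ M) (hN : 0 ≤ N)
    (h : ∀ a, ‖u a‖ ≤ M * ‖x a‖ + N * ‖z a‖) : ‖u‖ ≤ M * ‖x‖ + N * ‖z‖ := by
  have habs (x : Ell2 s) : ∃ x' : Ell2 s, (∀ a, x' a = (‖x a‖ : ℂ)) ∧ ‖x'‖ ≤ ‖x‖ := by
    refine ⟨of (fun a => (‖x a‖ : ℂ)) (x.isSobolev.of_le (M := 1) fun a => by simp),
      fun a => rfl, ?_⟩
    simpa using norm_le_of_le (of (fun a => (‖x a‖ : ℂ)) _) x zero_le_one fun a => by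
      simp [of_apply]
  obtain ⟨x', hx', hx⟩ := habs x
  obtain ⟨z', hz', hz⟩ := habs z
  have h1 := norm_le_of_le u (M • x' + N • z') zero_le_one fun a => by
    rw [one_mul, add_apply, real_smul_apply, real_smul_apply, hx', hz', ← Complex.ofReal_mul,
      ← Complex.ofReal_mul, ← Complex.ofReal_add, Complex.norm_real]
    exact (h a).trans (le_abs_self _)
  rw [one_mul] at h1
  refine h1.trans ((norm_add_le _ _).trans ?_)
  rw [norm_smul, norm_smul, Real.norm_of_nonneg hM, Real.norm_of_nonneg hN]
  gcongr

end Ell2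

open Ser Polynomial

theorem Polynomial.eval_le_eval_of_coeff_nonneg {p : ℝ[X]} (hp : ∀ l, 0 ≤ p.coeff l) {x y : ℝ}
    (hx : 0 ≤ x) (hxy : x ≤ y) : p.eval x ≤ p.eval y := by
  rw [eval_eq_sum_range, eval_eq_sum_range]
  exact Finset.sum_le_sum fun l _ =>
    mul_le_mul_of_nonneg_left (pow_le_pow_left₀ hx hxy l) (hp l)

section polynomialMaps

variable {s : ℝ} (hs : 0 ≤ s) {A B : ℕ+ → Ser} {p : ℝ[X]} (hA : ∀ a, Maj (A a) p)
  (hB : ∀ a, Maj (B a) p)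

theorem norm_E_zeta_le (hs : 0 ≤ s) {c : Ser} (hc : Maj c p) (z : Ell2 s) :
    ‖E c (zeta z)‖ ≤ p.eval (3 * ‖z‖ ^ 2) :=
  (norm_E_le (summable_zeta hs z).1 hc).trans (eval_le_eval_of_coeff_nonneg hc.coeff_nonneg
    (tsum_nonneg fun _ => norm_nonneg _) (summable_zeta hs z).2)

theorem norm_polyMap_apply_le {x : ℝ} (z : Ell2 s) (hxA : ∀ a, ‖E (A a) (zeta z)‖ ≤ x)
    (hxB : ∀ a, ‖E (B a) (zeta z)‖ ≤ x) (a : ℕ+) :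
    ‖polyMap hs hA hB z a‖ ≤ 2 * x * ‖z a‖ := by
  rw [polyMap_apply]
  refine (norm_add_le _ _).trans ?_
  rw [norm_mul, norm_mul, RCLike.norm_conj]
  nlinarith [norm_nonneg (z a), hxA a, hxB a]

theorem norm_polyMap_le {x : ℝ} (z : Ell2 s) (hxA : ∀ a, ‖E (A a) (zeta z)‖ ≤ x)
    (hxB : ∀ a, ‖E (B a) (zeta z)‖ ≤ x) : ‖polyMap hs hA hB z‖ ≤ 2 * x * ‖z‖ :=
  Ell2.norm_le_of_le _ _ (by linarith [(norm_nonneg _).trans (hxA 1)])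
    (norm_polyMap_apply_le hs hA hB z hxA hxB)

/-- The derivative either falls on the factor z or z̄, or on the coefficient. In the latter case the
direction is twice the bilinear form, of size 2 · 3‖z‖‖x‖; with the two families this makes 12. -/
theorem norm_fderiv_polyMap_le (z : Ell2 s) : ‖fderiv ℝ (polyMap hs hA hB) z‖
    ≤ 2 * p.eval (3 * ‖z‖ ^ 2) + 12 * ‖z‖ ^ 2 * (derivative p).eval (3 * ‖z‖ ^ 2) := by
  have hp := (hA 1).coeff_nonneg
  have hp' (l : ℕ) : 0 ≤ (derivative p).coeff l := by
    rw [coeff_derivative]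
    exact mul_nonneg (hp _) (by positivity)
  have h0 : 0 ≤ p.eval (3 * ‖z‖ ^ 2) := (norm_nonneg _).trans (norm_E_zeta_le hs (hA 1) z)
  have hd0 : 0 ≤ (derivative p).eval (3 * ‖z‖ ^ 2) := by
    rw [eval_eq_sum_range]
    exact Finset.sum_nonneg fun l _ => mul_nonneg (hp' l) (by positivity)
  refine ContinuousLinearMap.opNorm_le_bound _ (by positivity) fun x => ?_
  obtain ⟨hv, hvz⟩ := summable_zeta hs z
  obtain ⟨h1, h2⟩ := summable_zetaBil hs z x
  have hu : HasSum (fun j => ‖2 * zetaBil z x j‖) (2 * ∑' j, ‖zetaBil z x j‖) := by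
    simpa using h1.hasSum.mul_left 2
  have hdE (c : Ser) (hc : Maj c p) : ‖dE c (zeta z) fun j => 2 * zetaBil z x j‖
      ≤ (derivative p).eval (3 * ‖z‖ ^ 2) * (6 * (‖z‖ * ‖x‖)) := by
    refine (norm_dE_le hv hu.summable hc).trans ?_
    rw [hu.tsum_eq]
    refine mul_le_mul (eval_le_eval_of_coeff_nonneg hp' (tsum_nonneg fun _ => norm_nonneg _) hvz)
      (by linarith) (by positivity) hd0
  have h3 := Ell2.norm_le_of_le_add (fderiv ℝ (polyMap hs hA hB) z x) x z
    (M := 2 * p.eval (3 * ‖z‖ ^ 2))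
    (N := 2 * ((derivative p).eval (3 * ‖z‖ ^ 2) * (6 * (‖z‖ * ‖x‖)))) (by positivity)
    (by positivity) fun a => by
      rw [fderiv_polyMap_apply]
      refine (norm_add₄_le).trans ?_
      simp only [norm_mul, RCLike.norm_conj]
      have e1 := mul_le_mul_of_nonneg_right (norm_E_zeta_le hs (hA a) z) (norm_nonneg (x a))
      have e2 := mul_le_mul_of_nonneg_right (norm_E_zeta_le hs (hB a) z) (norm_nonneg (x a))
      have e3 := mul_le_mul_of_nonneg_right (hdE _ (hA a)) (norm_nonneg (z a))
      have e4 := mul_le_mul_of_nonneg_right (hdE _ (hB a)) (norm_nonneg (z a))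
      linarith
  refine h3.trans (le_of_eq ?_)
  ring

/-- One series is treated as a constant family, so that the smoothness of `pol` can be used. -/
theorem continuous_E_zeta (hs : 0 ≤ s) {c : Ser} (hc : Maj c p) :
    Continuous fun z : Ell2 s => E c (zeta z) := by
  have h1 := (BddCoeff.contDiff_pol hs (BddCoeff.ofSer (fun _ => c) fun _ => hc) p.natDegree
    (n := 0)).continuous
  have h2 : Continuous fun z : Ell2 s => (BddCoeff.pol hs
      (BddCoeff.ofSer (fun _ => c) fun _ => hc) p.natDegree z) (1, []) :=
    (lp.evalCLM ℂ (fun _ : ℕ+ × List ZIndex => ℂ) ⊤ (1, [])).continuous.comp h1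
  simpa only [BddCoeff.pol_apply] using h2

/-- Taking A = B = 0 writes the sums over b as series in ζ(z), and these are continuous; f itself is
continuous on all of [0, ∞). -/
theorem continuous_kirRS (hs : 0 ≤ s) (r : ℕ) : Continuous fun z : Ell2 s => kirRS r z := by
  have hz : ∀ a, Maj ((0 : ℕ+ → Ser) a) 0 := fun _ => Maj.zero
  have h0 (z : Ell2 s) (b : ℕ+) : z b = z b * (1 + E ((0 : ℕ+ → Ser) b) (zeta z))
      + conj (z b) * E ((0 : ℕ+ → Ser) b) (zeta z) := by simp [E_zero]
  obtain ⟨q, hq⟩ := exists_maj_yHead hz hz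
  obtain ⟨q', hq'⟩ := exists_maj_sHead hz hz
  have hS : Continuous fun z : Ell2 s => kirS z := by
    simpa only [← kirS_eq_E hs _ hz hz (h0 _)] using continuous_E_zeta hs (Maj.lin hq')
  have hW : Continuous fun z : Ell2 s => kirW z := by
    simpa only [← kirW_eq_E hs _ hz hz (h0 _)] using continuous_E_zeta hs (Maj.lin hq)
  have hY : Continuous fun z : Ell2 s => kirY z := by
    have h1 : Continuous fun z : Ell2 s => (kirW z).re / 4 := by fun_prop
    refine h1.congr fun z => ?_
    rw [kirW_eq, Complex.ofReal_re]
    ring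
  have hF : Continuous fun z : Ell2 s => kirF (kirY z) :=
    continuousOn_kirF.comp_continuous hY fun z => kirY_nonneg z
  unfold kirRS
  fun_prop

end polynomialMaps

end

noncomputable section

open Ser Polynomial

/-! ### The transformed field -/

namespace Ser

/-- The series with coefficients multiplied by `Δ`. -/
def wtS (c : Ser) : Ser := fun w => wt w * c w

/-- The part of degree more than `r` of a series. -/
def tailS (r : ℕ) (c : Ser) : Ser := fun w => if w.length ≤ r then 0 else c w

theorem Maj.tailS {c : Ser} {p : ℝ[X]} (hc : Maj c p) (r : ℕ) : Maj (tailS r c) p := fun w => by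
  unfold Ser.tailS
  split_ifs
  · rw [abs_zero]
    exact hc.coeff_nonneg _
  · exact hc w

theorem tailS_eq_zero (r : ℕ) (c : Ser) (w : List ZIndex) (hw : w.length ≤ r) : tailS r c w = 0 :=
  if_pos hw

/-- The homological equation as an identity between full series: up to degree n it is `nf_spec`, and
above n the unknowns vanish while the tail cancels the right-hand side. It also shows that Δ·A_a has
bounded coefficients, although Δ does not. -/
theorem wtS_nf_A (r : ℕ) (cf : ℕ → ℝ) (n : ℕ) (a : ℕ+) : wtS ((nf r cf n).A a) = (1 / 2 : ℝ) •
    ((nf r cf n).kA a + tailS n ((nf r cf n).rA r cf a) - (nf r cf n).rA r cf a) := by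
  funext w
  simp only [wtS, Pi.smul_apply, Pi.add_apply, Pi.sub_apply, smul_eq_mul, tailS]
  split_ifs with h
  · obtain ⟨h1, -, h2, -⟩ := nf_spec (r := r) (cf := cf) a h
    rw [h1, h2]
    linear_combination (-1 / 2) * resA_sub ((nf r cf n).rA r cf a) w
  · obtain ⟨h1, -, h2, -⟩ := nf_eq_zero (r := r) (cf := cf) n a w (Or.inr (by omega))
    rw [h1, h2]
    ring

/-- As for `wtS_nf_A`. The term with the factor a is bounded only for each fixed a, which suffices
because it cancels against Z_1 in the component a. -/
theorem wtS_nf_B (r : ℕ) (cf : ℕ → ℝ) (n : ℕ) (a : ℕ+) : wtS ((nf r cf n).B a) =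
    (a : ℝ) • (nf r cf n).B a + (1 / 2 : ℝ) •
    ((nf r cf n).kB a + tailS n ((nf r cf n).rB r cf a) - (nf r cf n).rB r cf a) := by
  funext w
  simp only [wtS, Pi.smul_apply, Pi.add_apply, Pi.sub_apply, smul_eq_mul, tailS]
  split_ifs with h
  · obtain ⟨-, h1, -, h2⟩ := nf_spec (r := r) (cf := cf) a h
    have h3 := resB_add a ((nf r cf n).rB r cf a) w
    rw [h1, h2]
    push_cast at h3
    linear_combination (-1 / 2) * h3
  · obtain ⟨-, h1, -, h2⟩ := nf_eq_zero (r := r) (cf := cf) n a w (Or.inr (by omega))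
    rw [h1, h2]
    ring

end Ser

theorem isSobolev_linField {s : ℝ} {z : ℕ+ → ℂ} (hz : IsSobolev (s + 1) z) :
    IsSobolev s (linField z) := by
  refine Summable.congr hz fun a => ?_
  have ha : (0 : ℝ) < a := by exact_mod_cast a.pos
  have h1 : ‖(a : ℂ)‖ = (a : ℝ) := by simp
  rw [linField, norm_mul, norm_mul, norm_neg, Complex.norm_I, one_mul, h1, mul_add,
    Real.rpow_add ha, mul_one, Real.rpow_two]
  ring

section identity

variable {s : ℝ} (hs : 0 ≤ s) {A B kA kB : ℕ+ → Ser} {p k : ℝ[X]} (hA : ∀ a, Maj (A a) p)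
  (hB : ∀ a, Maj (B a) p) (hkA : ∀ a, Maj (kA a) k) (hkB : ∀ a, Maj (kB a) k)

/-- The derivative of the transformation along the linear field. -/
theorem fderiv_polyMap_lin (z x : Ell2 s) (hx : ∀ a, x a = linField z a)
    (hwA : ∀ a, Bd (wtS (A a))) (hwB : ∀ a, Bd (wtS (B a))) (a : ℕ+) :
    fderiv ℝ (polyMap hs hA hB) z x a = -Complex.I * a * z a * E (A a) (zeta z)
      + Complex.I * a * conj (z a) * E (B a) (zeta z)
      - 2 * Complex.I * (z a * E (wtS (A a)) (zeta z) + conj (z a) * E (wtS (B a)) (zeta z)) := by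
  obtain ⟨hv, -⟩ := summable_zeta hs z
  have hu : Summable fun j => ‖2 * zetaBil z x j‖ := by
    simpa using (summable_zetaBil hs z x).1.mul_left 2
  have hvu (j : ZIndex) : 2 * zetaBil z x j
      = -2 * Complex.I * ((j.1 : ℤ) * (j.2 : ℤ) : ℤ) * zeta z j := by
    obtain ⟨δ, b⟩ := j
    have hxb : x b = -Complex.I * b * z b := hx b
    cases δ
    · change 2 * ((z b * conj (x b) + conj (z b) * x b) / 2) = _ * (((0 : ℤ) * (b : ℤ) : ℤ) : ℂ) * _
      rw [hxb]
      simp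
      ring
    · change 2 * (conj (z b) * conj (x b)) = _ * (((-1 : ℤ) * (b : ℤ) : ℤ) : ℂ) * (conj (z b) ^ 2)
      rw [hxb]
      simp
      ring
    · change 2 * (z b * x b) = _ * (((1 : ℤ) * (b : ℤ) : ℤ) : ℂ) * (z b ^ 2)
      rw [hxb]
      simp
      ring
  have hd (c : Ser) (hc : Bd c) (hw : Bd (wtS c)) :
      dE c (zeta z) (fun j => 2 * zetaBil z x j) = -2 * Complex.I * E (wtS c) (zeta z) :=
    dE_diag hv hu hvu wt wt_cons wt_nil hc hw
  have hxa : x a = -Complex.I * a * z a := hx a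
  rw [fderiv_polyMap_apply, hd _ ⟨_, hA a⟩ (hwA a), hd _ ⟨_, hB a⟩ (hwB a), hxa]
  simp only [map_mul, map_neg, Complex.conj_I, Complex.conj_natCast]
  ring

/-- The derivative of the transformation along a field with coefficients `iκ`. -/
theorem fderiv_polyMap_field (hkA : ∀ a, Maj (kA a) k) (hkB : ∀ a, Maj (kB a) k) (z x : Ell2 s)
    (hx : ∀ a, x a = Complex.I * (E (kA a) (zeta z) * z a + E (kB a) (zeta z) * conj (z a)))
    (a : ℕ+) :
    fderiv ℝ (polyMap hs hA hB) z x a = Complex.I *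
      (z a * E (dSerA A B kA kB a) (zeta z) + conj (z a) * E (dSerB A B kA kB a) (zeta z)) := by
  obtain ⟨hv, -⟩ := summable_zeta hs z
  have hvb := zeta_bar z
  have hu : Summable fun j => ‖2 * zetaBil z x j‖ := by
    simpa using (summable_zetaBil hs z x).1.mul_left 2
  have hxc (b : ℕ+) : conj (x b) = -Complex.I * (conj (E (kA b) (zeta z)) * conj (z b)
      + conj (E (kB b) (zeta z)) * z b) := by
    rw [hx]
    simp
  have hd (c : Ser) (hc : Bd c) : dE c (zeta z) (fun j => 2 * zetaBil z x j)
      = Complex.I * E (derS kA kB c) (zeta z) := by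
    refine dE_eq_E_derS hkA hkB hv hu hvb (fun b => ?_) (fun b => ?_) (fun b => ?_) hc
    · change 2 * (z b * x b) = _
      rw [hx, zeta_one, zeta_zero]
      ring
    · change 2 * (conj (z b) * conj (x b)) = _
      rw [hxc, zeta_neg_one, zeta_zero]
      ring
    · change 2 * ((z b * conj (x b) + conj (z b) * x b) / 2) = _
      rw [hxc, hx, zeta_one, zeta_neg_one, zeta_zero]
      ring
  have bA (b : ℕ+) : Bd (A b) := ⟨_, hA b⟩
  have bB (b : ℕ+) : Bd (B b) := ⟨_, hB b⟩
  have bkA (b : ℕ+) : Bd (kA b) := ⟨_, hkA b⟩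
  have bkB (b : ℕ+) : Bd (kB b) := ⟨_, hkB b⟩
  rw [fderiv_polyMap_apply, hd _ (bA a), hd _ (bB a), hxc, hx, dSerA, dSerB,
    E_add hv (((bkA a).conv (bA a)).sub ((bkB a).bar.conv (bB a))) ⟨_, Maj.derS hkA hkB (hA a)⟩,
    E_add hv (((bkB a).conv (bA a)).sub ((bkA a).bar.conv (bB a))) ⟨_, Maj.derS hkA hkB (hB a)⟩,
    E_sub hv ((bkA a).conv (bA a)) ((bkB a).bar.conv (bB a)),
    E_sub hv ((bkB a).conv (bA a)) ((bkA a).bar.conv (bB a)), E_conv hv (bkA a) (bA a),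
    E_conv hv (bkB a).bar (bB a), E_conv hv (bkB a) (bA a), E_conv hv (bkA a).bar (bB a),
    E_bar hv hvb (bkA a), E_bar hv hvb (bkB a)]
  ring

/-- The conjugacy identity in each component. DF along Z_1 brings in Δ·A and Δ·B, DF along iκ brings
in `dSerA` and `dSerB`, and the Kirchhoff field along id + F brings in `pSer`; the homological
equation cancels everything except the tails and the Taylor remainder, which is U. -/
theorem transformed_field (hkA : ∀ a, Maj (kA a) k) (hkB : ∀ a, Maj (kB a) k) {r : ℕ} {q : ℝ[X]}
    (hrA : ∀ a, Maj (rhoA r kirC A B kA kB a) q) (hrB : ∀ a, Maj (rhoB r kirC A B kA kB a) q)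
    (hwA : ∀ a, wtS (A a) = (1 / 2 : ℝ) •
      (kA a + tailS r (rhoA r kirC A B kA kB a) - rhoA r kirC A B kA kB a))
    (hwB : ∀ a, wtS (B a) = (a : ℝ) • B a + (1 / 2 : ℝ) •
      (kB a + tailS r (rhoB r kirC A B kA kB a) - rhoB r kirC A B kA kB a))
    (z w : Ell2 s) (hz : IsSobolev (s + 1) z) (hw : w = z + polyMap hs hA hB z)
    (R U : Ell2 s)
    (hR : R + fderiv ℝ (polyMap hs hA hB) z R = U)
    (hU : ∀ a, U a = Complex.I * (E (tailS r (rhoA r kirC A B kA kB a)) (zeta z) * z a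
        + E (tailS r (rhoB r kirC A B kA kB a)) (zeta z) * conj (z a))
      + kirRS r w * conj (w a)) :
    ∃ v : Ell2 s, (∀ a, v a = linField z a
      + Complex.I * (E (kA a) (zeta z) * z a + E (kB a) (zeta z) * conj (z a)) + R a) ∧
      ∀ a, (v + fderiv ℝ (polyMap hs hA hB) z v) a = kirField w a := by
  obtain ⟨hv, -⟩ := summable_zeta hs z
  have hvb := zeta_bar z
  have bA (b : ℕ+) : Bd (A b) := ⟨_, hA b⟩
  have bB (b : ℕ+) : Bd (B b) := ⟨_, hB b⟩
  have bkA (b : ℕ+) : Bd (kA b) := ⟨_, hkA b⟩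
  have bkB (b : ℕ+) : Bd (kB b) := ⟨_, hkB b⟩
  have brA (b : ℕ+) : Bd (rhoA r kirC A B kA kB b) := ⟨_, hrA b⟩
  have brB (b : ℕ+) : Bd (rhoB r kirC A B kA kB b) := ⟨_, hrB b⟩
  have btA (b : ℕ+) : Bd (tailS r (rhoA r kirC A B kA kB b)) := ⟨_, (hrA b).tailS r⟩
  have btB (b : ℕ+) : Bd (tailS r (rhoB r kirC A B kA kB b)) := ⟨_, (hrB b).tailS r⟩
  have bP : Bd (pSer r kirC A B) := Bd.sum _ fun m _ => (bd_term hA hB (m - 1)).smul _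
  have bwA (b : ℕ+) : Bd (wtS (A b)) := by
    rw [hwA]
    exact (((bkA b).add (btA b)).sub (brA b)).smul _
  have bwB (b : ℕ+) : Bd (wtS (B b)) := by
    rw [hwB]
    exact ((bB b).smul _).add ((((bkB b).add (btB b)).sub (brB b)).smul _)
  have bdA (b : ℕ+) : Bd (dSerA A B kA kB b) :=
    (((bkA b).conv (bA b)).sub ((bkB b).bar.conv (bB b))).add ⟨_, Maj.derS hkA hkB (hA b)⟩
  have bdB (b : ℕ+) : Bd (dSerB A B kA kB b) :=
    (((bkB b).conv (bA b)).sub ((bkA b).bar.conv (bB b))).add ⟨_, Maj.derS hkA hkB (hB b)⟩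
  let x₁ : Ell2 s := Ell2.of (linField z) (isSobolev_linField hz)
  let x₂ : Ell2 s := Complex.I • polyMap hs hkA hkB z
  have hx₂ (a : ℕ+) : x₂ a
      = Complex.I * (E (kA a) (zeta z) * z a + E (kB a) (zeta z) * conj (z a)) := by
    rw [← polyMap_apply hs hkA hkB]
    rfl
  have hφ (a : ℕ+) : w a
      = z a * (1 + E (A a) (zeta z)) + conj (z a) * E (B a) (zeta z) := by
    rw [hw, Ell2.add_apply, polyMap_apply]
    ring
  refine ⟨x₁ + x₂ + R, fun a => ?_, fun a => ?_⟩
  · rw [Ell2.add_apply, Ell2.add_apply, hx₂]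
    rfl
  -- By linearity R enters only through R + DF[R] = U; the rest is an identity between polynomial
  -- expressions.
  have e1 : x₁ + x₂ + R + fderiv ℝ (polyMap hs hA hB) z (x₁ + x₂ + R)
      = x₁ + x₂ + fderiv ℝ (polyMap hs hA hB) z x₁ + fderiv ℝ (polyMap hs hA hB) z x₂ + U := by
    rw [map_add, map_add, ← hR]
    abel
  have e2 : x₁ a = -Complex.I * a * z a := rfl
  rw [e1, Ell2.add_apply, Ell2.add_apply, Ell2.add_apply, Ell2.add_apply, hx₂, hU,
    fderiv_polyMap_lin hs hA hB z x₁ (fun _ => rfl) bwA bwB,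
    fderiv_polyMap_field hs hA hB hkA hkB z x₂ hx₂, kirField_eq r,
    sum_kirW_eq_E hs z hA hB hφ, hwA, hwB, e2,
    E_add hv ((bB a).smul _) ((((bkB a).add (btB a)).sub (brB a)).smul _), E_smul, E_smul, E_smul,
    E_sub hv ((bkA a).add (btA a)) (brA a), E_sub hv ((bkB a).add (btB a)) (brB a),
    E_add hv (bkA a) (btA a), E_add hv (bkB a) (btB a), linField, hφ]
  have e3 : E (rhoA r kirC A B kA kB a) (zeta z) = -(E (pSer r kirC A B) (zeta z)
      * conj (E (B a) (zeta z))) - E (dSerA A B kA kB a) (zeta z) := by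
    rw [rhoA, E_sub hv (bP.conv (bB a).bar).neg (bdA a), E_neg, E_conv hv bP (bB a).bar,
      E_bar hv hvb (bB a)]
  have e4 : E (rhoB r kirC A B kA kB a) (zeta z) = -(E (pSer r kirC A B) (zeta z)
      * (1 + conj (E (A a) (zeta z)))) - E (dSerB A B kA kB a) (zeta z) := by
    rw [rhoB, E_sub hv (bP.conv (Bd.one.add (bA a).bar)).neg (bdB a), E_neg,
      E_conv hv bP (Bd.one.add (bA a).bar), E_add hv Bd.one (bA a).bar, E_one hv,
      E_bar hv hvb (bA a)]
  rw [e3, e4]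
  simp only [map_add, map_mul, map_one, Complex.conj_conj, Complex.ofReal_natCast]
  push_cast
  ring

end identity

end

noncomputable section

open Ser Polynomial

/-! ### The normal form transformation -/

/-- Near zero the linear term dominates: c^{i(i-1)} t^i = t (t c^i)^{i-1} ≤ t · 10^{-(i-1)}, and the
factor i ≤ 2^{i-1} from the derivative leaves a geometric series of ratio 1/5. -/
theorem kPoly_eval_le_two_mul {c : ℝ} (hc : 20 ≤ c) {n : ℕ} {t : ℝ} (ht : 0 ≤ t)
    (htc : t * c ^ n ≤ 1 / 10) :
    (kPoly c n).eval t ≤ 2 * t ∧ t * (derivative (kPoly c n)).eval t ≤ 2 * t := by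
  have hc0 : 0 < c := by linarith
  have hc1 : 1 ≤ c := by linarith
  have key : ∑ i ∈ Finset.Icc 1 n, (i : ℝ) * (c ^ (i * (i - 1)) * t ^ i) ≤ 2 * t := by
    have h1 : ∀ i ∈ Finset.Icc 1 n, (i : ℝ) * (c ^ (i * (i - 1)) * t ^ i)
        ≤ t * (1 / 5) ^ (i - 1) := by
      intro i hi
      obtain ⟨j, rfl⟩ := Nat.exists_eq_add_of_le' (Finset.mem_Icc.1 hi).1
      have h2 : ((j + 1 : ℕ) : ℝ) ≤ 2 ^ j := by exact_mod_cast j.lt_two_pow_self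
      have h3 : t * c ^ (j + 1) ≤ 1 / 10 :=
        (mul_le_mul_of_nonneg_left (pow_le_pow_right₀ hc1 (Finset.mem_Icc.1 hi).2) ht).trans htc
      have h4 : c ^ ((j + 1) * j) * t ^ (j + 1) = t * (t * c ^ (j + 1)) ^ j := by
        rw [pow_mul, mul_pow, pow_succ t]
        ring
      rw [Nat.add_sub_cancel, h4, mul_left_comm]
      calc t * (((j + 1 : ℕ) : ℝ) * (t * c ^ (j + 1)) ^ j)
          ≤ t * (2 ^ j * (1 / 10) ^ j) := by gcongr
        _ = t * (1 / 5) ^ j := by rw [← mul_pow]; norm_num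
    refine (Finset.sum_le_sum h1).trans ?_
    rw [← Finset.mul_sum, ← Finset.Ico_add_one_right_eq_Icc, Finset.sum_Ico_eq_sum_range,
      Nat.add_sub_cancel, mul_comm 2 t]
    simp only [Nat.add_sub_cancel_left]
    refine mul_le_mul_of_nonneg_left ?_ ht
    have h4 := (summable_geometric_of_lt_one (r := (1 / 5 : ℝ)) (by norm_num)
      (by norm_num)).sum_le_tsum (Finset.range n) fun _ _ => by positivity
    rw [tsum_geometric_of_lt_one (by norm_num) (by norm_num)] at h4
    linarith
  rw [eval_derivative_kPoly, eval_kPoly]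
  refine ⟨(Finset.sum_le_sum fun i hi => ?_).trans key, le_of_eq_of_le ?_ key⟩
  · have h1 : (1 : ℝ) ≤ i := by exact_mod_cast (Finset.mem_Icc.1 hi).1
    exact le_mul_of_one_le_left (by positivity) h1
  · exact Finset.sum_congr rfl fun i _ => by ring

theorem wt_ofFn {l : ℕ} (j : Fin l → ZIndex) : wt (List.ofFn j) = resDelta j := by
  rw [wt, List.map_ofFn, List.sum_ofFn]
  rfl

section resonantFields

variable {c : ℝ} {r : ℕ} (hc : 20 ≤ c) (hcf : CoeffBound c r kirC)

theorem Ser.Maj.abs_ofFn_le {d : Ser} {n : ℕ} (h : Maj d (kPoly c n)) (hc : 20 ≤ c) {l : ℕ}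
    (j : Fin l → ZIndex) : |d (List.ofFn j)| ≤ c ^ (l * (l - 1)) := by
  refine (h _).trans ?_
  rw [coeff_kPoly, List.length_ofFn]
  split_ifs
  · exact le_rfl
  · positivity

/-- The resonant fields `K_{2l+1}` of the normal form. -/
def resField (l : ℕ) : PolyField l :=
  PolyField.ofFun (fun a j => (nf r kirC r).kA a (List.ofFn j))
    (fun a j => (nf r kirC r).kB a (List.ofFn j)) (c ^ (l * (l - 1)))
    (fun a j => (maj_nf hc hcf le_rfl a).2.2.1.abs_ofFn_le hc j)
    fun a j => (maj_nf hc hcf le_rfl a).2.2.2.abs_ofFn_le hc j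

theorem nf_res (r : ℕ) (cf : ℕ → ℝ) (n : ℕ) (a : ℕ+) (w : List ZIndex) :
    (wt w ≠ 0 → (nf r cf n).kA a w = 0) ∧ (wt w ≠ (a : ℤ) → (nf r cf n).kB a w = 0) := by
  rcases le_or_gt w.length n with h | h
  · obtain ⟨-, -, h1, h2⟩ := nf_spec (r := r) (cf := cf) a h
    exact ⟨fun hw => h1.trans (if_neg hw), fun hw => h2.trans (if_neg hw)⟩
  · obtain ⟨-, -, h1, h2⟩ := nf_eq_zero (r := r) (cf := cf) n a w (Or.inr h)
    exact ⟨fun _ => h1, fun _ => h2⟩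

theorem resField_isResonant (l : ℕ) : (resField hc hcf l).IsResonant :=
  PolyField.ofFun_isResonant
    (fun a j h => (nf_res r kirC r a _).1 (by rwa [wt_ofFn]))
    (fun a j h => (nf_res r kirC r a _).2 (by rwa [wt_ofFn]))

theorem resField_coeffNorm_le (l : ℕ) : (resField hc hcf l).coeffNorm ≤ c ^ (l ^ 2) :=
  PolyField.coeffNorm_ofFun_le.trans (pow_le_pow_right₀ (by linarith) (by
    rw [sq]
    exact Nat.mul_le_mul_left l (Nat.sub_le l 1)))

/-- The majorant has neither a constant term nor terms of degree above n, so the evaluation splits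
into the homogeneous fields l = 1, …, n. -/
theorem E_eq_sum_kPoly {v : ZIndex → ℂ} (hv : Summable fun j => ‖v j‖) {d : Ser} {n : ℕ}
    (h : Maj d (kPoly c n)) : E d v = ∑ l ∈ Finset.Icc 1 n, ev l d v := by
  refine tsum_eq_sum fun l hl => ?_
  have := norm_ev_le hv h l
  rw [coeff_kPoly, if_neg (by simpa using hl), zero_mul] at this
  exact norm_le_zero_iff.1 this

theorem sum_resField {s : ℝ} (hs : 0 ≤ s) (z : Ell2 s) (a : ℕ+) :
    ∑ l ∈ Finset.Icc 1 r, (resField hc hcf l).compZ z a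
      = Complex.I * (E ((nf r kirC r).kA a) (zeta z) * z a
        + E ((nf r kirC r).kB a) (zeta z) * conj (z a)) := by
  obtain ⟨hv, -⟩ := summable_zeta hs z
  obtain ⟨-, -, h1, h2⟩ := maj_nf hc hcf le_rfl a
  rw [E_eq_sum_kPoly hv h1, E_eq_sum_kPoly hv h2, Finset.sum_mul, Finset.sum_mul,
    ← Finset.sum_add_distrib, Finset.mul_sum]
  refine Finset.sum_congr rfl fun l _ => ?_
  rw [resField, PolyField.compZ_ofFun hv, ev_eq_tsum hv h1, ev_eq_tsum hv h2]
  ring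

end resonantFields

theorem phaseBall_eq (s R : ℝ) : phaseBall s R = Metric.ball 0 (R / √2) := by
  ext z
  have : phaseNorm s z = √2 * ‖z‖ := by rw [phaseNorm_eq, Ell2.norm_eq]
  rw [mem_ball_zero_iff, lt_div_iff₀ (by positivity), mul_comm, ← this]
  rfl

theorem sqrt_two_lt : √2 < 3 / 2 := by
  rw [Real.sqrt_lt' (by norm_num)]
  norm_num

section transformation

variable {c : ℝ} {r : ℕ} (hc : 20 ≤ c) (hcf : CoeffBound c r kirC) {s : ℝ} (hs : 0 ≤ s)

/-- The transformation minus the identity. -/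
def nfMap : Ell2 s → Ell2 s :=
  polyMap hs (fun a => (maj_nf hc hcf le_rfl a).1) fun a => (maj_nf hc hcf le_rfl a).2.1

/-- At t = 3‖z‖² the majorant of A and B is at most t, and the two families give 2t‖z‖ = 6‖z‖³. -/
theorem norm_nfMap_le (z : Ell2 s) (hz : 3 * ‖z‖ ^ 2 * c ^ r ≤ 1 / 10) :
    ‖nfMap hc hcf hs z‖ ≤ 6 * ‖z‖ ^ 3 := by
  have h1 := (kPoly_eval_le_two_mul hc (by positivity) hz).1
  have h2 := norm_polyMap_le hs (fun a => (maj_nf hc hcf le_rfl a).1)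
    (fun a => (maj_nf hc hcf le_rfl a).2.1) z
    (fun a => norm_E_zeta_le hs (maj_nf hc hcf le_rfl a).1 z)
    fun a => norm_E_zeta_le hs (maj_nf hc hcf le_rfl a).2.1 z
  rw [eval_mul, eval_C] at h2
  refine h2.trans ?_
  nlinarith [norm_nonneg z]

/-- With t = 3‖z‖² the bound of `norm_fderiv_polyMap_le` is at most 6t, and t ≤ 1/(10 c^r) ≤ 1/200.
-/
theorem norm_fderiv_nfMap_le (hr : 1 ≤ r) (z : Ell2 s) (hz : 3 * ‖z‖ ^ 2 * c ^ r ≤ 1 / 10) :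
    ‖fderiv ℝ (nfMap hc hcf hs) z‖ ≤ 1 / 4 := by
  obtain ⟨h1, h2⟩ := kPoly_eval_le_two_mul hc (by positivity) hz
  have h3 := norm_fderiv_polyMap_le hs (fun a => (maj_nf hc hcf le_rfl a).1)
    (fun a => (maj_nf hc hcf le_rfl a).2.1) z
  rw [eval_mul, eval_C, derivative_C_mul, eval_mul, eval_C] at h3
  have h4 : 20 ≤ c ^ r := hc.trans (le_self_pow₀ (by linarith) (by omega))
  refine h3.trans ?_
  nlinarith [sq_nonneg ‖z‖]

theorem norm_le_of_add_nfMap (hr : 1 ≤ r) (z : Ell2 s) (hz : 3 * ‖z‖ ^ 2 * c ^ r ≤ 1 / 10) :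
    ‖z + nfMap hc hcf hs z‖ ≤ 5 / 4 * ‖z‖ ∧ ‖z‖ ≤ 5 / 4 * ‖z + nfMap hc hcf hs z‖ := by
  have h1 := norm_nfMap_le hc hcf hs z hz
  have h4 : 20 ≤ c ^ r := hc.trans (le_self_pow₀ (by linarith) (by omega))
  have h5 : 6 * ‖z‖ ^ 3 ≤ 1 / 5 * ‖z‖ := by
    have : 6 * ‖z‖ ^ 2 ≤ 1 / 5 := by nlinarith [sq_nonneg ‖z‖]
    nlinarith [norm_nonneg z]
  have h2 := norm_add_le z (nfMap hc hcf hs z)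
  have h3 := norm_sub_norm_le z (-nfMap hc hcf hs z)
  rw [sub_neg_eq_add, norm_neg] at h3
  have := norm_nonneg z
  constructor <;> linarith

/-- The transformed field minus the normal form, multiplied by the derivative of the
transformation. -/
theorem exists_remainder (hr : 2 ≤ r) {C₀ : ℝ} (hC : IsStructureConstant r C₀) (hCc : C₀ ≤ c) :
    ∃ U : Ell2 s → Ell2 s, Continuous U ∧
      (∀ z a, U z a = Complex.I *
        (E (tailS r ((nf r kirC r).rA r kirC a)) (zeta z) * z a
          + E (tailS r ((nf r kirC r).rB r kirC a)) (zeta z) * conj (z a))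
        + kirRS r (z + nfMap hc hcf hs z : Ell2 s) * conj ((z + nfMap hc hcf hs z : Ell2 s) a)) ∧
      ∀ z : Ell2 s, 3 * ‖z‖ ^ 2 * c ^ r ≤ 1 / 10 →
        ‖U z‖ ≤ 3 ^ (r + 2) * c ^ (r * (r + 1)) * ‖z‖ ^ (2 * r + 3) := by
  have hρ := Maj.rho (r := r) (cf := kirC) (fun a => (maj_nf hc hcf le_rfl a).1)
    (fun a => (maj_nf hc hcf le_rfl a).2.1) (fun a => (maj_nf hc hcf le_rfl a).2.2.1)
    fun a => (maj_nf hc hcf le_rfl a).2.2.2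
  have hA (a : ℕ+) : Maj (tailS r ((nf r kirC r).rA r kirC a)) (qPoly r kirC (kPoly c r)) :=
    (hρ a).1.tailS r
  have hB (a : ℕ+) : Maj (tailS r ((nf r kirC r).rB r kirC a)) (qPoly r kirC (kPoly c r)) :=
    (hρ a).2.tailS r
  have hφ : Continuous fun z : Ell2 s => z + nfMap hc hcf hs z :=
    continuous_id.add (contDiff_polyMap hs _ _ (n := 0)).continuous
  refine ⟨fun z => Complex.I • polyMap hs hA hB z
    + kirRS r (z + nfMap hc hcf hs z : Ell2 s) • Ell2.conjL s (z + nfMap hc hcf hs z), ?_,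
    fun z a => ?_, fun z hz => ?_⟩
  · exact ((contDiff_polyMap hs hA hB (n := 0)).continuous.const_smul Complex.I).add
      (((continuous_kirRS hs r).comp hφ).smul ((Ell2.conjL s).continuous.comp hφ))
  · rw [Ell2.add_apply, Ell2.smul_apply, Ell2.smul_apply, polyMap_apply, Ell2.conjL_apply]
  · set w := z + nfMap hc hcf hs z with hw
    have hc0 : 0 < c := by linarith
    have hcr : 0 < c ^ r := by positivity
    obtain ⟨hv, hvz⟩ := summable_zeta hs z
    have hT : ∑' j, ‖zeta z j‖ ≤ (c ^ r)⁻¹ := hvz.trans (by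
      rw [← one_div, le_div_iff₀ hcr]
      linarith)
    -- The comparison radius is c^{-r}, at which the majorant of the right-hand side is at most 1.
    have htail {d : Ser} (hd : Maj (tailS r d) (qPoly r kirC (kPoly c r))) :
        ‖E (tailS r d) (zeta z)‖ ≤ (3 * ‖z‖ ^ 2 * c ^ r) ^ (r + 1) := by
      refine (norm_E_le_of_eq_zero hv hd (tailS_eq_zero r d) (inv_pos.2 hcr) hT).trans ?_
      have h1 := qPoly_eval_le hc hcf (n := r) (Nat.le_succ r) le_rfl
      rw [div_inv_eq_mul]
      have h2 : 0 ≤ ∑' j, ‖zeta z j‖ := tsum_nonneg fun _ => norm_nonneg _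
      calc _ ≤ ((∑' j, ‖zeta z j‖) * c ^ r) ^ (r + 1) * 1 := by gcongr
        _ ≤ _ := by rw [mul_one]; gcongr
    have h1 := norm_polyMap_le hs hA hB z (fun a => htail (hA a)) fun a => htail (hB a)
    have h2 : ‖kirRS r w • Ell2.conjL s w‖ ≤ C₀ ^ r * ‖w‖ ^ (2 * r + 3) := by
      have h3 := (hC.2.2 s hs w).2
      have h4 : ‖kirRS r w • Ell2.conjL s w‖ = sobNorm s (kirR r w) := by
        rw [Ell2.norm_eq]
        congr 1
        funext a
        rw [kirR_eq]
        rfl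
      rw [phaseNorm_eq, ← Ell2.norm_eq] at h3
      rw [h4]
      refine le_trans ?_ h3
      exact le_mul_of_one_le_left (sobNorm_nonneg _ _) (Real.one_le_sqrt.2 (by norm_num))
    have h5 : ‖w‖ ≤ 2 * ‖z‖ := (norm_le_of_add_nfMap hc hcf hs (by omega) z hz).1.trans
      (by linarith [norm_nonneg z])
    have h6 : C₀ ^ r * ‖w‖ ^ (2 * r + 3) ≤ c ^ r * (2 * ‖z‖) ^ (2 * r + 3) := by
      have := hC.1
      gcongr
    -- The tails take two of the three parts 3^{r+1} of 3^{r+2}; the Taylor remainder has to fit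
    -- into the third, which it does because 4 ≤ c^r and, for r ≥ 2, 8 ≤ 3^{r+1}.
    have h7 : c ^ r * 2 ^ (2 * r + 3) ≤ 3 ^ (r + 1) * c ^ (r * (r + 1)) := by
      have e1 : c ^ (r * (r + 1)) = c ^ r * (c ^ r) ^ r := by rw [← pow_mul, ← pow_add]; ring_nf
      have e2 : (2 : ℝ) ^ (2 * r + 3) = 4 ^ r * 8 := by rw [pow_add, pow_mul]; norm_num
      have e3 : (4 : ℝ) ^ r ≤ (c ^ r) ^ r := by
        gcongr
        exact (by linarith : (4 : ℝ) ≤ c).trans (le_self_pow₀ (by linarith) (by omega))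
      have e4 : (8 : ℝ) ≤ 3 ^ (r + 1) := by
        calc (8 : ℝ) ≤ 3 ^ 3 := by norm_num
          _ ≤ 3 ^ (r + 1) := pow_le_pow_right₀ (by norm_num) (by omega)
      have e5 := mul_le_mul e3 e4 (by norm_num) (by positivity)
      rw [e1, e2]
      calc c ^ r * (4 ^ r * 8) ≤ c ^ r * ((c ^ r) ^ r * 3 ^ (r + 1)) :=
            mul_le_mul_of_nonneg_left e5 hcr.le
        _ = _ := by ring
    have h8 : (3 * ‖z‖ ^ 2 * c ^ r) ^ (r + 1)
        = 3 ^ (r + 1) * c ^ (r * (r + 1)) * ‖z‖ ^ (2 * r + 2) := by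
      rw [mul_pow, mul_pow, ← pow_mul, ← pow_mul]
      ring
    calc _ ≤ ‖Complex.I • polyMap hs hA hB z‖ + ‖kirRS r w • Ell2.conjL s w‖ := norm_add_le _ _
      _ ≤ 2 * (3 * ‖z‖ ^ 2 * c ^ r) ^ (r + 1) * ‖z‖ + c ^ r * (2 * ‖z‖) ^ (2 * r + 3) := by
        rw [norm_smul, Complex.norm_I, one_mul]
        exact add_le_add h1 (h2.trans h6)
      _ = 2 * (3 ^ (r + 1) * c ^ (r * (r + 1))) * ‖z‖ ^ (2 * r + 3)
          + c ^ r * 2 ^ (2 * r + 3) * ‖z‖ ^ (2 * r + 3) := by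
        rw [h8, mul_pow 2]
        ring
      _ ≤ 2 * (3 ^ (r + 1) * c ^ (r * (r + 1))) * ‖z‖ ^ (2 * r + 3)
          + 3 ^ (r + 1) * c ^ (r * (r + 1)) * ‖z‖ ^ (2 * r + 3) := by gcongr
      _ = _ := by ring

end transformation

end

/-! ### The change of coordinates on the balls of radius 3ε and 4ε -/

noncomputable section

open Ser Polynomial

section transformation

theorem phaseNorm_coe {s : ℝ} (z : Ell2 s) : phaseNorm s z = √2 * ‖z‖ := by
  rw [phaseNorm_eq, Ell2.norm_eq]

/-- The phase norm carries a √2, so ‖z‖² ≤ 8ε². From rc ≥ 40 and the smallness of ε one gets 240 ε²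
c^r ≤ 1, and 24/240 is the required 1/10. -/
theorem norm_sq_mul_pow_le {c ε : ℝ} {r : ℕ} (hc : 20 ≤ c) (hr : 2 ≤ r) (hε : 0 < ε)
    (hε' : ε ≤ (6 * (r : ℝ) * c ^ (r + 1)) ^ (-(1 / 2) : ℝ)) {s : ℝ} {z : Ell2 s}
    (hz : z ∈ phaseBall s (4 * ε)) : 3 * ‖z‖ ^ 2 * c ^ r ≤ 1 / 10 := by
  have hc0 : 0 < c := by linarith
  have hr' : (2 : ℝ) ≤ r := by exact_mod_cast hr
  have hx : 0 < 6 * (r : ℝ) * c ^ (r + 1) := by positivity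
  have h1 : ε ^ 2 * (6 * (r : ℝ) * c ^ (r + 1)) ≤ 1 := by
    have h2 := pow_le_pow_left₀ hε.le hε' 2
    rw [← Real.rpow_natCast, ← Real.rpow_natCast, ← Real.rpow_mul hx.le] at h2
    norm_num [Real.rpow_neg_one] at h2
    calc ε ^ 2 * (6 * (r : ℝ) * c ^ (r + 1))
        ≤ (6 * (r : ℝ) * c ^ (r + 1))⁻¹ * (6 * (r : ℝ) * c ^ (r + 1)) := by
          gcongr
          simpa [mul_comm, mul_left_comm, mul_assoc] using h2
      _ = 1 := inv_mul_cancel₀ hx.ne'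
  have h3 : 2 * ‖z‖ ^ 2 ≤ 16 * ε ^ 2 := by
    have h4 : √2 * ‖z‖ < 4 * ε := by rw [← phaseNorm_coe]; exact hz
    have h5 := pow_le_pow_left₀ (by positivity) h4.le 2
    rw [mul_pow, mul_pow, Real.sq_sqrt (by norm_num)] at h5
    linarith
  have h6 : 40 ≤ (r : ℝ) * c := by nlinarith
  have h7 : 0 < c ^ r := by positivity
  have h8 : ε ^ 2 * c ^ r * 240 ≤ 1 := by
    calc ε ^ 2 * c ^ r * 240 ≤ ε ^ 2 * c ^ r * (6 * (r * c)) := by gcongr; linarith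
      _ = ε ^ 2 * (6 * (r : ℝ) * c ^ (r + 1)) := by ring
      _ ≤ 1 := h1
  have h9 : 3 * ‖z‖ ^ 2 * c ^ r ≤ 24 * ε ^ 2 * c ^ r :=
    mul_le_mul_of_nonneg_right (by linarith) h7.le
  linarith

/-- Each entry is multiplied by bounded factors, so every weighted space is preserved, whatever its
index. This is why the transformation respects the domain of Z_1. -/
theorem IsSobolev.add_polyMap {s s' : ℝ} (hs : 0 ≤ s) {A B : ℕ+ → Ser} {p : ℝ[X]}
    (hA : ∀ a, Maj (A a) p) (hB : ∀ a, Maj (B a) p) {z : Ell2 s} (hz : IsSobolev s' z) :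
    IsSobolev s' (z + polyMap hs hA hB z : Ell2 s) := by
  refine hz.of_le (M := 1 + 2 * p.eval (3 * ‖z‖ ^ 2)) fun a => ?_
  have h1 := norm_polyMap_apply_le hs hA hB z (fun a => norm_E_zeta_le hs (hA a) z)
    (fun a => norm_E_zeta_le hs (hB a) z) a
  rw [Ell2.add_apply]
  refine (norm_add_le _ _).trans ?_
  linarith

/-- All constants leave room for 2 in place of √2; this slack gives the strict inequalities away
from zero. -/
theorem sqrt_two_mul_lt_of_le {x y M N : ℝ} (hy : 0 ≤ y) (hx : x ≤ M * y) (hM : 0 ≤ M)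
    (hMN : 2 * M < N) : √2 * x ≤ N * y ∧ (y ≠ 0 → √2 * x < N * y) := by
  have h1 : √2 * x ≤ 2 * M * y := by
    rcases le_or_gt x 0 with h | h
    · exact (mul_nonpos_of_nonneg_of_nonpos (Real.sqrt_nonneg _) h).trans (by positivity)
    · nlinarith [sqrt_two_lt]
  have h2 : 2 * M * y ≤ N * y := mul_le_mul_of_nonneg_right hMN.le hy
  refine ⟨h1.trans h2, fun h => h1.trans_lt ?_⟩
  exact mul_lt_mul_of_pos_right hMN (lt_of_le_of_ne hy (Ne.symm h))

theorem exists_transformation {c C₀ : ℝ} {r : ℕ} (hc : 20 ≤ c) (hcf : CoeffBound c r kirC)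
    (hr : 2 ≤ r) (hC : IsStructureConstant r C₀) (hCc : C₀ ≤ c) {s : ℝ} (hs : 0 ≤ s) {ε : ℝ}
    (hε : 0 < ε) (hε' : ε ≤ (6 * (r : ℝ) * c ^ (r + 1)) ^ (-(1 / 2) : ℝ)) :
    ∃ (φ : OpenPartialHomeomorph (Ell2 s) (Ell2 s)) (R' : Ell2 s → Ell2 s),
      ContDiffOn ℝ ∞ φ φ.source ∧ ContDiffOn ℝ ∞ φ.symm φ.target ∧
      phaseBall s (3 * ε) ⊆ φ.source ∧ MapsTo φ (phaseBall s (3 * ε)) (phaseBall s (4 * ε)) ∧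
      phaseBall s (3 * ε) ⊆ φ.target ∧ MapsTo φ.symm (phaseBall s (3 * ε)) (phaseBall s (4 * ε)) ∧
      ContinuousOn R' (phaseBall s (3 * ε)) ∧
      TransformsInto φ (phaseBall s (3 * ε)) kirField (fun z a =>
        linField z a + ∑ l ∈ Finset.Icc 1 r, (resField hc hcf l).compZ z a + R' z a) ∧
      (∀ z ∈ phaseBall s (3 * ε), phaseNorm s (z - φ z) ≤ 9 * c * sobNorm s z ^ 3 ∧
        (z ≠ 0 → phaseNorm s (z - φ z) < 9 * c * sobNorm s z ^ 3)) ∧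
      (∀ w ∈ phaseBall s (3 * ε) ∪ φ '' phaseBall s (3 * ε),
        phaseNorm s (w - φ.symm w) ≤ 9 * c * sobNorm s w ^ 3 ∧
        (w ≠ 0 → phaseNorm s (w - φ.symm w) < 9 * c * sobNorm s w ^ 3)) ∧
      (∀ z ∈ phaseBall s (3 * ε),
        phaseNorm s (R' z) ≤ (3 * c) ^ (r * (r + 1)) * sobNorm s z ^ (2 * r + 3) ∧
        (z ≠ 0 → phaseNorm s (R' z) < (3 * c) ^ (r * (r + 1)) * sobNorm s z ^ (2 * r + 3))) := by
  have hsmall (z : Ell2 s) (hz : z ∈ phaseBall s (4 * ε)) := norm_sq_mul_pow_le hc hr hε hε' hz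
  have h34 : phaseBall s (3 * ε) ⊆ phaseBall s (4 * ε) := fun z hz =>
    lt_trans (b := 3 * ε) hz (by linarith)
  set F := nfMap hc hcf hs with hF
  have hFs : ContDiff ℝ ∞ F := contDiff_polyMap hs _ _
  have hF0 : F 0 = 0 := by
    have h := norm_nfMap_le hc hcf hs 0 (by simp)
    rw [norm_zero] at h
    exact norm_le_zero_iff.1 (h.trans (by norm_num))
  -- The source is the ball of radius 4ε in the phase norm, so that the guaranteed image, three
  -- quarters of it, is exactly the ball of radius 3ε.
  have hd : ∀ z ∈ Metric.ball (0 : Ell2 s) (4 * ε / √2), ‖fderiv ℝ F z‖ ≤ 1 / 4 := fun z hz =>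
    norm_fderiv_nfMap_le hc hcf hs (by omega) z (hsmall z (by rwa [phaseBall_eq]))
  obtain ⟨φ, hφ, hsource, htarget, hφs, hφs'⟩ := exists_openPartialHomeomorph hFs hF0 hd
  obtain ⟨U, hUc, hU, hUn⟩ := exists_remainder hc hcf hs hr hC hCc
  obtain ⟨R', hR'c, hR'⟩ := exists_pullback hFs hd hUc.continuousOn
  rw [← phaseBall_eq] at hsource hR'c hR'
  rw [show 3 / 4 * (4 * ε / √2) = 3 * ε / √2 by ring, ← phaseBall_eq] at htarget
  have hfd (z : Ell2 s) : fderiv ℝ φ z = 1 + fderiv ℝ F z := by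
    have h1 : (φ : Ell2 s → Ell2 s) = fun z => z + F z := funext hφ
    rw [h1]
    exact ((hasFDerivAt_id z).add (hFs.differentiable (by simp) z).hasFDerivAt).fderiv
  -- The distortion is at most 5/4, and 15/4 < 4.
  have hbig {z w : Ell2 s} (h : ‖z‖ ≤ 5 / 4 * ‖w‖) (hw : w ∈ phaseBall s (3 * ε)) :
      z ∈ phaseBall s (4 * ε) := by
    have h1 : √2 * ‖w‖ < 3 * ε := by rw [← phaseNorm_coe]; exact hw
    change phaseNorm s z < 4 * ε
    rw [phaseNorm_coe]
    have h2 := mul_le_mul_of_nonneg_left h (Real.sqrt_nonneg 2)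
    linarith
  have hmaps : MapsTo φ (phaseBall s (3 * ε)) (phaseBall s (4 * ε)) := fun z hz => by
    rw [hφ]
    exact hbig (norm_le_of_add_nfMap hc hcf hs (by omega) z (hsmall z (h34 hz))).1 hz
  have hsub {w : Ell2 s} (hw : w ∈ phaseBall s (3 * ε) ∪ φ '' phaseBall s (3 * ε)) :
      w ∈ φ.target := by
    rcases hw with hw | ⟨z, hz, rfl⟩
    · exact htarget hw
    · exact φ.map_source (hsource ▸ h34 hz)
  refine ⟨φ, R', hφs, hφs', hsource ▸ h34, hmaps, htarget, fun w hw => ?_, hR'c.mono h34,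
    fun z hz hzs => ⟨?_, ?_⟩, fun z hz => ?_, fun w hw => ?_, fun z hz => ?_⟩
  · rw [← hsource]
    exact φ.map_target (htarget hw)
  · rw [hφ]
    exact hzs.add_polyMap hs _ _
  · obtain ⟨v, hv, hv'⟩ := transformed_field hs (fun a => (maj_nf hc hcf le_rfl a).1)
      (fun a => (maj_nf hc hcf le_rfl a).2.1) (fun a => (maj_nf hc hcf le_rfl a).2.2.1)
      (fun a => (maj_nf hc hcf le_rfl a).2.2.2)
      (fun a => (Maj.rho (r := r) (cf := kirC) (fun a => (maj_nf hc hcf le_rfl a).1)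
        (fun a => (maj_nf hc hcf le_rfl a).2.1) (fun a => (maj_nf hc hcf le_rfl a).2.2.1)
        (fun a => (maj_nf hc hcf le_rfl a).2.2.2) a).1)
      (fun a => (Maj.rho (r := r) (cf := kirC) (fun a => (maj_nf hc hcf le_rfl a).1)
        (fun a => (maj_nf hc hcf le_rfl a).2.1) (fun a => (maj_nf hc hcf le_rfl a).2.2.1)
        (fun a => (maj_nf hc hcf le_rfl a).2.2.2) a).2)
      (wtS_nf_A r kirC r) (wtS_nf_B r kirC r) z (φ z) hzs (hφ z) (R' z) (U z)
      (hR' z (h34 hz)).1 (fun a => by rw [hU, hφ]; rfl)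
    refine ⟨v, fun a => ?_, fun a => ?_⟩
    · rw [hv]
      change _ = linField z a + ∑ l ∈ Finset.Icc 1 r, (resField hc hcf l).compZ z a + R' z a
      rw [sum_resField hc hcf hs]
    · rw [← hv', hfd]
      rfl
  · have h1 : phaseNorm s (z - φ z : Ell2 s) = √2 * ‖F z‖ := by
      rw [phaseNorm_coe, hφ, sub_add_cancel_left, norm_neg]
    have h2 := sqrt_two_mul_lt_of_le (by positivity) (norm_nfMap_le hc hcf hs z (hsmall z (h34 hz)))
      (by norm_num) (show 2 * 6 < 9 * c by linarith)
    rw [← hF, ← h1, Ell2.norm_eq] at h2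
    refine ⟨h2.1, fun h => h2.2 (pow_ne_zero _ ?_)⟩
    rw [← Ell2.norm_eq]
    exact norm_ne_zero_iff.2 h
  · set z := φ.symm w with hz
    have hzw : z + F z = w := by rw [← hφ, hz, φ.right_inv (hsub hw)]
    have hzs : z ∈ phaseBall s (4 * ε) := hsource ▸ φ.map_target (hsub hw)
    have h1 : phaseNorm s (w - z : Ell2 s) = √2 * ‖F z‖ := by
      rw [phaseNorm_coe, ← hzw, add_sub_cancel_left]
    -- The displacement of the inverse at w is F at the preimage z, and ‖z‖ ≤ 2‖w‖ costs the factor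
    -- 2³; still 2 · 48 < 9 · 20.
    have h3 : ‖F z‖ ≤ 48 * ‖w‖ ^ 3 := by
      have h4 := norm_nfMap_le hc hcf hs z (hsmall z hzs)
      have h5 := (norm_le_of_add_nfMap hc hcf hs (by omega) z (hsmall z hzs)).2
      rw [← hF, hzw] at h5
      have h6 : ‖z‖ ≤ 2 * ‖w‖ := h5.trans (by linarith [norm_nonneg w])
      calc _ ≤ 6 * ‖z‖ ^ 3 := h4
        _ ≤ 6 * (2 * ‖w‖) ^ 3 := by gcongr
        _ = _ := by ring
    have h2 := sqrt_two_mul_lt_of_le (by positivity) h3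
      (by norm_num) (show 2 * 48 < 9 * c by linarith)
    rw [← h1, Ell2.norm_eq] at h2
    refine ⟨h2.1, fun h => h2.2 (pow_ne_zero _ ?_)⟩
    rw [← Ell2.norm_eq]
    exact norm_ne_zero_iff.2 h
  · have hc0 : 0 < c := by linarith
    have h1 := (hR' z (h34 hz)).2.trans
      (mul_le_mul_of_nonneg_left (hUn z (hsmall z (h34 hz))) (by norm_num))
    rw [← mul_assoc] at h1
    -- The 4/3 is the norm of (1 + DF)^{-1} and the 2 stands for √2. Their product is below 3, and r
    -- + 3 ≤ r(r + 1) for r ≥ 2.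
    have h3 : 2 * (4 / 3 * (3 ^ (r + 2) * c ^ (r * (r + 1)))) < (3 * c) ^ (r * (r + 1)) := by
      have h4 : (3 : ℝ) ^ (r + 3) ≤ 3 ^ (r * (r + 1)) :=
        pow_le_pow_right₀ (by norm_num) (by nlinarith)
      have h5 : (0 : ℝ) < 3 ^ (r + 2) := by positivity
      have h6 : (3 : ℝ) ^ (r + 3) = 3 ^ (r + 2) * 3 := pow_succ _ _
      have h7 : 0 < c ^ (r * (r + 1)) := by positivity
      rw [mul_pow, ← mul_assoc, ← mul_assoc]
      refine mul_lt_mul_of_pos_right ?_ h7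
      linarith
    have h2 := sqrt_two_mul_lt_of_le (by positivity) h1 (by positivity) h3
    rw [← phaseNorm_coe, Ell2.norm_eq] at h2
    refine ⟨h2.1, fun h => h2.2 (pow_ne_zero _ ?_)⟩
    rw [← Ell2.norm_eq]
    exact norm_ne_zero_iff.2 h

end transformation

end

noncomputable section

open Polynomial

/-! ### The normal form up to degree five -/

namespace Ser

theorem conv_singleton (c d : Ser) (j : ZIndex) : conv c d [j] = c [] * d [j] + c [j] * d [] := rfl

theorem conv_pair (c d : Ser) (j k : ZIndex) :
    conv c d [j, k] = c [] * d [j, k] + (c [j] * d [k] + c [j, k] * d []) := rfl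

variable {A B kA kB : ℕ+ → Ser} {r : ℕ} {cf : ℕ → ℝ} {p : ℝ[X]}

theorem one_nil : one [] = 1 := if_pos rfl

theorem one_cons (j : ZIndex) (w : List ZIndex) : one (j :: w) = 0 := if_neg (by simp)

theorem serG_nil (h0 : ∀ a, A a [] = 0 ∧ B a [] = 0 ∧ kA a [] = 0 ∧ kB a [] = 0) (b : ℕ+) :
    serG A B b [] = 1 := by
  have : bar (B b) [] = 0 := (h0 b).2.1
  simp [serG, one_nil, h0 b, this]

theorem serH_nil (h0 : ∀ a, A a [] = 0 ∧ B a [] = 0 ∧ kA a [] = 0 ∧ kB a [] = 0) (b : ℕ+) :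
    serH A B b [] = 1 := by
  have : bar (B b) [] = 0 := (h0 b).2.1
  simp [serH, one_nil, h0 b, this]

theorem yHead_nil (h0 : ∀ a, A a [] = 0 ∧ B a [] = 0 ∧ kA a [] = 0 ∧ kB a [] = 0) (b : ℕ+) :
    yHead A B (1, b) [] = (b : ℝ)⁻¹ ∧ yHead A B (-1, b) [] = (b : ℝ)⁻¹ ∧
      yHead A B (0, b) [] = 2 * (b : ℝ)⁻¹ := by
  have hG := serG_nil h0 b
  refine ⟨?_, ?_, ?_⟩
  · change (b : ℝ)⁻¹ * (serG A B b [] * serG A B b []) = _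
    rw [hG, one_mul, mul_one]
  · change (b : ℝ)⁻¹ * (serG A B b [] * serG A B b []) = _
    rw [hG, one_mul, mul_one]
  · change 2 * (b : ℝ)⁻¹ * (serG A B b [] * serG A B b []) = _
    rw [hG, one_mul, mul_one]

theorem sHead_nil (h0 : ∀ a, A a [] = 0 ∧ B a [] = 0 ∧ kA a [] = 0 ∧ kB a [] = 0) (b : ℕ+) :
    sHead A B (1, b) [] = 1 ∧ sHead A B (-1, b) [] = -1 ∧ sHead A B (0, b) [] = 0 := by
  have hG := serG_nil h0 b
  have hH := serH_nil h0 b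
  refine ⟨?_, ?_, ?_⟩
  · change serH A B b [] * serG A B b [] = _
    rw [hG, hH, one_mul]
  · change -(serH A B b [] * serG A B b []) = _
    rw [hG, hH, one_mul]
  · change serH A B b [] * serG A B b [] - serH A B b [] * serG A B b [] = _
    rw [sub_self]

/-- A has no linear part, so G and H have opposite linear parts ±B̄. They cancel in the product GH
and survive only in the mixed letter. -/
theorem sHead_singleton (h0 : ∀ a, A a [] = 0 ∧ B a [] = 0 ∧ kA a [] = 0 ∧ kB a [] = 0)
    (h1 : ∀ a j, A a [j] = 0) (b : ℕ+) (k : ZIndex) :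
    sHead A B (1, b) [k] = 0 ∧ sHead A B (-1, b) [k] = 0 ∧
      sHead A B (0, b) [k] = 2 * (B b [k] - B b [k.bar]) := by
  have hG := serG_nil h0 b
  have hH := serH_nil h0 b
  have hG1 (k : ZIndex) : serG A B b [k] = B b [k.bar] := by
    change one [k] + A b [k] + B b [k.bar] = _
    rw [one_cons, h1, zero_add, zero_add]
  have hH1 (k : ZIndex) : serH A B b [k] = -B b [k.bar] := by
    change one [k] + A b [k] - B b [k.bar] = _
    rw [one_cons, h1, zero_add, zero_sub]
  refine ⟨?_, ?_, ?_⟩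
  · change serH A B b [] * serG A B b [k] + serH A B b [k] * serG A B b [] = _
    rw [hG, hH, hG1, hH1]
    ring
  · change -(serH A B b [] * serG A B b [k.bar] + serH A B b [k.bar] * serG A B b []) = _
    rw [hG, hH, hG1, hH1]
    ring
  · change serH A B b [] * serG A B b [k.bar] + serH A B b [k] * serG A B b []
      - (serH A B b [] * serG A B b [k] + serH A B b [k.bar] * serG A B b []) = _
    rw [hG, hH, hG1, hH1, hG1, hH1, ZIndex.bar_bar]
    ring

/-- The summand of index m begins in degree m, so only f(0) and f'(0) matter up to degree two. -/
theorem pSer_eq_sum_two (hA : ∀ a, Maj (A a) p) (hB : ∀ a, Maj (B a) p) (hr : 2 ≤ r)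
    {w : List ZIndex} (hw : w.length ≤ 2) : pSer r cf A B w = cf 1 * lin (sHead A B) w
      + cf 2 * conv (conv (lin (yHead A B)) one) (lin (sHead A B)) w := by
  obtain ⟨q, hq⟩ := exists_maj_yHead hA hB
  obtain ⟨q', hq'⟩ := exists_maj_sHead hA hB
  have h1 : pSer r cf A B w = ∑ m ∈ Finset.Icc 1 r,
      cf m * conv (powS (lin (yHead A B)) (m - 1)) (lin (sHead A B)) w := by
    rw [pSer, Finset.sum_apply]
    rfl
  have h2 : ({1, 2} : Finset ℕ) ⊆ Finset.Icc 1 r := by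
    intro m hm
    simp only [Finset.mem_insert, Finset.mem_singleton] at hm
    rw [Finset.mem_Icc]
    omega
  rw [h1, ← Finset.sum_subset h2 fun m hm hm' => ?_, Finset.sum_pair (by norm_num)]
  · change cf 1 * conv one (lin (sHead A B)) w
      + cf 2 * conv (conv (lin (yHead A B)) one) (lin (sHead A B)) w = _
    rw [one_conv]
  · have hm1 := (Finset.mem_Icc.1 hm).1
    have hm3 : 2 < m := by
      simp only [Finset.mem_insert, Finset.mem_singleton] at hm'
      omega
    have h3 := ((Maj.lin hq).powS (m - 1)).conv (Maj.lin hq') w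
    have h4 : (X * q) ^ (m - 1) * (X * q') = X ^ m * (q ^ (m - 1) * q') := by
      obtain ⟨n, rfl⟩ := Nat.exists_eq_add_of_le' hm1
      rw [Nat.add_sub_cancel]
      ring
    rw [h4, coeff_X_pow_mul', if_neg (by omega)] at h3
    rw [abs_nonpos_iff.1 h3, mul_zero]

theorem pSer_singleton (hA : ∀ a, Maj (A a) p) (hB : ∀ a, Maj (B a) p) (hr : 2 ≤ r) (j : ZIndex) :
    pSer r cf A B [j] = cf 1 * sHead A B j [] := by
  rw [pSer_eq_sum_two hA hB hr (by simp), conv_singleton, conv_nil, lin_nil, lin_nil, lin_cons]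
  ring

theorem pSer_pair (hA : ∀ a, Maj (A a) p) (hB : ∀ a, Maj (B a) p) (hr : 2 ≤ r) (j k : ZIndex) :
    pSer r cf A B [j, k] = cf 1 * sHead A B j [k] + cf 2 * (yHead A B j [] * sHead A B k []) := by
  rw [pSer_eq_sum_two hA hB hr (by simp), conv_pair, conv_singleton, conv_nil, lin_nil, lin_nil,
    lin_cons, lin_cons, lin_cons, one_nil]
  ring

theorem derHead_nil (h0 : ∀ a, A a [] = 0 ∧ B a [] = 0 ∧ kA a [] = 0 ∧ kB a [] = 0) (c : Ser)
    (j : ZIndex) : derHead kA kB c j [] = 0 := by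
  obtain ⟨δ, b⟩ := j
  obtain ⟨-, -, h1, h2⟩ := h0 b
  cases δ
  · change 2 * kB b [] * _ - 2 * kB b [] * _ + (kA b [] - kA b []) * _ = (0 : ℝ)
    rw [h1, h2]
    ring
  · change kB b [] * _ - 2 * kA b [] * _ = (0 : ℝ)
    rw [h1, h2]
    ring
  · change 2 * kA b [] * _ - kB b [] * _ = (0 : ℝ)
    rw [h1, h2]
    ring

theorem derS_singleton (h0 : ∀ a, A a [] = 0 ∧ B a [] = 0 ∧ kA a [] = 0 ∧ kB a [] = 0) (c : Ser)
    (j : ZIndex) : derS kA kB c [j] = 0 := by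
  rw [derS_cons, derHead_nil h0, derS_nil, add_zero]

theorem derS_pair (h0 : ∀ a, A a [] = 0 ∧ B a [] = 0 ∧ kA a [] = 0 ∧ kB a [] = 0) (c : Ser)
    (j k : ZIndex) : derS kA kB c [j, k] = derHead kA kB c j [k] := by
  rw [derS_cons, derS_singleton h0, add_zero]

theorem derHead_singleton (h0 : ∀ a, A a [] = 0 ∧ B a [] = 0 ∧ kA a [] = 0 ∧ kB a [] = 0)
    (hk : ∀ a j, kA a [j] = 0) (c : Ser) (b : ℕ+) (k : ZIndex) :
    derHead kA kB c (1, b) [k] = -(kB b [k.bar] * c [(0, b)]) ∧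
    derHead kA kB c (-1, b) [k] = kB b [k] * c [(0, b)] ∧
    derHead kA kB c (0, b) [k] = 2 * kB b [k] * c [(1, b)] - 2 * kB b [k.bar] * c [(-1, b)] := by
  obtain ⟨-, -, h1, h2⟩ := h0 b
  refine ⟨?_, ?_, ?_⟩
  · change (2 * kA b [] * c [(1, b), k] + 2 * kA b [k] * c [(1, b)])
      - (kB b [] * c [(0, b), k] + kB b [k.bar] * c [(0, b)]) = _
    rw [h1, h2, hk]
    ring
  · change (kB b [] * c [(0, b), k] + kB b [k] * c [(0, b)])
      - (2 * kA b [] * c [(-1, b), k] + 2 * kA b [k.bar] * c [(-1, b)]) = _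
    rw [h1, h2, hk]
    ring
  · change (2 * kB b [] * c [(1, b), k] + 2 * kB b [k] * c [(1, b)])
      - (2 * kB b [] * c [(-1, b), k] + 2 * kB b [k.bar] * c [(-1, b)])
      + ((kA b [] - kA b []) * c [(0, b), k] + (kA b [k] - kA b [k.bar]) * c [(0, b)]) = _
    rw [h1, h2, hk, hk]
    ring

theorem rho_singleton (h0 : ∀ a, A a [] = 0 ∧ B a [] = 0 ∧ kA a [] = 0 ∧ kB a [] = 0) (a : ℕ+)
    (j : ZIndex) : rhoA r cf A B kA kB a [j] = 0 ∧
      rhoB r cf A B kA kB a [j] = -pSer r cf A B [j] := by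
  obtain ⟨h1, h2, h3, h4⟩ := h0 a
  refine ⟨?_, ?_⟩
  · change -(pSer r cf A B [] * B a [j.bar] + pSer r cf A B [j] * B a [])
      - ((kA a [] * A a [j] + kA a [j] * A a []) - (kB a [] * B a [j] + kB a [j.bar] * B a [])
        + derS kA kB (A a) [j]) = _
    rw [derS_singleton h0, pSer_nil, h1, h2, h3, h4]
    ring
  · change -(pSer r cf A B [] * (one [j] + A a [j.bar]) + pSer r cf A B [j] * (one [] + A a []))
      - ((kB a [] * A a [j] + kB a [j] * A a []) - (kA a [] * B a [j] + kA a [j.bar] * B a [])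
        + derS kA kB (B a) [j]) = _
    rw [derS_singleton h0, pSer_nil, h1, h2, h3, h4, one_nil]
    ring

/-- On words of length one A and kA vanish, so in degree two only products of linear parts of B and
kB, the linear part of `pSer` times that of B, and the degree-two part of `pSer` remain. -/
theorem rho_pair (h0 : ∀ a, A a [] = 0 ∧ B a [] = 0 ∧ kA a [] = 0 ∧ kB a [] = 0)
    (hA : ∀ a j, A a [j] = 0) (hkA : ∀ a j, kA a [j] = 0) (a : ℕ+) (j k : ZIndex) :
    rhoA r cf A B kA kB a [j, k] = kB a [j.bar] * B a [k] - pSer r cf A B [j] * B a [k.bar] ∧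
    rhoB r cf A B kA kB a [j, k] = -pSer r cf A B [j, k] - derHead kA kB (B a) j [k] := by
  obtain ⟨h1, h2, h3, h4⟩ := h0 a
  have hd : derHead kA kB (A a) j [k] = 0 := by
    obtain ⟨δ, b⟩ := j
    obtain ⟨e1, e2, e3⟩ := derHead_singleton h0 hkA (A a) b k
    cases δ
    · exact e3.trans (by rw [hA, hA]; ring)
    · exact e2.trans (by rw [hA]; ring)
    · exact e1.trans (by rw [hA]; ring)
  refine ⟨?_, ?_⟩
  · change -(pSer r cf A B [] * B a [j.bar, k.bar]
        + (pSer r cf A B [j] * B a [k.bar] + pSer r cf A B [j, k] * B a []))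
      - ((kA a [] * A a [j, k] + (kA a [j] * A a [k] + kA a [j, k] * A a []))
        - (kB a [] * B a [j, k] + (kB a [j.bar] * B a [k] + kB a [j.bar, k.bar] * B a []))
        + derS kA kB (A a) [j, k]) = _
    rw [derS_pair h0, hd, pSer_nil, h1, h2, h3, h4, hkA]
    ring
  · change -(pSer r cf A B [] * (one [j, k] + A a [j.bar, k.bar])
        + (pSer r cf A B [j] * (one [k] + A a [k.bar]) + pSer r cf A B [j, k] * (one [] + A a [])))
      - ((kB a [] * A a [j, k] + (kB a [j] * A a [k] + kB a [j, k] * A a []))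
        - (kA a [] * B a [j, k] + (kA a [j.bar] * B a [k] + kA a [j.bar, k.bar] * B a []))
        + derS kA kB (B a) [j, k]) = _
    rw [derS_pair h0, pSer_nil, h1, h2, h3, h4, hA, hA, hkA, one_nil, one_cons k]
    ring

end Ser

open Ser

section lowDegree

variable {c : ℝ} {r : ℕ}

theorem wt_singleton (j : ZIndex) : wt [j] = (j.1 : ℤ) * (j.2 : ℤ) := by simp [wt]

theorem wt_pair (j k : ZIndex) :
    wt [j, k] = (j.1 : ℤ) * (j.2 : ℤ) + (k.1 : ℤ) * (k.2 : ℤ) := by simp [wt]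

/-- Every term of the z_a-equation is a product of two factors without constant term or a derivative
that raises the degree, so nothing is present in degree one. -/
theorem nf_A_singleton (hr : 2 ≤ r) (a : ℕ+) (j : ZIndex) :
    (nf r kirC r).A a [j] = 0 ∧ (nf r kirC r).kA a [j] = 0 := by
  obtain ⟨h1, -, h2, -⟩ := nf_spec (r := r) (cf := kirC) (n := r) a (w := [j]) (by simp; omega)
  have h3 : (nf r kirC r).rA r kirC a [j] = 0 := (rho_singleton (nf_nil r) a j).1
  rw [h1, h2, solA, resA, h3]
  simp

/-- The right-hand side is -1/4 times the sign of the letter, divided by 2(a - b) for z_b² and 2(a +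
b) for z̄_b². The only resonant letter is z_a², whose coefficient -1/4 is Z_3. -/
theorem nf_B_singleton (hc : 20 ≤ c) (hcf : CoeffBound c r kirC) (hr : 2 ≤ r) (a b : ℕ+) :
    ((nf r kirC r).B a [(1, b)] = if b = a then 0 else 1 / (8 * ((b : ℝ) - a))) ∧
    (nf r kirC r).B a [(-1, b)] = 1 / (8 * ((b : ℝ) + a)) ∧
    (nf r kirC r).B a [(0, b)] = 0 ∧
    ((nf r kirC r).kB a [(1, b)] = if b = a then -(1 / 4) else 0) ∧
    (nf r kirC r).kB a [(-1, b)] = 0 ∧ (nf r kirC r).kB a [(0, b)] = 0 := by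
  have hs (j : ZIndex) := nf_spec (r := r) (cf := kirC) (n := r) a (w := [j]) (by simp; omega)
  have hρ (j : ZIndex) : (nf r kirC r).rB r kirC a [j]
      = -(1 / 4 * sHead (nf r kirC r).A (nf r kirC r).B j []) := by
    rw [← kirC_one, ← pSer_singleton (fun a => (maj_nf hc hcf le_rfl a).1)
      (fun a => (maj_nf hc hcf le_rfl a).2.1) hr]
    exact (rho_singleton (nf_nil r) a j).2
  obtain ⟨s1, s2, s3⟩ := sHead_nil (nf_nil (r := r) (cf := kirC) r) b
  have ha : (0 : ℤ) < (a : ℤ) := by exact_mod_cast a.pos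
  have hb : (0 : ℤ) < (b : ℤ) := by exact_mod_cast b.pos
  have w1 : wt [((1 : SignType), b)] = (b : ℤ) := by simp [wt_singleton]
  have w2 : wt [((-1 : SignType), b)] = -(b : ℤ) := by simp [wt_singleton]
  have w3 : wt [((0 : SignType), b)] = 0 := by simp [wt_singleton]
  have hba : ((b : ℤ) = (a : ℤ)) ↔ b = a := by
    rw [Nat.cast_inj, PNat.coe_inj]
  refine ⟨?_, ?_, ?_, ?_, ?_, ?_⟩
  · rw [(hs _).2.1, solB, hρ, w1, s1]
    simp only [hba]
    split_ifs with h
    · rfl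
    · have h1 : (b : ℝ) - a ≠ 0 := by
        rw [sub_ne_zero]
        exact_mod_cast h
      have h2 : (a : ℝ) - b ≠ 0 := by
        rw [sub_ne_zero]
        exact_mod_cast Ne.symm h
      push_cast
      field_simp
      ring
  · rw [(hs _).2.1, solB, hρ, w2, s2, if_neg (by omega)]
    have h1 : (b : ℝ) + a ≠ 0 := by positivity
    push_cast
    rw [sub_neg_eq_add, add_comm (a : ℝ)]
    field_simp
    norm_num
  · rw [(hs _).2.1, solB, hρ, w3, s3, if_neg (by omega)]
    simp
  · rw [(hs _).2.2.2, resB, hρ, w1, s1]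
    simp only [hba]
    simp
  · rw [(hs _).2.2.2, resB, hρ, w2, if_neg (by omega)]
  · rw [(hs _).2.2.2, resB, hρ, w3, if_neg (by omega)]

end lowDegree

end

/-! ### The coefficients of the quintic field -/

noncomputable section

open Ser Polynomial

section lowDegree

variable {c : ℝ} {r : ℕ}

theorem nf_kA_pair (hc : 20 ≤ c) (hcf : CoeffBound c r kirC) (hr : 2 ≤ r) (a : ℕ+) (j k : ZIndex) :
    (nf r kirC r).kA a [j, k] = if wt [j, k] = 0 then
      (nf r kirC r).kB a [j.bar] * (nf r kirC r).B a [k]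
        - 1 / 4 * sHead (nf r kirC r).A (nf r kirC r).B j [] * (nf r kirC r).B a [k.bar] else 0 := by
  obtain ⟨-, -, h1, -⟩ := nf_spec (r := r) (cf := kirC) (n := r) a (w := [j, k]) (by simp; omega)
  have h2 := (rho_pair (r := r) (cf := kirC) (nf_nil r) (fun a j => (nf_A_singleton hr a j).1)
    (fun a j => (nf_A_singleton hr a j).2) a j k).1
  rw [pSer_singleton (fun a => (maj_nf hc hcf le_rfl a).1)
      (fun a => (maj_nf hc hcf le_rfl a).2.1) hr, kirC_one] at h2
  rw [h1, resA, ← h2]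
  rfl

theorem nf_kB_pair (hc : 20 ≤ c) (hcf : CoeffBound c r kirC) (hr : 2 ≤ r) (a : ℕ+) (j k : ZIndex) :
    (nf r kirC r).kB a [j, k] = if wt [j, k] = (a : ℤ) then
      3 / 16 * (yHead (nf r kirC r).A (nf r kirC r).B j [] *
          sHead (nf r kirC r).A (nf r kirC r).B k [])
        - 1 / 4 * sHead (nf r kirC r).A (nf r kirC r).B j [k]
        - derHead (nf r kirC r).kA (nf r kirC r).kB ((nf r kirC r).B a) j [k] else 0 := by
  obtain ⟨-, -, -, h1⟩ := nf_spec (r := r) (cf := kirC) (n := r) a (w := [j, k]) (by simp; omega)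
  have h2 := (rho_pair (r := r) (cf := kirC) (nf_nil r) (fun a j => (nf_A_singleton hr a j).1)
    (fun a j => (nf_A_singleton hr a j).2) a j k).2
  rw [pSer_pair (fun a => (maj_nf hc hcf le_rfl a).1)
      (fun a => (maj_nf hc hcf le_rfl a).2.1) hr, kirC_one, kirC_two] at h2
  rw [h1, resB]
  congr 1
  refine h2.trans ?_
  ring

/-- The coefficients of the resonant field of degree five: first sum. -/
theorem nf_kA_values (hc : 20 ≤ c) (hcf : CoeffBound c r kirC) (hr : 2 ≤ r) (a b d : ℕ+) :
    ((nf r kirC r).kA a [(1, b), (-1, d)] =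
      if b = d then -(1 / 4 * (nf r kirC r).B a [(1, b)]) else 0) ∧
    ((nf r kirC r).kA a [(-1, b), (1, d)] =
      if b = d then 1 / 4 * (nf r kirC r).B a [(-1, b)] else 0) ∧
    (nf r kirC r).kA a [(1, b), (1, d)] = 0 ∧ (nf r kirC r).kA a [(-1, b), (-1, d)] = 0 ∧
    (nf r kirC r).kA a [(0, b), (1, d)] = 0 ∧ (nf r kirC r).kA a [(0, b), (-1, d)] = 0 ∧
    (nf r kirC r).kA a [(1, b), (0, d)] = 0 ∧ (nf r kirC r).kA a [(-1, b), (0, d)] = 0 ∧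
    (nf r kirC r).kA a [(0, b), (0, d)] = 0 := by
  have hb : (0 : ℤ) < (b : ℤ) := by exact_mod_cast b.pos
  have hd : (0 : ℤ) < (d : ℤ) := by exact_mod_cast d.pos
  have hbd : ((b : ℤ) = (d : ℤ)) ↔ b = d := by
    rw [Nat.cast_inj, PNat.coe_inj]
  have hbar (δ : SignType) (e : ℕ+) : ZIndex.bar (δ, e) = (-δ, e) := rfl
  obtain ⟨s1, s2, s3⟩ := sHead_nil (nf_nil (r := r) (cf := kirC) r) b
  obtain ⟨B1, B2, B3, k1, k2, k3⟩ := nf_B_singleton hc hcf hr a b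
  simp only [nf_kA_pair hc hcf hr, wt_pair, s1, s2, s3, hbar, neg_neg, neg_zero, k2, k3, k1,
    SignType.coe_one, SignType.coe_neg_one, SignType.coe_zero, one_mul, neg_mul, zero_mul]
  refine ⟨?_, ?_, if_neg (by omega), if_neg (by omega), if_neg (by omega), if_neg (by omega),
    if_neg (by omega), if_neg (by omega), ?_⟩
  · by_cases h : b = d
    · subst h
      simp
    · rw [if_neg h, if_neg]
      rw [← hbd] at h
      omega
  · by_cases h : b = d
    · subst h
      rw [if_pos (by omega), if_pos rfl, B1]
      split_ifs <;> ring
    · rw [if_neg h, if_neg]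
      rw [← hbd] at h
      omega
  · simp

/-- The coefficients of the resonant field of degree five: second sum. -/
theorem nf_kB_values (hc : 20 ≤ c) (hcf : CoeffBound c r kirC) (hr : 2 ≤ r) (a b d : ℕ+) :
    ((nf r kirC r).kB a [(0, b), (1, d)] = if d = a then 3 / 8 * (b : ℝ)⁻¹
      - 1 / 2 * ((nf r kirC r).B b [(1, a)] - (nf r kirC r).B b [(-1, a)]) else 0) ∧
    ((nf r kirC r).kB a [(1, b), (1, d)] = if b + d = a then 3 / 16 * (b : ℝ)⁻¹ else 0) ∧
    ((nf r kirC r).kB a [(1, b), (-1, d)] = if b = d + a then -(3 / 16 * (b : ℝ)⁻¹) else 0) ∧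
    ((nf r kirC r).kB a [(-1, b), (1, d)] = if d = b + a then 3 / 16 * (b : ℝ)⁻¹ else 0) ∧
    (nf r kirC r).kB a [(-1, b), (-1, d)] = 0 ∧ (nf r kirC r).kB a [(0, b), (-1, d)] = 0 ∧
    (nf r kirC r).kB a [(1, b), (0, d)] = 0 ∧ (nf r kirC r).kB a [(-1, b), (0, d)] = 0 ∧
    (nf r kirC r).kB a [(0, b), (0, d)] = 0 := by
  have ha : (0 : ℤ) < (a : ℤ) := by exact_mod_cast a.pos
  have hb : (0 : ℤ) < (b : ℤ) := by exact_mod_cast b.pos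
  have hd : (0 : ℤ) < (d : ℤ) := by exact_mod_cast d.pos
  have hcast (m n : ℕ+) : ((m : ℤ) = (n : ℤ)) ↔ m = n := by
    rw [Nat.cast_inj, PNat.coe_inj]
  have e1 : (b : ℤ) + d = a ↔ b + d = a := by rw [← hcast]; push_cast; rfl
  have e2 : (b : ℤ) + -d = a ↔ b = d + a := by rw [← hcast]; push_cast; omega
  have e3 : -(b : ℤ) + d = a ↔ d = b + a := by rw [← hcast]; push_cast; omega
  have hbar (δ : SignType) (e : ℕ+) : ZIndex.bar (δ, e) = (-δ, e) := rfl
  have hk (a : ℕ+) (j : ZIndex) := (nf_A_singleton hr a j).2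
  have hA (a : ℕ+) (j : ZIndex) := (nf_A_singleton hr a j).1
  obtain ⟨y1, y2, y3⟩ := yHead_nil (nf_nil (r := r) (cf := kirC) r) b
  obtain ⟨s1, s2, s3⟩ := sHead_nil (nf_nil (r := r) (cf := kirC) r) d
  have hs := sHead_singleton (nf_nil (r := r) (cf := kirC) r) hA b
  have hD := derHead_singleton (nf_nil (r := r) (cf := kirC) r) hk ((nf r kirC r).B a) b
  obtain ⟨B1, B2, B3, -⟩ := nf_B_singleton hc hcf hr a b
  obtain ⟨-, -, -, k1, k2, -⟩ := nf_B_singleton hc hcf hr b d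
  simp only [nf_kB_pair hc hcf hr, wt_pair, s1, s2, s3, y1, y2, y3, (hs _).1, (hs _).2.1,
    (hs _).2.2, (hD _).1, (hD _).2.1, (hD _).2.2, hbar, neg_neg, neg_zero, B1, B3, k1, k2,
    SignType.coe_one, SignType.coe_neg_one, SignType.coe_zero, one_mul, neg_mul, zero_mul, zero_add,
    add_zero, e1, e2, e3, hcast]
  refine ⟨?_, ?_, ?_, ?_, if_neg (by omega), if_neg (by omega), ?_, if_neg (by omega),
    if_neg (by omega)⟩
  · by_cases h : d = a
    · subst h
      rw [if_pos rfl, if_pos rfl]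
      -- The derivative term is a product of the coefficients of z_d² in kB_b and of z_b² in B_d.
      -- The first lives on d = b and the second vanishes there, so the term is zero.
      by_cases hbd : d = b
      · subst hbd
        rw [if_pos rfl, if_pos rfl]
        ring
      · rw [if_neg hbd]
        ring
    · rw [if_neg h, if_neg h]
  · simp
  · simp
  · simp
  · simp

end lowDegree

end

noncomputable section

open Ser Polynomial

/-! ### The cubic and the quintic fields -/

theorem sum_signType {M : Type*} [AddCommMonoid M] (g : SignType → M) :
    ∑ δ, g δ = g 0 + (g (-1) + g 1) := by
  have : (Finset.univ : Finset SignType) = {0, -1, 1} := rfl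
  rw [this, Finset.sum_insert (by decide), Finset.sum_insert (by decide), Finset.sum_singleton]

theorem tsum_fin_two {v : ZIndex → ℂ} (hv : Summable fun j => ‖v j‖)
    {g : (Fin 2 → ZIndex) → ℝ} {M : ℝ} (hg : ∀ j, |g j| ≤ M) :
    (∀ δ δ' : SignType, Summable fun p : ℕ+ × ℕ+ =>
      (g ![(δ, p.1), (δ', p.2)] : ℂ) * (v (δ, p.1) * v (δ', p.2))) ∧
    ∑' j : Fin 2 → ZIndex, (g j : ℂ) * ∏ k, v (j k)
      = ∑ δ : SignType, ∑ δ' : SignType, ∑' p : ℕ+ × ℕ+,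
        (g ![(δ, p.1), (δ', p.2)] : ℂ) * (v (δ, p.1) * v (δ', p.2)) := by
  have h1 := summable_mul_prod hv hg
  let e : ((SignType × SignType) × (ℕ+ × ℕ+)) ≃ (Fin 2 → ZIndex) :=
    (Equiv.prodProdProdComm _ _ _ _).trans (finTwoArrowEquiv ZIndex).symm
  have he (x : (SignType × SignType) × (ℕ+ × ℕ+)) :
      (g (e x) : ℂ) * ∏ k, v (e x k)
        = (g ![(x.1.1, x.2.1), (x.1.2, x.2.2)] : ℂ) * (v (x.1.1, x.2.1) * v (x.1.2, x.2.2)) := by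
    rw [Fin.prod_univ_two]
    rfl
  have h2 := e.summable_iff.2 h1
  have h3 : Summable fun x : (SignType × SignType) × (ℕ+ × ℕ+) =>
      (g ![(x.1.1, x.2.1), (x.1.2, x.2.2)] : ℂ) * (v (x.1.1, x.2.1) * v (x.1.2, x.2.2)) :=
    h2.congr he
  refine ⟨fun δ δ' => h3.prod_factor (δ, δ'), ?_⟩
  rw [← e.tsum_eq, tsum_congr he, h3.tsum_prod, tsum_fintype, Fintype.sum_prod_type]

theorem tsum_diag {F : ℕ+ × ℕ+ → ℂ} (h : ∀ p : ℕ+ × ℕ+, p.1 ≠ p.2 → F p = 0) :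
    ∑' p, F p = ∑' b, F (b, b) := by
  refine (Function.Injective.tsum_eq (f := F) (g := fun b : ℕ+ => (b, b))
    (fun x y h => (Prod.ext_iff.1 h).1) fun p hp => ?_).symm
  refine ⟨p.1, Prod.ext rfl ?_⟩
  by_contra hne
  exact hp (h p hne)

theorem tsum_snd_eq {F : ℕ+ × ℕ+ → ℂ} (a : ℕ+) (h : ∀ p : ℕ+ × ℕ+, p.2 ≠ a → F p = 0) :
    ∑' p, F p = ∑' b, F (b, a) := by
  refine (Function.Injective.tsum_eq (f := F) (g := fun b : ℕ+ => (b, a))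
    (fun x y h => (Prod.ext_iff.1 h).1) fun p hp => ?_).symm
  refine ⟨p.1, Prod.ext rfl ?_⟩
  by_contra hne
  exact hp (h p (Ne.symm hne))

theorem tsum_eq_add_tsum_ne {F : ℕ+ → ℂ} (hF : Summable F) (a : ℕ+) :
    ∑' b, F b = F a + ∑' d : {d : ℕ+ // d ≠ a}, F d := by
  rw [← hF.tsum_subtype_add_tsum_subtype_compl {a}, tsum_singleton]
  rfl

section pairs

variable {c : ℝ} {r : ℕ}

theorem coe_ne {a d : ℕ+} (h : d ≠ a) : ((d : ℂ) - a ≠ 0) ∧ ((d : ℂ) ^ 2 - (a : ℂ) ^ 2 ≠ 0) := by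
  have h1 : (d : ℂ) - a ≠ 0 := by
    rw [sub_ne_zero]
    exact_mod_cast h
  have h2 : (d : ℂ) + a ≠ 0 := by
    have : ((d : ℕ) : ℂ) + ((a : ℕ) : ℂ) = ((d + a : ℕ+) : ℕ) := by push_cast; rfl
    rw [this]
    exact Nat.cast_ne_zero.2 (d + a).ne_zero
  refine ⟨h1, ?_⟩
  rw [sq_sub_sq]
  exact mul_ne_zero h2 h1

theorem coe_pnat_ne_zero (a : ℕ+) : (a : ℂ) ≠ 0 := Nat.cast_ne_zero.2 a.ne_zero

/-- Only opposite pairs with the same index survive and give I_d². The two orders combine to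
(1/32)(1/(d + a) - 1/(d - a)) = -a/(16(d² - a²)), while for d = a only 1/(64a) is left. -/
theorem tsum_kA_two (hc : 20 ≤ c) (hcf : CoeffBound c r kirC) (hr : 2 ≤ r) {s : ℝ} (hs : 0 ≤ s)
    (z : Ell2 s) (a : ℕ+) :
    ∑' j : Fin 2 → ZIndex, ((nf r kirC r).kA a (List.ofFn j) : ℂ) * ∏ k, zeta z (j k)
      = 1 / (64 * (a : ℂ)) * ((‖z a‖ ^ 2 : ℝ) : ℂ) ^ 2 - (a : ℂ) / 16 *
        ∑' d : {d : ℕ+ // d ≠ a}, 1 / ((d : ℂ) ^ 2 - (a : ℂ) ^ 2) * ((‖z d‖ ^ 2 : ℝ) : ℂ) ^ 2 := by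
  obtain ⟨hsum, h⟩ := tsum_fin_two (g := fun j => (nf r kirC r).kA a (List.ofFn j))
    (summable_zeta hs z).1 fun j => (maj_nf hc hcf le_rfl a).2.2.1.abs_ofFn_le hc j
  have hofFn (x y : ZIndex) : List.ofFn ![x, y] = [x, y] := rfl
  simp only [sum_signType, hofFn, (nf_kA_values hc hcf hr a _ _).2.2.1,
    (nf_kA_values hc hcf hr a _ _).2.2.2.1, (nf_kA_values hc hcf hr a _ _).2.2.2.2.1,
    (nf_kA_values hc hcf hr a _ _).2.2.2.2.2.1, (nf_kA_values hc hcf hr a _ _).2.2.2.2.2.2.1,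
    (nf_kA_values hc hcf hr a _ _).2.2.2.2.2.2.2.1, (nf_kA_values hc hcf hr a _ _).2.2.2.2.2.2.2.2,
    Complex.ofReal_zero, zero_mul, tsum_zero, add_zero, zero_add] at h
  rw [h, tsum_diag fun p hp => by
      rw [(nf_kA_values hc hcf hr a _ _).2.1, if_neg hp, Complex.ofReal_zero, zero_mul],
    tsum_diag fun p hp => by
      rw [(nf_kA_values hc hcf hr a _ _).1, if_neg hp, Complex.ofReal_zero, zero_mul]]
  have hinj : Function.Injective fun b : ℕ+ => (b, b) := fun x y h => (Prod.ext_iff.1 h).1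
  have s1 := (hsum (-1) 1).comp_injective hinj
  have s2 := (hsum 1 (-1)).comp_injective hinj
  have s3 := s1.add s2
  simp only [Function.comp_def, hofFn] at s1 s2 s3
  rw [← Summable.tsum_add s1 s2, tsum_eq_add_tsum_ne s3 a, sub_eq_add_neg, ← mul_neg, ← tsum_neg,
    ← tsum_mul_left]
  have hI (b : ℕ+) : ((‖z b‖ ^ 2 : ℝ) : ℂ) = z b * conj (z b) := zeta_zero z b
  have ha := coe_pnat_ne_zero a
  congr 1
  · rw [(nf_kA_values hc hcf hr a _ _).1, (nf_kA_values hc hcf hr a _ _).2.1, if_pos rfl, if_pos rfl,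
      (nf_B_singleton hc hcf hr a a).1, (nf_B_singleton hc hcf hr a a).2.1, if_pos rfl, hI, zeta_one,
      zeta_neg_one]
    push_cast
    field_simp
    ring
  · refine tsum_congr fun d => ?_
    obtain ⟨h1, h2⟩ := coe_ne d.2
    have h3 : ((d : ℕ+) : ℂ) + a ≠ 0 := fun h => h2 (by rw [sq_sub_sq, h, zero_mul])
    rw [(nf_kA_values hc hcf hr a _ _).1, (nf_kA_values hc hcf hr a _ _).2.1, if_pos rfl, if_pos rfl,
      (nf_B_singleton hc hcf hr a d).1, (nf_B_singleton hc hcf hr a d).2.1, if_neg d.2, hI, zeta_one,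
      zeta_neg_one]
    push_cast
    rw [sq_sub_sq]
    field_simp
    ring

/-- The integrable part of the second sum of the resonant field of degree five. -/
theorem tsum_kB_zero_one (hc : 20 ≤ c) (hcf : CoeffBound c r kirC) (hr : 2 ≤ r) {s : ℝ}
    (hs : 0 ≤ s) (z : Ell2 s) (a : ℕ+) :
    ∑' p : ℕ+ × ℕ+, ((nf r kirC r).kB a [(0, p.1), (1, p.2)] : ℂ)
        * (zeta z (0, p.1) * zeta z (1, p.2))
      = z a ^ 2 * (13 / (32 * (a : ℂ)) * ((‖z a‖ ^ 2 : ℝ) : ℂ) + 1 / 8 *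
        ∑' d : {d : ℕ+ // d ≠ a},
          (3 / (d : ℂ) + (d : ℂ) / ((d : ℂ) ^ 2 - (a : ℂ) ^ 2)) * ((‖z d‖ ^ 2 : ℝ) : ℂ)) := by
  obtain ⟨hsum, -⟩ := tsum_fin_two (g := fun j => (nf r kirC r).kB a (List.ofFn j))
    (summable_zeta hs z).1 fun j => (maj_nf hc hcf le_rfl a).2.2.2.abs_ofFn_le hc j
  have hofFn (x y : ZIndex) : List.ofFn ![x, y] = [x, y] := rfl
  rw [tsum_snd_eq a fun p hp => by
      rw [(nf_kB_values hc hcf hr a _ _).1, if_neg hp, Complex.ofReal_zero, zero_mul]]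
  have hinj : Function.Injective fun b : ℕ+ => (b, a) := fun x y h => (Prod.ext_iff.1 h).1
  have s1 := (hsum 0 1).comp_injective hinj
  simp only [Function.comp_def, hofFn] at s1
  have hI (b : ℕ+) : ((‖z b‖ ^ 2 : ℝ) : ℂ) = z b * conj (z b) := zeta_zero z b
  have ha := coe_pnat_ne_zero a
  rw [tsum_eq_add_tsum_ne s1 a, mul_add, ← tsum_mul_left, ← tsum_mul_left]
  congr 1
  -- On the diagonal the nonresonant part contributes only 1/(32a), which with 3/(8a) makes
  -- 13/(32a).
  · rw [(nf_kB_values hc hcf hr a _ _).1, if_pos rfl, (nf_B_singleton hc hcf hr a a).1,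
      (nf_B_singleton hc hcf hr a a).2.1, if_pos rfl, hI, zeta_one, zeta_zero]
    push_cast
    field_simp
    ring
  · refine tsum_congr fun d => ?_
    obtain ⟨h1, h2⟩ := coe_ne d.2
    have h3 : ((d : ℕ+) : ℂ) + a ≠ 0 := fun h => h2 (by rw [sq_sub_sq, h, zero_mul])
    have h3' : (a : ℂ) + ((d : ℕ+) : ℂ) ≠ 0 := by rwa [add_comm]
    have h1' : (a : ℂ) - ((d : ℕ+) : ℂ) ≠ 0 := by rwa [← neg_sub, neg_ne_zero]
    have hd := coe_pnat_ne_zero (d : ℕ+)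
    rw [(nf_kB_values hc hcf hr a _ _).1, if_pos rfl, (nf_B_singleton hc hcf hr d a).1,
      (nf_B_singleton hc hcf hr d a).2.1, if_neg d.2.symm, hI, zeta_one, zeta_zero]
    push_cast
    -- Partial fractions bring the two divisors of B_d, at z_a² and z̄_a², over the common
    -- denominator d² - a².
    have e : (d : ℂ) / ((d : ℂ) ^ 2 - (a : ℂ) ^ 2)
        = 1 / 2 * (1 / ((a : ℂ) + d) - 1 / ((a : ℂ) - d)) := by
      rw [sq_sub_sq]
      field_simp
      ring
    rw [e]
    field_simp
    ring

/-- The coefficient of an ordered pair depends on its first index alone. Averaging with the swapped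
pair gives 1/b₁ + 1/b₂ = a/(b₁b₂) when b₁ + b₂ = a. -/
theorem tsum_kB_one_one (hc : 20 ≤ c) (hcf : CoeffBound c r kirC) (hr : 2 ≤ r) {s : ℝ}
    (hs : 0 ≤ s) (z : Ell2 s) (a : ℕ+) :
    ∑' p : ℕ+ × ℕ+, ((nf r kirC r).kB a [(1, p.1), (1, p.2)] : ℂ)
        * (zeta z (1, p.1) * zeta z (1, p.2))
      = 3 * (a : ℂ) / 32 * ∑' p : {p : ℕ+ × ℕ+ // p.1 + p.2 = a},
        z p.1.1 ^ 2 * z p.1.2 ^ 2 / ((p.1.1 : ℂ) * (p.1.2 : ℂ)) := by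
  obtain ⟨hsum, -⟩ := tsum_fin_two (g := fun j => (nf r kirC r).kB a (List.ofFn j))
    (summable_zeta hs z).1 fun j => (maj_nf hc hcf le_rfl a).2.2.2.abs_ofFn_le hc j
  have s1 : Summable fun p : ℕ+ × ℕ+ => ((nf r kirC r).kB a [(1, p.1), (1, p.2)] : ℂ)
        * (zeta z (1, p.1) * zeta z (1, p.2)) := hsum 1 1
  have s2 := (Equiv.prodComm ℕ+ ℕ+).summable_iff.2 s1
  have h1 := (Equiv.prodComm ℕ+ ℕ+).tsum_eq fun p : ℕ+ × ℕ+ =>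
    ((nf r kirC r).kB a [(1, p.1), (1, p.2)] : ℂ) * (zeta z (1, p.1) * zeta z (1, p.2))
  have h2 := Summable.tsum_add s1 s2
  have h3 : ∑' p : {p : ℕ+ × ℕ+ // p.1 + p.2 = a},
        z p.1.1 ^ 2 * z p.1.2 ^ 2 / ((p.1.1 : ℂ) * (p.1.2 : ℂ))
      = ∑' p : ℕ+ × ℕ+, {p : ℕ+ × ℕ+ | p.1 + p.2 = a}.indicator
        (fun p => z p.1 ^ 2 * z p.2 ^ 2 / ((p.1 : ℂ) * (p.2 : ℂ))) p :=
    tsum_subtype {p : ℕ+ × ℕ+ | p.1 + p.2 = a}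
      fun p => z p.1 ^ 2 * z p.2 ^ 2 / ((p.1 : ℂ) * (p.2 : ℂ))
  have h4 : ∑' p : ℕ+ × ℕ+, (((nf r kirC r).kB a [(1, p.1), (1, p.2)] : ℂ)
        * (zeta z (1, p.1) * zeta z (1, p.2))
        + ((nf r kirC r).kB a [(1, p.2), (1, p.1)] : ℂ) * (zeta z (1, p.2) * zeta z (1, p.1)))
      = 3 * (a : ℂ) / 16 * ∑' p : ℕ+ × ℕ+, {p : ℕ+ × ℕ+ | p.1 + p.2 = a}.indicator
        (fun p => z p.1 ^ 2 * z p.2 ^ 2 / ((p.1 : ℂ) * (p.2 : ℂ))) p := by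
    rw [← tsum_mul_left]
    refine tsum_congr fun p => ?_
    rw [(nf_kB_values hc hcf hr a _ _).2.1, (nf_kB_values hc hcf hr a _ _).2.1, add_comm p.2 p.1]
    by_cases h : p.1 + p.2 = a
    · have hp1 := coe_pnat_ne_zero p.1
      have hp2 := coe_pnat_ne_zero p.2
      rw [if_pos h, if_pos h, indicator_of_mem (show p ∈ {p : ℕ+ × ℕ+ | p.1 + p.2 = a} from h), ← h,
        zeta_one, zeta_one]
      push_cast
      field_simp
      ring
    · rw [if_neg h, if_neg h, indicator_of_notMem (show p ∉ {p : ℕ+ × ℕ+ | p.1 + p.2 = a} from h)]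
      simp
  rw [h3]
  have h5 : ∑' p : ℕ+ × ℕ+, ((nf r kirC r).kB a [(1, p.2), (1, p.1)] : ℂ)
      * (zeta z (1, p.2) * zeta z (1, p.1)) = ∑' p : ℕ+ × ℕ+,
        ((nf r kirC r).kB a [(1, p.1), (1, p.2)] : ℂ) * (zeta z (1, p.1) * zeta z (1, p.2)) := h1
  have h6 := h2.symm.trans h4
  change _ + ∑' p : ℕ+ × ℕ+, ((nf r kirC r).kB a [(1, p.2), (1, p.1)] : ℂ)
      * (zeta z (1, p.2) * zeta z (1, p.1)) = _ at h6
  rw [h5] at h6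
  linear_combination (1 / 2) * h6

/-- The two orders of z_b² z̄_c² have coefficients of opposite sign, and 1/c - 1/b = a/(bc) when b -
c = a. -/
theorem tsum_kB_mixed (hc : 20 ≤ c) (hcf : CoeffBound c r kirC) (hr : 2 ≤ r) {s : ℝ}
    (hs : 0 ≤ s) (z : Ell2 s) (a : ℕ+) :
    ∑' p : ℕ+ × ℕ+, ((nf r kirC r).kB a [(1, p.1), (-1, p.2)] : ℂ)
        * (zeta z (1, p.1) * zeta z (-1, p.2))
      + ∑' p : ℕ+ × ℕ+, ((nf r kirC r).kB a [(-1, p.1), (1, p.2)] : ℂ)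
        * (zeta z (-1, p.1) * zeta z (1, p.2))
      = 3 * (a : ℂ) / 32 * ∑' p : {p : ℕ+ × ℕ+ // p.1 = p.2 + a},
        2 * z p.1.1 ^ 2 * conj (z p.1.2) ^ 2 / ((p.1.1 : ℂ) * (p.1.2 : ℂ)) := by
  obtain ⟨hsum, -⟩ := tsum_fin_two (g := fun j => (nf r kirC r).kB a (List.ofFn j))
    (summable_zeta hs z).1 fun j => (maj_nf hc hcf le_rfl a).2.2.2.abs_ofFn_le hc j
  have s1 : Summable fun p : ℕ+ × ℕ+ => ((nf r kirC r).kB a [(1, p.1), (-1, p.2)] : ℂ)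
        * (zeta z (1, p.1) * zeta z (-1, p.2)) := hsum 1 (-1)
  have s2 : Summable fun p : ℕ+ × ℕ+ => ((nf r kirC r).kB a [(-1, p.2), (1, p.1)] : ℂ)
        * (zeta z (-1, p.2) * zeta z (1, p.1)) :=
    (Equiv.prodComm ℕ+ ℕ+).summable_iff.2 (hsum (-1) 1)
  have h1 : ∑' p : ℕ+ × ℕ+, ((nf r kirC r).kB a [(-1, p.2), (1, p.1)] : ℂ)
        * (zeta z (-1, p.2) * zeta z (1, p.1))
      = ∑' p : ℕ+ × ℕ+, ((nf r kirC r).kB a [(-1, p.1), (1, p.2)] : ℂ)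
        * (zeta z (-1, p.1) * zeta z (1, p.2)) :=
    (Equiv.prodComm ℕ+ ℕ+).tsum_eq fun p : ℕ+ × ℕ+ =>
      ((nf r kirC r).kB a [(-1, p.1), (1, p.2)] : ℂ) * (zeta z (-1, p.1) * zeta z (1, p.2))
  have h3 : ∑' p : {p : ℕ+ × ℕ+ // p.1 = p.2 + a},
        2 * z p.1.1 ^ 2 * conj (z p.1.2) ^ 2 / ((p.1.1 : ℂ) * (p.1.2 : ℂ))
      = ∑' p : ℕ+ × ℕ+, {p : ℕ+ × ℕ+ | p.1 = p.2 + a}.indicator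
        (fun p => 2 * z p.1 ^ 2 * conj (z p.2) ^ 2 / ((p.1 : ℂ) * (p.2 : ℂ))) p :=
    tsum_subtype {p : ℕ+ × ℕ+ | p.1 = p.2 + a}
      fun p => 2 * z p.1 ^ 2 * conj (z p.2) ^ 2 / ((p.1 : ℂ) * (p.2 : ℂ))
  rw [← h1, ← Summable.tsum_add s1 s2, h3, ← tsum_mul_left]
  refine tsum_congr fun p => ?_
  rw [(nf_kB_values hc hcf hr a _ _).2.2.1, (nf_kB_values hc hcf hr a _ _).2.2.2.1]
  by_cases h : p.1 = p.2 + a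
  · have hp1 := coe_pnat_ne_zero p.1
    have hp2 := coe_pnat_ne_zero p.2
    have ha : (a : ℂ) = p.1 - p.2 := by
      rw [h]
      push_cast
      ring
    rw [if_pos h, if_pos h, indicator_of_mem (show p ∈ {p : ℕ+ × ℕ+ | p.1 = p.2 + a} from h), ha,
      zeta_one, zeta_neg_one]
    push_cast
    field_simp
    ring
  · rw [if_neg h, if_neg h, indicator_of_notMem (show p ∉ {p : ℕ+ × ℕ+ | p.1 = p.2 + a} from h)]
    simp

end pairs

end

noncomputable section

open Ser Polynomial

/-! ### The integrable parts -/

/-- The pairing reverses signs, so they add up to zero. This necessary condition rules out most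
words of length two without any search for permutations. -/
theorem sum_fst_eq_zero {l : ℕ} {j : Fin l → ZIndex} (h : j ∈ intSetZero l) :
    ∑ k, ((j k).1 : ℤ) = 0 := by
  obtain ⟨-, σ, hσ⟩ := h
  have h1 := Equiv.sum_comp σ fun k => ((j k).1 : ℤ)
  have h2 : ∑ k, ((j k).1 : ℤ) = -∑ k, ((j (σ k)).1 : ℤ) := by
    rw [← Finset.sum_neg_distrib]
    refine Finset.sum_congr rfl fun k _ => ?_
    rw [(hσ k).1, SignType.coe_neg]
  omega

theorem sum_fst_of_mem_intSet {l : ℕ} {a : ℕ+} {j : Fin l → ZIndex} (h : j ∈ intSet l a) :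
    ∑ k, ((j k).1 : ℤ) = 1 := by
  have h1 := sum_fst_eq_zero h.2
  rw [Fin.sum_univ_castSucc] at h1
  simp only [Fin.snoc_castSucc, Fin.snoc_last, SignType.coe_neg_one] at h1
  omega

theorem mem_intSet_one (a : ℕ+) (j : Fin 1 → ZIndex) (h : j 0 = (1, a)) : j ∈ intSet 1 a := by
  have hj : j = fun _ => (1, a) := funext fun k => by rw [Subsingleton.elim k 0, h]
  subst hj
  refine ⟨by simp [resSet, resDelta], by simp [resSet, resDelta, Fin.snoc], Equiv.swap 0 1, ?_⟩
  intro k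
  fin_cases k <;> simp [Fin.snoc]

theorem mem_intSet_two (a b : ℕ+) : ![(0, b), (1, a)] ∈ intSet 2 a := by
  refine ⟨by simp [resSet, resDelta], ?_, Equiv.swap 1 2, ?_⟩
  · simp [resSet, resDelta, Fin.sum_univ_three]
  · intro k
    fin_cases k
    · rw [show Equiv.swap (1 : Fin 3) 2 ⟨0, by omega⟩ = 0 by decide]
      exact ⟨rfl, rfl⟩
    · rw [show Equiv.swap (1 : Fin 3) 2 ⟨1, by omega⟩ = 2 by decide]
      exact ⟨rfl, rfl⟩
    · rw [show Equiv.swap (1 : Fin 3) 2 ⟨2, by omega⟩ = 1 by decide]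
      exact ⟨rfl, rfl⟩

theorem mem_intSetZero_two (δ : SignType) (b : ℕ+) : ![(δ, b), (-δ, b)] ∈ intSetZero 2 := by
  refine ⟨by simp [resSet, resDelta], Equiv.swap 0 1, fun k => ?_⟩
  fin_cases k <;> simp

section lowDegree

variable {c : ℝ} {r : ℕ}

theorem nf_kB_singleton_eq_zero (hc : 20 ≤ c) (hcf : CoeffBound c r kirC) (hr : 2 ≤ r) (a : ℕ+)
    {j : ZIndex} (hj : j ≠ (1, a)) : (nf r kirC r).kB a [j] = 0 := by
  obtain ⟨δ, b⟩ := j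
  obtain ⟨-, -, -, h1, h2, h3⟩ := nf_B_singleton hc hcf hr a b
  cases δ
  · exact h3
  · exact h2
  · refine h1.trans (if_neg ?_)
    rintro rfl
    exact hj rfl

theorem compZ_resField_one (hc : 20 ≤ c) (hcf : CoeffBound c r kirC) (hr : 2 ≤ r) {s : ℝ}
    (hs : 0 ≤ s) (z : Ell2 s) (a : ℕ+) :
    (resField hc hcf 1).compZ z a = -(Complex.I / 4) * ((‖z a‖ ^ 2 : ℝ) : ℂ) * z a := by
  have hofFn (j : Fin 1 → ZIndex) : List.ofFn j = [j 0] := by simp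
  rw [resField, PolyField.compZ_ofFun (summable_zeta hs z).1]
  simp only [hofFn, (nf_A_singleton hr a _).2, Complex.ofReal_zero, zero_mul, tsum_zero]
  rw [tsum_eq_single (fun _ => ((1, a) : ZIndex)) fun j hj => ?_]
  · obtain ⟨-, -, -, h1, -⟩ := nf_B_singleton hc hcf hr a a
    rw [h1, if_pos rfl, Fin.prod_univ_one, zeta_one, Complex.ofReal_pow, ← Complex.conj_mul']
    push_cast
    ring
  · rw [nf_kB_singleton_eq_zero hc hcf hr a fun h => hj (funext fun k => by
      rw [Subsingleton.elim k 0, h]), Complex.ofReal_zero, zero_mul]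

theorem resField_one_isIntegrable (hc : 20 ≤ c) (hcf : CoeffBound c r kirC) (hr : 2 ≤ r) :
    (resField hc hcf 1).IsIntegrable := by
  have hofFn (j : Fin 1 → ZIndex) : List.ofFn j = [j 0] := by simp
  refine PolyField.ofFun_isIntegrable_of (fun j σ => (PolyField.intSetZero_perm j σ).1)
    (fun a j σ => (PolyField.intSet_perm a j σ).1) (fun a j _ => ?_) fun a j hj => ?_
  · rw [hofFn, (nf_A_singleton hr a _).2]
  · rw [hofFn]
    exact nf_kB_singleton_eq_zero hc hcf hr a fun h => hj (mem_intSet_one a j h)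

/-- Every word of length two that occurs in the first sum is already integrable, so the difference
between K_5 and Z_5 sits in the second sum alone. -/
theorem indicator_kA_two (hc : 20 ≤ c) (hcf : CoeffBound c r kirC) (hr : 2 ≤ r) (a : ℕ+) :
    (intSetZero 2).indicator (fun j => (nf r kirC r).kA a (List.ofFn j))
      = fun j => (nf r kirC r).kA a (List.ofFn j) := by
  refine indicator_eq_self.2 fun j hj => ?_
  obtain ⟨⟨δ, b⟩, ⟨δ', d⟩, rfl⟩ : ∃ x y : ZIndex, j = ![x, y] := ⟨j 0, j 1, by
    funext k
    fin_cases k <;> rfl⟩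
  rw [Function.mem_support, show List.ofFn ![((δ, b) : ZIndex), (δ', d)] = [(δ, b), (δ', d)] from rfl]
    at hj
  obtain ⟨h1, h2, h3, h4, h5, h6, h7, h8, h9⟩ := nf_kA_values hc hcf hr a b d
  cases δ <;> cases δ'
  · exact absurd h9 hj
  · exact absurd h6 hj
  · exact absurd h5 hj
  · exact absurd h8 hj
  · exact absurd h4 hj
  · obtain rfl : b = d := by
      by_contra h
      exact hj (h2.trans (if_neg h))
    exact mem_intSetZero_two (-1) b
  · exact absurd h7 hj
  · obtain rfl : b = d := by
      by_contra h
      exact hj (h1.trans (if_neg h))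
    exact mem_intSetZero_two 1 b
  · exact absurd h3 hj

theorem tsum_kB_two (hc : 20 ≤ c) (hcf : CoeffBound c r kirC) (hr : 2 ≤ r) {s : ℝ} (hs : 0 ≤ s)
    (z : Ell2 s) (a : ℕ+) :
    ∑' j : Fin 2 → ZIndex, ((nf r kirC r).kB a (List.ofFn j) : ℂ) * ∏ k, zeta z (j k)
      = z a ^ 2 * (13 / (32 * (a : ℂ)) * ((‖z a‖ ^ 2 : ℝ) : ℂ) + 1 / 8 *
          ∑' d : {d : ℕ+ // d ≠ a},
            (3 / (d : ℂ) + (d : ℂ) / ((d : ℂ) ^ 2 - (a : ℂ) ^ 2)) * ((‖z d‖ ^ 2 : ℝ) : ℂ))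
        + (3 * (a : ℂ) / 32 * (∑' p : {p : ℕ+ × ℕ+ // p.1 + p.2 = a},
            z p.1.1 ^ 2 * z p.1.2 ^ 2 / ((p.1.1 : ℂ) * (p.1.2 : ℂ)))
          + 3 * (a : ℂ) / 32 * ∑' p : {p : ℕ+ × ℕ+ // p.1 = p.2 + a},
            2 * z p.1.1 ^ 2 * conj (z p.1.2) ^ 2 / ((p.1.1 : ℂ) * (p.1.2 : ℂ))) := by
  rw [← tsum_kB_zero_one hc hcf hr hs, ← tsum_kB_one_one hc hcf hr hs,
    ← tsum_kB_mixed hc hcf hr hs,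
    (tsum_fin_two (g := fun j => (nf r kirC r).kB a (List.ofFn j))
      (summable_zeta hs z).1 fun j => (maj_nf hc hcf le_rfl a).2.2.2.abs_ofFn_le hc j).2]
  have hofFn (x y : ZIndex) : List.ofFn ![x, y] = [x, y] := rfl
  simp only [sum_signType, hofFn, (nf_kB_values hc hcf hr a _ _).2.2.2.2.1,
    (nf_kB_values hc hcf hr a _ _).2.2.2.2.2.1, (nf_kB_values hc hcf hr a _ _).2.2.2.2.2.2.1,
    (nf_kB_values hc hcf hr a _ _).2.2.2.2.2.2.2.1, (nf_kB_values hc hcf hr a _ _).2.2.2.2.2.2.2.2,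
    Complex.ofReal_zero, zero_mul, tsum_zero, zero_add]
  ring

/-- The signs of an integrable word in this sum add up to 1, which leaves one letter of sign zero
and one of sign one. The coefficient of the order (1, 0) vanishes, and in the order (0, 1) the
second letter must be z_a². -/
theorem tsum_indicator_kB_two (hc : 20 ≤ c) (hcf : CoeffBound c r kirC) (hr : 2 ≤ r) {s : ℝ}
    (hs : 0 ≤ s) (z : Ell2 s) (a : ℕ+) :
    ∑' j : Fin 2 → ZIndex, (((intSet 2 a).indicator
        (fun j => (nf r kirC r).kB a (List.ofFn j)) j : ℝ) : ℂ) * ∏ k, zeta z (j k)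
      = z a ^ 2 * (13 / (32 * (a : ℂ)) * ((‖z a‖ ^ 2 : ℝ) : ℂ) + 1 / 8 *
          ∑' d : {d : ℕ+ // d ≠ a},
            (3 / (d : ℂ) + (d : ℂ) / ((d : ℂ) ^ 2 - (a : ℂ) ^ 2)) * ((‖z d‖ ^ 2 : ℝ) : ℂ)) := by
  set f := (intSet 2 a).indicator (fun j => (nf r kirC r).kB a (List.ofFn j)) with hf
  have hle (j : Fin 2 → ZIndex) : |f j| ≤ c ^ (2 * (2 - 1)) := by
    rw [← Real.norm_eq_abs]
    exact (norm_indicator_le_norm_self _ j).trans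
      ((maj_nf hc hcf le_rfl a).2.2.2.abs_ofFn_le hc j)
  have hne {δ δ' : SignType} (h : (δ : ℤ) + δ' ≠ 1) (b d : ℕ+) : f ![(δ, b), (δ', d)] = 0 := by
    refine indicator_of_notMem (fun h1 => h ?_) _
    have h2 := sum_fst_of_mem_intSet h1
    rwa [Fin.sum_univ_two] at h2
  have h01 (b d : ℕ+) : f ![(0, b), (1, d)] = (nf r kirC r).kB a [(0, b), (1, d)] := by
    by_cases h : d = a
    · subst h
      exact indicator_of_mem (mem_intSet_two d b) _
    · have h0 := (nf_kB_values hc hcf hr a b d).1.trans (if_neg h)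
      have h1 : f ![(0, b), (1, d)] = 0 := indicator_apply_eq_zero.2 fun _ => h0
      exact h1.trans h0.symm
  have h10 (b d : ℕ+) : f ![(1, b), (0, d)] = 0 :=
    indicator_apply_eq_zero.2 fun _ => (nf_kB_values hc hcf hr a b d).2.2.2.2.2.2.1
  rw [(tsum_fin_two (summable_zeta hs z).1 hle).2, ← tsum_kB_zero_one hc hcf hr hs]
  simp only [sum_signType, h01, h10, hne (δ := 0) (δ' := 0) (by decide),
    hne (δ := 0) (δ' := -1) (by decide), hne (δ := -1) (δ' := 0) (by decide),
    hne (δ := -1) (δ' := -1) (by decide), hne (δ := -1) (δ' := 1) (by decide),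
    hne (δ := 1) (δ' := -1) (by decide), hne (δ := 1) (δ' := 1) (by decide),
    Complex.ofReal_zero, zero_mul, tsum_zero, add_zero, zero_add]

/-- The z̄_a z_a² of the second sum is z_a I_a, and the two contributions to I_a² combine to 1/64 +
13/32 = 27/64. -/
theorem intCompZ_resField_two (hc : 20 ≤ c) (hcf : CoeffBound c r kirC) (hr : 2 ≤ r) {s : ℝ}
    (hs : 0 ≤ s) (z : Ell2 s) (a : ℕ+) : (resField hc hcf 2).intCompZ z a = kirZ5 z a := by
  rw [resField, PolyField.intCompZ_ofFun (summable_zeta hs z).1, indicator_kA_two hc hcf hr,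
    tsum_kA_two hc hcf hr hs, tsum_indicator_kB_two hc hcf hr hs, kirZ5, Complex.ofReal_pow,
    ← Complex.conj_mul']
  have := coe_pnat_ne_zero a
  field_simp
  ring

theorem compZ_resField_two (hc : 20 ≤ c) (hcf : CoeffBound c r kirC) (hr : 2 ≤ r) {s : ℝ}
    (hs : 0 ≤ s) (z : Ell2 s) (a : ℕ+) : (resField hc hcf 2).compZ z a = kirK5 z a := by
  rw [kirK5, ← intCompZ_resField_two hc hcf hr hs, resField,
    PolyField.intCompZ_ofFun (summable_zeta hs z).1, PolyField.compZ_ofFun (summable_zeta hs z).1,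
    indicator_kA_two hc hcf hr, tsum_indicator_kB_two hc hcf hr hs, tsum_kB_two hc hcf hr hs]
  ring

end lowDegree

end

/-! ### The main theorem -/

theorem mainTheorem5 :
    (∃ C₀ : ℝ, ∀ r : ℕ, 2 ≤ r → IsStructureConstant r C₀) ∧
    ∀ r : ℕ, 2 ≤ r → ∀ C₀ : ℝ, IsStructureConstant r C₀ → ∀ C₁ : ℝ, C₁ = max C₀ 20 →
    ∀ s : ℝ, 0 ≤ s → ∀ ε : ℝ, 0 < ε → ε ≤ (6 * (r : ℝ) * C₁ ^ (r + 1)) ^ (-(1 / 2) : ℝ) →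
    ∃ (φ : OpenPartialHomeomorph (Ell2 s) (Ell2 s)) (Z₃ : PolyField 1)
      (K : (l : ℕ) → PolyField l) (R' : Ell2 s → Ell2 s),
      -- the transformation is a smooth change of coordinates, defined on `B_s(3ε)`,
      -- and so is its inverse
      ContDiffOn ℝ ∞ φ φ.source ∧ ContDiffOn ℝ ∞ φ.symm φ.target ∧
      phaseBall s (3 * ε) ⊆ φ.source ∧ MapsTo φ (phaseBall s (3 * ε)) (phaseBall s (4 * ε)) ∧
      phaseBall s (3 * ε) ⊆ φ.target ∧ MapsTo φ.symm (phaseBall s (3 * ε)) (phaseBall s (4 * ε)) ∧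
      -- the transformed field
      ContinuousOn R' (phaseBall s (3 * ε)) ∧
      TransformsInto φ (phaseBall s (3 * ε)) kirField (fun z a =>
        linField z a + Z₃.compZ z a + ∑ l ∈ Finset.Icc 2 r, (K l).compZ z a + R' z a) ∧
      -- closeness to the identity of the transformation and of its inverse
      (∀ z ∈ phaseBall s (3 * ε), phaseNorm s (z - φ z) ≤ 9 * C₁ * sobNorm s z ^ 3 ∧
        (z ≠ 0 → phaseNorm s (z - φ z) < 9 * C₁ * sobNorm s z ^ 3)) ∧
      (∀ w ∈ phaseBall s (3 * ε) ∪ φ '' phaseBall s (3 * ε),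
        phaseNorm s (w - φ.symm w) ≤ 9 * C₁ * sobNorm s w ^ 3 ∧
        (w ≠ 0 → phaseNorm s (w - φ.symm w) < 9 * C₁ * sobNorm s w ^ 3)) ∧
      -- the cubic field
      Z₃.IsIntegrable ∧ Z₃.IsReversible ∧
      (∀ (z : Ell2 s) (a : ℕ+),
        Z₃.compZ z a = -(Complex.I / 4) * ((‖z a‖ ^ 2 : ℝ) : ℂ) * z a ∧
        Z₃.compZbar z a = Complex.I / 4 * ((‖z a‖ ^ 2 : ℝ) : ℂ) * conj (z a)) ∧
      -- the resonant fields
      (∀ l : ℕ, 2 ≤ l → l ≤ r →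
        (K l).IsResonant ∧ (K l).IsReversible ∧ (K l).coeffNorm ≤ C₁ ^ (l ^ 2)) ∧
      -- the remainder
      (∀ z ∈ phaseBall s (3 * ε),
        phaseNorm s (R' z) ≤ (3 * C₁) ^ (r * (r + 1)) * sobNorm s z ^ (2 * r + 3) ∧
        (z ≠ 0 → phaseNorm s (R' z) < (3 * C₁) ^ (r * (r + 1)) * sobNorm s z ^ (2 * r + 3))) ∧
      -- the quintic field and its integrable part
      (∀ (z : Ell2 s) (a : ℕ+), (K 2).compZ z a = kirK5 z a ∧ (K 2).intCompZ z a = kirZ5 z a) := by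
  refine ⟨exists_isStructureConstant, ?_⟩
  rintro r hr C₀ hC C₁ rfl s hs ε hε hε'
  have hc : 20 ≤ max C₀ 20 := le_max_right _ _
  have hcf := hC.coeffBound (le_max_left C₀ 20)
  obtain ⟨φ, R', h1, h2, h3, h4, h5, h6, h7, h8, h9, h10, h11⟩ :=
    exists_transformation hc hcf hr hC (le_max_left C₀ 20) hs hε hε'
  refine ⟨φ, resField hc hcf 1, resField hc hcf, R', h1, h2, h3, h4, h5, h6, h7, ?_, h9, h10,
    resField_one_isIntegrable hc hcf hr, PolyField.ofFun_isReversible, fun z a => ?_,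
    fun l _ _ => ⟨resField_isResonant hc hcf l, PolyField.ofFun_isReversible,
      resField_coeffNorm_le hc hcf l⟩, h11,
    fun z a => ⟨compZ_resField_two hc hcf hr hs z a, intCompZ_resField_two hc hcf hr hs z a⟩⟩
  -- The constructed fields start at l = 1; the first one is split off as Z_3.
  · convert h8 using 3 with z a
    rw [Finset.Icc_eq_cons_Ioc (by omega : 1 ≤ r), Finset.sum_cons, ← add_assoc]
    rfl
  · refine ⟨compZ_resField_one hc hcf hr hs z a, ?_⟩
    rw [PolyField.compZbar_eq, compZ_resField_one hc hcf hr hs]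
    simp only [map_mul, map_neg, map_div₀, Complex.conj_I, Complex.conj_ofReal, map_ofNat]
    ring
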